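/- Let $F$ (latent feedback nodes, $|F|=k\ge 0$) and $T$ (observed nodes, $|T|=m\ge 1$) be disjoint finite sets, $n=k+m$, and write symmetric matrices on $F\cup T$ as $A=\begin{pmatrix}A_F&A_M^{\top}\\A_M&A_T\end{pmatrix}$. Let $\mathcal Q_F$ be the set of Gaussian distributions $\mathcal N(0,J^{-1})$ on $\mathbb R^{F\cup T}$ with $J\succ0$ such that the graph on $T$ with edges $\{i,j\}$, $i\ne j$, $(J_T)_{ij}\neq0$, has no cycle. For $S\succ0$ on $T$ let $\rho_{ij}=S_{ij}/\sqrt{S_{ii}S_{jj}}$; an output $\mathrm{CL}(S)$ of the Chow–Liu algorithm is given by a maximum weight spanning tree $\mathcal T$ of the complete graph on $T$ with weights $|\rho_{ij}|$ (ties broken arbitrarily): $\mathrm{CL}(S)_{ij}=S_{ij}$ if $i=j$ or $\{i,j\}\in\mathcal T$, and otherwise $\mathrm{CL}(S)_{ij}=\sqrt{S_{ii}S_{jj}}\prod_{\{l,r\}}\rho_{lr}$ over the edges of the path from $i$ to $j$ in $\mathcal T$. For $S\succ0$ on $F\cup T$, the conditioned Chow–Liu algorithm outputs $$\mathrm{CCL}(S)=\begin{pmatrix}S_F&S_M^{\top}\\S_M&\mathrm{CL}(S_T-S_MS_F^{-1}S_M^{\top})+S_MS_F^{-1}S_M^{\top}\end{pmatrix}.$$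 The latent Chow–Liu algorithm takes an empirical covariance matrix $\hat\Sigma_T\succ0$ and an information matrix $J^{(0)}$ of a distribution in $\mathcal Q_F$, puts $\Sigma^{(0)}=(J^{(0)})^{-1}$, and repeats for $t=0,1,2,\dots$: (P1) $\hat\Sigma^{(t)}=\begin{pmatrix}J_F^{(t)}&(J_M^{(t)})^{\top}\\J_M^{(t)}&\hat\Sigma_T^{-1}+J_M^{(t)}(J_F^{(t)})^{-1}(J_M^{(t)})^{\top}\end{pmatrix}^{-1}$; (P2) $\Sigma^{(t+1)}=\mathrm{CCL}(\hat\Sigma^{(t)})$, $J^{(t+1)}=(\Sigma^{(t+1)})^{-1}$. Then, for every run of the algorithm and every $t\ge0$: 1. The matrices $\hat\Sigma^{(t)}$ and $\Sigma^{(t+1)}$ are positive definite, and P2 is an exact projection: $\mathcal N(0,\Sigma^{(t+1)})\in\mathcal Q_F$ (indeed, $J^{(t+1)}\succ0$ and $J^{(t+1)}_T$ has a cycle-free graph), and it minimizes $D_{\mathrm{KL}}(\mathcal N(0,\hat\Sigma^{(t)})\,\|\,q)$ over all $q\in\mathcal Q_F$. 2. $D_{\mathrm{KL}}(\mathcal N(0,\hat\Sigma_T)\,\|\,\mathcal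 N(0,\Sigma_T^{(t+1)}))\le D_{\mathrm{KL}}(\mathcal N(0,\hat\Sigma_T)\,\|\,\mathcal N(0,\Sigma_T^{(t)}))$. 3. There is an accelerated implementation with $\mathcal O(kn^2+n^2\log n)$ complexity per iteration: there are one real-RAM program (unit cost for arithmetic operations and square roots on reals, comparisons, memory accesses, and addition and subtraction of indices; a program does not depend on the input size) and a constant $C$ such that, for all $k\ge0$, $m\ge1$ with $n\ge2$, all $\hat\Sigma_T\succ0$ and all $J^{(0)}$ as above, repeated execution of the program, started from any memory containing $k,m,\hat\Sigma_T,J^{(0)}$, computes the successive pairs $\Sigma^{(t+1)},J^{(t+1)}$ of a run of the latent Chow–Liu algorithm, each execution performing one iteration and taking at most $C(kn^2+n^2\log n)$ steps. -/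

import Mathlib

namespace LatentChowLiu

open Matrix MeasureTheory ProbabilityTheory

noncomputable section

/-! ## Gaussian models with a feedback vertex set -/

/-- The centred Gaussian distribution `N(0, S)`. -/
def gauss {V : Type} [Fintype V] [DecidableEq V] (S : Matrix V V ℝ) :
    Measure (EuclideanSpace ℝ V) :=
  multivariateGaussian 0 S

/-- The sparsity graph of a matrix: `i` and `j` are adjacent when the entry `(i, j)` is nonzero
(`i ≠ j`). -/
def sparsityGraph {V : Type} (M : Matrix V V ℝ) : SimpleGraph V :=
  SimpleGraph.fromRel fun i j => M i j ≠ 0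

/-- `J` is the information matrix of a Gaussian graphical model on the nodes `F ⊕ T` with feedback
vertex set `F`: it is positive definite, and the graph on `T` has no cycle. -/
def HasFVS {F T : Type} (J : Matrix (F ⊕ T) (F ⊕ T) ℝ) : Prop :=
  J.PosDef ∧ (sparsityGraph J.toBlocks₂₂).IsAcyclic

/-- The family `Q_F` of centred Gaussian distributions with feedback vertex set `F`. -/
def familyQ (F T : Type) [Fintype F] [Fintype T] [DecidableEq F] [DecidableEq T] :
    Set (Measure (EuclideanSpace ℝ (F ⊕ T))) :=
  {q | ∃ J : Matrix (F ⊕ T) (F ⊕ T) ℝ, HasFVS J ∧ q = gauss J⁻¹}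

/-! ## The Chow-Liu algorithm and the conditioned Chow-Liu algorithm -/

/-- Correlation coefficients. -/
def corr {V : Type} (S : Matrix V V ℝ) (i j : V) : ℝ :=
  S i j / √(S i i * S j j)

open Classical in
/-- Total weight `|ρ_ij|` of the edges of a graph (each edge occurs twice in the double sum). -/
def graphWeight {V : Type} [Fintype V] (S : Matrix V V ℝ) (G : SimpleGraph V) : ℝ :=
  (∑ i, ∑ j, if G.Adj i j then |corr S i j| else 0) / 2

/-- `G` is a maximum weight spanning tree of the complete graph with weights `|ρ_ij|`. -/
def IsMaxSpanningTree {V : Type} [Fintype V] (S : Matrix V V ℝ) (G : SimpleGraph V) : Prop :=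
  G.IsTree ∧ ∀ G' : SimpleGraph V, G'.IsTree → graphWeight S G' ≤ graphWeight S G

/-- `(C, G)` is an output (covariance matrix and tree) of the Chow-Liu algorithm on the input `S`;
it is unique up to ties between maximum weight spanning trees. -/
structure IsChowLiu {V : Type} [Fintype V] (S : Matrix V V ℝ) (G : SimpleGraph V)
    (C : Matrix V V ℝ) : Prop where
  tree : IsMaxSpanningTree S G
  diag : ∀ i, C i i = S i i
  edge : ∀ i j, G.Adj i j → C i j = S i j
  path : ∀ i j, i ≠ j → ¬ G.Adj i j → ∀ p : G.Walk i j, p.IsPath →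
    C i j = √(S i i * S j j) * (p.darts.map fun d => corr S d.fst d.snd).prod

/-- `Σ_M Σ_F⁻¹ Σ_Mᵀ`. -/
def correction {F T : Type} [Fintype F] [DecidableEq F]
    (S : Matrix (F ⊕ T) (F ⊕ T) ℝ) : Matrix T T ℝ :=
  S.toBlocks₂₁ * S.toBlocks₁₁⁻¹ * S.toBlocks₂₁ᵀ

/-- `S'` is an output `CCL(S)` of the conditioned Chow-Liu algorithm on the input `S`. -/
def IsCCL {F T : Type} [Fintype F] [Fintype T] [DecidableEq F]
    (S S' : Matrix (F ⊕ T) (F ⊕ T) ℝ) : Prop :=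
  ∃ (G : SimpleGraph T) (C : Matrix T T ℝ),
    IsChowLiu (S.toBlocks₂₂ - correction S) G C ∧
      S' = fromBlocks S.toBlocks₁₁ S.toBlocks₂₁ᵀ S.toBlocks₂₁ (C + correction S)

/-! ## The latent Chow-Liu algorithm -/

/-- Projection P1: the information matrix `Ĵ` obtained from `J` and the empirical covariance
matrix `ST`. -/
def projInfo {F T : Type} [Fintype F] [Fintype T] [DecidableEq F] [DecidableEq T]
    (ST : Matrix T T ℝ) (J : Matrix (F ⊕ T) (F ⊕ T) ℝ) : Matrix (F ⊕ T) (F ⊕ T) ℝ :=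
  fromBlocks J.toBlocks₁₁ J.toBlocks₂₁ᵀ J.toBlocks₂₁
    (ST⁻¹ + J.toBlocks₂₁ * J.toBlocks₁₁⁻¹ * J.toBlocks₂₁ᵀ)

/-- The covariance matrix `Σ̂ = Ĵ⁻¹` after projection P1. -/
def projCov {F T : Type} [Fintype F] [Fintype T] [DecidableEq F] [DecidableEq T]
    (ST : Matrix T T ℝ) (J : Matrix (F ⊕ T) (F ⊕ T) ℝ) : Matrix (F ⊕ T) (F ⊕ T) ℝ :=
  (projInfo ST J)⁻¹

/-- `(J t, S t)`, `t = 0, 1, 2, …`, are the information and covariance matrices produced by a run of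
the latent Chow-Liu algorithm on the empirical covariance matrix `ST`, started in a model of the
family. -/
structure IsRun {F T : Type} [Fintype F] [Fintype T] [DecidableEq F] [DecidableEq T]
    (ST : Matrix T T ℝ) (J S : ℕ → Matrix (F ⊕ T) (F ⊕ T) ℝ) : Prop where
  init : HasFVS (J 0)
  init_cov : S 0 = (J 0)⁻¹
  cov : ∀ t, IsCCL (projCov ST (J t)) (S (t + 1))
  info : ∀ t, J (t + 1) = (S (t + 1))⁻¹

/-! ## A real random access machine with a step count

Programs are finite, independent of the input size, and have index registers, index arrays, real
registers and real matrices. Each arithmetic operation, comparison, memory access and assignment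
costs one step; index arithmetic has only addition and truncated subtraction, and the only real
constants are integers. -/

/-- Memory contents. -/
structure Mem where
  nreg : ℕ → ℕ
  narr : ℕ → ℕ → ℕ
  rreg : ℕ → ℝ
  rarr : ℕ → ℕ → ℕ → ℝ

/-- Overwrite one index register. -/
def Mem.setIReg (s : Mem) (x v : ℕ) : Mem :=
  { s with nreg := Function.update s.nreg x v }

/-- Overwrite one entry of an index array. -/
def Mem.setIArr (s : Mem) (a i v : ℕ) : Mem :=
  { s with narr := fun a' i' => if a' = a ∧ i' = i then v else s.narr a' i' }

/-- Overwrite one real register. -/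
def Mem.setRReg (s : Mem) (x : ℕ) (v : ℝ) : Mem :=
  { s with rreg := Function.update s.rreg x v }

/-- Overwrite one entry of a real matrix. -/
def Mem.setRArr (s : Mem) (a i j : ℕ) (v : ℝ) : Mem :=
  { s with rarr := fun a' i' j' => if a' = a ∧ i' = i ∧ j' = j then v else s.rarr a' i' j' }

/-- Index expressions. -/
inductive IExp where
  | const (c : ℕ)
  | reg (x : ℕ)
  | arr (a : ℕ) (i : IExp)
  | add (e₁ e₂ : IExp)
  | sub (e₁ e₂ : IExp)

/-- Real expressions. -/
inductive RExp where
  | const (c : ℤ)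
  | reg (x : ℕ)
  | arr (a : ℕ) (i j : IExp)
  | add (e₁ e₂ : RExp)
  | sub (e₁ e₂ : RExp)
  | mul (e₁ e₂ : RExp)
  | div (e₁ e₂ : RExp)
  | sqrt (e : RExp)

/-- Tests. -/
inductive BExp where
  | ilt (e₁ e₂ : IExp)
  | rlt (e₁ e₂ : RExp)
  | not (b : BExp)
  | and (b₁ b₂ : BExp)

/-- Programs. -/
inductive Prog where
  | skip
  | setIReg (x : ℕ) (e : IExp)
  | setIArr (a : ℕ) (i e : IExp)
  | setRReg (x : ℕ) (e : RExp)
  | setRArr (a : ℕ) (i j : IExp) (e : RExp)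
  | seq (p q : Prog)
  | ite (b : BExp) (p q : Prog)
  | while (b : BExp) (p : Prog)

def IExp.eval (s : Mem) : IExp → ℕ
  | const c => c
  | reg x => s.nreg x
  | arr a i => s.narr a (i.eval s)
  | add e₁ e₂ => e₁.eval s + e₂.eval s
  | sub e₁ e₂ => e₁.eval s - e₂.eval s

def IExp.cost : IExp → ℕ
  | const _ => 1
  | reg _ => 1
  | arr _ i => i.cost + 1
  | add e₁ e₂ => e₁.cost + e₂.cost + 1
  | sub e₁ e₂ => e₁.cost + e₂.cost + 1

def RExp.eval (s : Mem) : RExp → ℝ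
  | const c => c
  | reg x => s.rreg x
  | arr a i j => s.rarr a (i.eval s) (j.eval s)
  | add e₁ e₂ => e₁.eval s + e₂.eval s
  | sub e₁ e₂ => e₁.eval s - e₂.eval s
  | mul e₁ e₂ => e₁.eval s * e₂.eval s
  | div e₁ e₂ => e₁.eval s / e₂.eval s
  | sqrt e => √(e.eval s)

def RExp.cost : RExp → ℕ
  | const _ => 1
  | reg _ => 1
  | arr _ i j => i.cost + j.cost + 1
  | add e₁ e₂ => e₁.cost + e₂.cost + 1
  | sub e₁ e₂ => e₁.cost + e₂.cost + 1
  | mul e₁ e₂ => e₁.cost + e₂.cost + 1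
  | div e₁ e₂ => e₁.cost + e₂.cost + 1
  | sqrt e => e.cost + 1

def BExp.holds (s : Mem) : BExp → Prop
  | ilt e₁ e₂ => e₁.eval s < e₂.eval s
  | rlt e₁ e₂ => e₁.eval s < e₂.eval s
  | not b => ¬ b.holds s
  | and b₁ b₂ => b₁.holds s ∧ b₂.holds s

def BExp.cost : BExp → ℕ
  | ilt e₁ e₂ => e₁.cost + e₂.cost + 1
  | rlt e₁ e₂ => e₁.cost + e₂.cost + 1
  | not b => b.cost + 1
  | and b₁ b₂ => b₁.cost + b₂.cost + 1

/-- `Exec p s c s'`: started in the memory `s`, the program `p` halts after exactly `c` steps in the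
memory `s'`. -/
inductive Exec : Prog → Mem → ℕ → Mem → Prop where
  | skip (s : Mem) : Exec .skip s 1 s
  | setIReg (x : ℕ) (e : IExp) (s : Mem) :
      Exec (.setIReg x e) s (e.cost + 1) (s.setIReg x (e.eval s))
  | setIArr (a : ℕ) (i e : IExp) (s : Mem) :
      Exec (.setIArr a i e) s (i.cost + e.cost + 1) (s.setIArr a (i.eval s) (e.eval s))
  | setRReg (x : ℕ) (e : RExp) (s : Mem) :
      Exec (.setRReg x e) s (e.cost + 1) (s.setRReg x (e.eval s))
  | setRArr (a : ℕ) (i j : IExp) (e : RExp) (s : Mem) :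
      Exec (.setRArr a i j e) s (i.cost + j.cost + e.cost + 1)
        (s.setRArr a (i.eval s) (j.eval s) (e.eval s))
  | seq {p q : Prog} {s s' s'' : Mem} {c c' : ℕ} (hp : Exec p s c s') (hq : Exec q s' c' s'') :
      Exec (.seq p q) s (c + c') s''
  | iteTrue {b : BExp} {p q : Prog} {s s' : Mem} {c : ℕ} (hb : b.holds s) (hp : Exec p s c s') :
      Exec (.ite b p q) s (b.cost + c) s'
  | iteFalse {b : BExp} {p q : Prog} {s s' : Mem} {c : ℕ} (hb : ¬ b.holds s)
      (hq : Exec q s c s') : Exec (.ite b p q) s (b.cost + c) s'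
  | whileTrue {b : BExp} {p : Prog} {s s' s'' : Mem} {c c' : ℕ} (hb : b.holds s)
      (hp : Exec p s c s') (hw : Exec (.while b p) s' c' s'') :
      Exec (.while b p) s (b.cost + c + c') s''
  | whileFalse {b : BExp} {p : Prog} {s : Mem} (hb : ¬ b.holds s) :
      Exec (.while b p) s b.cost s

/-- The real matrix number `a` of the memory contains `M` (in its upper left corner). -/
def Mem.Stores (s : Mem) (a : ℕ) {r c : ℕ} (M : Matrix (Fin r) (Fin c) ℝ) : Prop :=
  ∀ (i : Fin r) (j : Fin c), s.rarr a i j = M i j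

/-- The memory contains the sizes `k = |F|` and `m = |T|`, the empirical covariance matrix `ST` and
the blocks of the current information matrix `J`; everything else is arbitrary. -/
structure Mem.Encodes (s : Mem) {k m : ℕ} (ST : Matrix (Fin m) (Fin m) ℝ)
    (J : Matrix (Fin k ⊕ Fin m) (Fin k ⊕ Fin m) ℝ) : Prop where
  size_F : s.nreg 0 = k
  size_T : s.nreg 1 = m
  empirical : s.Stores 0 ST
  info_F : s.Stores 1 J.toBlocks₁₁
  info_M : s.Stores 2 J.toBlocks₂₁
  info_T : s.Stores 3 J.toBlocks₂₂

/-- The memory contains the blocks of the covariance matrix `S`. -/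
structure Mem.EncodesCov (s : Mem) {k m : ℕ}
    (S : Matrix (Fin k ⊕ Fin m) (Fin k ⊕ Fin m) ℝ) : Prop where
  cov_F : s.Stores 4 S.toBlocks₁₁
  cov_M : s.Stores 5 S.toBlocks₂₁
  cov_T : s.Stores 6 S.toBlocks₂₂

end

end LatentChowLiu

/-! Both divergence statements rest on one chain rule. For fixed `S`, the divergence of N(0, J⁻¹)
from N(0, S) is, up to the factor 1/2 and a constant, the loss tr(J S) − log det J (`gaussLoss`),
and Gibbs' inequality says that J = S⁻¹ minimises it. Completing the square in block form
(`gaussLoss_blocks`) splits the loss into the loss of T given F, the loss of the marginal of F, and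
a nonnegative term comparing the regression matrices of T on F. Conditioned Chow-Liu keeps the
marginal of F and the regression, so the last two terms are as small as possible, and the first is
an ordinary Chow-Liu problem for the Schur complement.

For that problem, the matrix of correlation products along a tree has an explicit inverse `treePrec`
supported on the tree. An information matrix supported on the tree sees the input covariance only on
the diagonal and on tree edges, where `treeCov` agrees with it; Gibbs' inequality for `treeCov` then
gives optimality within one tree. The optimal loss depends on the tree only through the sum of
−log(1 − ρ²) over its edges. This weight increases with |ρ|, and an edge exchange argument
(`IsMaxTree.mono`) shows that a maximum tree for |ρ| is also one for it. A general acyclic graph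
extends to a spanning tree.

The decrease of the observed divergence is the alternating minimisation argument of EM: in the chain
rule with F and T interchanged, P1 keeps the conditional law of F given T and replaces only the
marginal of T (`gaussLoss_marginal_le`).

For the complexity, no m × m matrix has to be inverted. The k × k blocks are inverted by
Gauss-Jordan exchange, which needs no pivoting for positive definite matrices; Prim's algorithm on
the dense graph takes O(m²) steps and yields the tree covariances on the way; J_T has a closed
formula, and J_M, J_F follow by multiplication. Every loop nest has volume O((k + 1) n²), so the
logarithm serves only to absorb the n² term. -/

namespace LatentChowLiu

open Matrix MeasureTheory ProbabilityTheory

noncomputable section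

/-! ### Densities and Kullback-Leibler divergence of centred Gaussians. -/

section Gaussian

variable {V : Type} [Fintype V]

/-- The quadratic form of a matrix on Euclidean space. -/
def quadForm (P : Matrix V V ℝ) (x : EuclideanSpace ℝ V) : ℝ :=
  x.ofLp ⬝ᵥ P *ᵥ x.ofLp

/-- The density of the standard Gaussian distribution at the origin. -/
def gaussConst (V : Type) [Fintype V] : ℝ := (2 * Real.pi) ^ (-(Fintype.card V : ℝ) / 2)

theorem gaussConst_pos : 0 < gaussConst V := by
  unfold gaussConst; positivity

/-- Taking `t = 0` yields the normalising constant; general `t` identifies the standard Gaussian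
with its density through the characteristic function. -/
theorem integral_gaussian_cexp (t : EuclideanSpace ℝ V) :
    ∫ x : EuclideanSpace ℝ V, Complex.exp (-(1/2 : ℂ) * ‖x‖ ^ 2 + Complex.I * inner ℝ t x) =
      (gaussConst V : ℂ)⁻¹ * Complex.exp (- ‖t‖ ^ 2 / 2) := by
  have h := GaussianFourier.integral_cexp_neg_mul_sq_norm_add (b := (1/2 : ℂ)) (by norm_num)
    Complex.I t
  rw [h]
  congr 1
  · unfold gaussConst
    rw [show (Real.pi : ℂ) / (1 / 2) = ((2 * Real.pi : ℝ) : ℂ) by push_cast; ring]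
    rw [show ((Module.finrank ℝ (EuclideanSpace ℝ V) : ℂ) / 2)
      = (((Fintype.card V : ℝ) / 2 : ℝ) : ℂ) by simp]
    rw [← Complex.ofReal_cpow (by positivity), ← Complex.ofReal_inv, neg_div, Real.rpow_neg
      (by positivity), inv_inv]
  · congr 1
    rw [Complex.I_sq]; ring

theorem integrable_gaussian :
    Integrable (fun x : EuclideanSpace ℝ V => Real.exp (-(‖x‖ ^ 2) / 2)) := by
  have h := (GaussianFourier.integrable_cexp_neg_mul_sq_norm_add (V := EuclideanSpace ℝ V)
    (b := (1/2 : ℂ)) (by norm_num) 0 0).re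
  refine h.congr (ae_of_all _ fun x => ?_)
  simp only [zero_mul, add_zero]
  rw [show (-(1/2 : ℂ) * (‖x‖ : ℂ) ^ 2) = ((-(‖x‖ ^ 2) / 2 : ℝ) : ℂ) by push_cast; ring,
    ← Complex.ofReal_exp]
  exact Complex.ofReal_re _

theorem integral_gaussian :
    ∫ x : EuclideanSpace ℝ V, Real.exp (-(‖x‖ ^ 2) / 2) = (gaussConst V)⁻¹ := by
  have h := integral_gaussian_cexp (V := V) 0
  simp only [inner_zero_left, Complex.ofReal_zero, mul_zero, add_zero, norm_zero] at h
  have h2 : ∀ x : EuclideanSpace ℝ V, Complex.exp (-(1/2 : ℂ) * (‖x‖ : ℂ) ^ 2)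
      = ((Real.exp (-(‖x‖ ^ 2) / 2) : ℝ) : ℂ) := by
    intro x
    rw [Complex.ofReal_exp]; congr 1; push_cast; ring
  simp_rw [h2] at h
  rw [integral_complex_ofReal] at h
  apply Complex.ofReal_injective
  rw [h]; simp

/-- The standard Gaussian density as a measure. -/
theorem stdGaussian_eq_withDensity :
    stdGaussian (EuclideanSpace ℝ V) = volume.withDensity fun x =>
      ENNReal.ofReal (gaussConst V * Real.exp (-(‖x‖ ^ 2) / 2)) := by
  have hc := gaussConst_pos (V := V)
  have hint := (integrable_gaussian (V := V)).const_mul (gaussConst V)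
  have hprob : IsProbabilityMeasure (volume.withDensity fun x : EuclideanSpace ℝ V =>
      ENNReal.ofReal (gaussConst V * Real.exp (-(‖x‖ ^ 2) / 2))) := by
    constructor
    rw [withDensity_apply _ MeasurableSet.univ, Measure.restrict_univ,
      ← ofReal_integral_eq_lintegral_ofReal hint (ae_of_all _ fun x => by positivity),
      integral_const_mul, integral_gaussian, mul_inv_cancel₀ hc.ne', ENNReal.ofReal_one]
  apply Measure.ext_of_charFun (E := EuclideanSpace ℝ V)
  ext t
  rw [charFun_stdGaussian, charFun_apply, integral_withDensity_eq_integral_toReal_smul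
    (by fun_prop) (ae_of_all _ fun x => ENNReal.ofReal_lt_top)]
  have h2 : ∀ x : EuclideanSpace ℝ V,
      (ENNReal.ofReal (gaussConst V * Real.exp (-(‖x‖ ^ 2) / 2))).toReal •
        Complex.exp (inner ℝ x t * Complex.I) =
      (gaussConst V : ℂ) * Complex.exp (-(1/2 : ℂ) * ‖x‖ ^ 2 + Complex.I * inner ℝ t x) := by
    intro x
    rw [ENNReal.toReal_ofReal (by positivity), Complex.real_smul, Complex.exp_add,
      Complex.ofReal_mul, Complex.ofReal_exp, real_inner_comm]
    push_cast
    rw [mul_assoc]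
    congr 3
    · ring
    · ring_nf
  simp_rw [h2]
  rw [integral_const_mul, integral_gaussian_cexp, mul_inv_cancel_left₀]
  exact_mod_cast hc.ne'

theorem continuous_quadForm (P : Matrix V V ℝ) : Continuous (quadForm P) := by
  unfold quadForm
  simp only [dotProduct, mulVec]
  fun_prop

theorem quadForm_eq_sum (P : Matrix V V ℝ) (x : EuclideanSpace ℝ V) :
    quadForm P x = ∑ i, ∑ j, P i j * (x i * x j) := by
  unfold quadForm
  simp only [dotProduct, mulVec, Finset.mul_sum]
  exact Finset.sum_congr rfl fun i _ => Finset.sum_congr rfl fun j _ => by ring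

variable [DecidableEq V]

/-- The density of a nondegenerate centred Gaussian distribution. -/
theorem gauss_eq_withDensity {S : Matrix V V ℝ} (hS : S.PosDef) :
    gauss S = volume.withDensity fun x =>
      ENNReal.ofReal ((√S.det)⁻¹ * gaussConst V * Real.exp (-(quadForm S⁻¹ x) / 2)) := by
  have hc := gaussConst_pos (V := V)
  -- `multivariateGaussian` is the image of the standard Gaussian under the symmetric square root of
  -- `S`, so the density comes from a linear change of variables with Jacobian √det S.
  open scoped MatrixOrder in
  set M := CFC.sqrt S with hM
  open scoped MatrixOrder in
  have hMM : M * M = S := CFC.sqrt_mul_sqrt_self _ hS.posSemidef.nonneg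
  open scoped MatrixOrder in
  have hMs : Mᵀ = M := by
    have := (CFC.sqrt_nonneg S).isSelfAdjoint
    rwa [IsSelfAdjoint, star_eq_conjTranspose, conjTranspose_eq_transpose_of_trivial] at this
  have hdet : M.det = √S.det := by
    have := hS.posSemidef.det_sqrt
    simpa using this
  have hdpos : 0 < √S.det := Real.sqrt_pos.2 hS.det_pos
  have hMu : IsUnit M.det := by rw [hdet]; exact hdpos.ne'.isUnit
  have hMSM : M * S⁻¹ * M = 1 := by
    rw [← hMM, Matrix.mul_inv_rev, ← Matrix.mul_assoc, Matrix.mul_nonsing_inv _ hMu, one_mul,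
      Matrix.nonsing_inv_mul _ hMu]
  set L := toEuclideanCLM (n := V) (𝕜 := ℝ) M with hL
  have hLdet : LinearMap.det (L : EuclideanSpace ℝ V →ₗ[ℝ] EuclideanSpace ℝ V) = √S.det := by
    rw [hL, coe_toEuclideanCLM_eq_toEuclideanLin, ← hdet]
    rw [Matrix.toEuclideanLin, Matrix.toLpLin_eq_toLin, LinearMap.det_toLin]
  have hmap : Measure.map L (volume : Measure (EuclideanSpace ℝ V)) =
      ENNReal.ofReal (√S.det)⁻¹ • volume := by
    have := Measure.map_linearMap_addHaar_eq_smul_addHaar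
      (volume : Measure (EuclideanSpace ℝ V)) (f := (L : EuclideanSpace ℝ V →ₗ[ℝ] _))
      (by rw [hLdet]; exact hdpos.ne')
    rw [hLdet, abs_of_pos (inv_pos.2 hdpos)] at this
    exact this
  have hquad : ∀ x, quadForm S⁻¹ (L x) = ‖x‖ ^ 2 := by
    intro x
    rw [EuclideanSpace.real_norm_sq_eq]
    unfold quadForm
    rw [hL, Matrix.ofLp_toEuclideanCLM]
    rw [Matrix.mulVec_mulVec, dotProduct_comm, dotProduct_mulVec, ← mulVec_transpose,
      Matrix.mulVec_mulVec, hMs, ← Matrix.mul_assoc, hMSM, one_mulVec]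
    simp [dotProduct, sq]
  unfold gauss multivariateGaussian
  rw [stdGaussian_eq_withDensity]
  simp only [zero_add]
  change Measure.map L _ = _
  have hLm : Measurable L := L.continuous.measurable
  have hqm : Measurable (quadForm S⁻¹) := (continuous_quadForm _).measurable
  ext s hs
  rw [Measure.map_apply hLm hs, withDensity_apply _ (hLm hs), withDensity_apply _ hs]
  have h1 : ∀ x, ENNReal.ofReal (gaussConst V * Real.exp (-(‖x‖ ^ 2) / 2)) =
      (fun y => ENNReal.ofReal (gaussConst V * Real.exp (-(quadForm S⁻¹ y) / 2))) (L x) := by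
    intro x; simp only [hquad]
  simp_rw [h1]
  rw [← setLIntegral_map (f := fun y => ENNReal.ofReal (gaussConst V *
    Real.exp (-(quadForm S⁻¹ y) / 2))) hs (by fun_prop) hLm, hmap, Measure.restrict_smul,
    lintegral_smul_measure, smul_eq_mul, ← lintegral_const_mul _ (by fun_prop)]
  congr 1; ext y
  rw [mul_assoc, ENNReal.ofReal_mul (inv_nonneg.2 hdpos.le)]

theorem integrable_mul_gauss (S : Matrix V V ℝ) (i j : V) :
    Integrable (fun x : EuclideanSpace ℝ V => x i * x j) (gauss S) := by
  unfold gauss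
  have h : ∀ i : V, MemLp (fun x : EuclideanSpace ℝ V => x i) 2 (multivariateGaussian 0 S) := by
    intro i
    exact (EuclideanSpace.proj (𝕜 := ℝ) i).comp_memLp' IsGaussian.memLp_two_id
  exact (h i).integrable_mul (h j)

theorem integral_mul_gauss {S : Matrix V V ℝ} (hS : S.PosSemidef) (i j : V) :
    ∫ x : EuclideanSpace ℝ V, x i * x j ∂(gauss S) = S i j := by
  unfold gauss
  have h : ∀ i : V, MemLp (fun x : EuclideanSpace ℝ V => x i) 2 (multivariateGaussian 0 S) := by
    intro i
    exact (EuclideanSpace.proj (𝕜 := ℝ) i).comp_memLp' IsGaussian.memLp_two_id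
  have h0 : ∀ i : V, ∫ x : EuclideanSpace ℝ V, x i ∂(multivariateGaussian 0 S) = 0 := by
    intro i
    have := (EuclideanSpace.proj (𝕜 := ℝ) i).integral_comp_id_comm
      (μ := multivariateGaussian 0 S) IsGaussian.integrable_id
    simpa using this
  have := covariance_eval_multivariateGaussian (μ := (0 : EuclideanSpace ℝ V)) hS i j
  rw [covariance_eq_sub (h i) (h j), h0, h0] at this
  simpa using this

theorem integrable_quadForm (S P : Matrix V V ℝ) : Integrable (quadForm P) (gauss S) := by
  rw [show quadForm P = fun x => ∑ i, ∑ j, P i j * (x i * x j) from funext (quadForm_eq_sum P)]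
  exact integrable_finsetSum _ fun i _ => integrable_finsetSum _ fun j _ =>
    (integrable_mul_gauss S i j).const_mul _

theorem integral_quadForm {S : Matrix V V ℝ} (hS : S.PosDef) (P : Matrix V V ℝ) :
    ∫ x, quadForm P x ∂(gauss S) = (P * S).trace := by
  have hint : ∀ i j, Integrable (fun x : EuclideanSpace ℝ V => P i j * (x i * x j)) (gauss S) :=
    fun i j => (integrable_mul_gauss S i j).const_mul _
  calc ∫ x, quadForm P x ∂(gauss S)
      = ∫ x, ∑ i, ∑ j, P i j * (x i * x j) ∂(gauss S) :=
        integral_congr_ae (ae_of_all _ fun x => quadForm_eq_sum P x)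
    _ = ∑ i, ∫ x, ∑ j, P i j * (x i * x j) ∂(gauss S) :=
        integral_finsetSum _ fun i _ => integrable_finsetSum _ fun j _ => hint i j
    _ = ∑ i, ∑ j, P i j * S j i := by
        refine Finset.sum_congr rfl fun i _ => (integral_finsetSum _ fun j _ => hint i j).trans
          (Finset.sum_congr rfl fun j _ => ?_)
        rw [integral_const_mul, integral_mul_gauss hS.posSemidef, ← hS.isHermitian.apply i j]
        simp
    _ = (P * S).trace := by simp only [trace, diag, mul_apply]

/-- The log-likelihood ratio is a constant plus half the difference of two quadratic forms, and the
mean of a quadratic form is a trace. Absolute continuity and integrability accompany the value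
because the divergence formula needs them. -/
theorem llr_gauss {A B : Matrix V V ℝ} (hA : A.PosDef) (hB : B.PosDef) :
    gauss A ≪ gauss B ∧ Integrable (llr (gauss A) (gauss B)) (gauss A) ∧
      ∫ x, llr (gauss A) (gauss B) x ∂(gauss A) =
        ((B⁻¹ * A).trace - Fintype.card V + Real.log B.det - Real.log A.det) / 2 := by
  have hc := gaussConst_pos (V := V)
  have hAd : 0 < √A.det := Real.sqrt_pos.2 hA.det_pos
  have hBd : 0 < √B.det := Real.sqrt_pos.2 hB.det_pos
  have : IsProbabilityMeasure (gauss A) := by unfold gauss; infer_instance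
  have : IsProbabilityMeasure (gauss B) := by unfold gauss; infer_instance
  have hqA : Measurable (quadForm A⁻¹) := (continuous_quadForm _).measurable
  have hqB : Measurable (quadForm B⁻¹) := (continuous_quadForm _).measurable
  set r : EuclideanSpace ℝ V → ℝ := fun x =>
    √B.det * (√A.det)⁻¹ * Real.exp ((quadForm B⁻¹ x - quadForm A⁻¹ x) / 2) with hr
  have hrm : Measurable r := by fun_prop
  have hAB : gauss A = (gauss B).withDensity fun x => ENNReal.ofReal (r x) := by
    rw [gauss_eq_withDensity hA, gauss_eq_withDensity hB, ← withDensity_mul _ (by fun_prop)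
      (by fun_prop)]
    congr 1
    ext x
    rw [Pi.mul_apply, ← ENNReal.ofReal_mul (by positivity)]
    congr 1
    simp only [hr]
    have : Real.exp (-quadForm A⁻¹ x / 2) = Real.exp (-quadForm B⁻¹ x / 2) *
        Real.exp ((quadForm B⁻¹ x - quadForm A⁻¹ x) / 2) := by
      rw [← Real.exp_add]; congr 1; ring
    rw [this]
    field_simp
  have hac : gauss A ≪ gauss B := by
    rw [hAB]; exact withDensity_absolutelyContinuous _ _
  have hllr : llr (gauss A) (gauss B) =ᵐ[gauss A] fun x =>
      (Real.log B.det - Real.log A.det) / 2 + (quadForm B⁻¹ x - quadForm A⁻¹ x) / 2 := by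
    have h1 : (gauss A).rnDeriv (gauss B) =ᵐ[gauss B] fun x => ENNReal.ofReal (r x) := by
      conv_lhs => rw [hAB]
      exact Measure.rnDeriv_withDensity _ (by fun_prop)
    filter_upwards [hac.ae_le h1] with x hx
    rw [llr, hx, ENNReal.toReal_ofReal (by positivity)]
    simp only [hr]
    rw [Real.log_mul (by positivity) (by positivity), Real.log_exp,
      Real.log_mul (by positivity) (by positivity), Real.log_inv, Real.log_sqrt hB.det_pos.le,
      Real.log_sqrt hA.det_pos.le]
    ring
  have hint : Integrable (fun x : EuclideanSpace ℝ V => (Real.log B.det - Real.log A.det) / 2 +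
      (quadForm B⁻¹ x - quadForm A⁻¹ x) / 2) (gauss A) :=
    (integrable_const _).add (((integrable_quadForm A _).sub (integrable_quadForm A _)).div_const _)
  refine ⟨hac, hint.congr hllr.symm, ?_⟩
  rw [integral_congr_ae hllr]
  have hq : ∫ x, (quadForm B⁻¹ x - quadForm A⁻¹ x) / 2 ∂(gauss A) =
      ((B⁻¹ * A).trace - Fintype.card V) / 2 := by
    rw [integral_div]
    have h1 : ∫ x, (quadForm B⁻¹ x - quadForm A⁻¹ x) ∂(gauss A) = _ :=
      integral_sub (integrable_quadForm A _) (integrable_quadForm A _)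
    rw [h1, integral_quadForm hA, integral_quadForm hA,
      Matrix.nonsing_inv_mul _ (hA.det_pos.ne'.isUnit), trace_one]
  have h2 : ∫ x, ((Real.log B.det - Real.log A.det) / 2 +
      (quadForm B⁻¹ x - quadForm A⁻¹ x) / 2) ∂(gauss A) = _ := integral_add (integrable_const _)
    (((integrable_quadForm A _).sub (integrable_quadForm A _)).div_const _)
  rw [h2, hq, integral_const]
  simp
  ring

/-- The Kullback-Leibler divergence between centred Gaussian distributions. -/
theorem klDiv_gauss {A B : Matrix V V ℝ} (hA : A.PosDef) (hB : B.PosDef) :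
    InformationTheory.klDiv (gauss A) (gauss B) = ENNReal.ofReal
      (((B⁻¹ * A).trace - Fintype.card V + Real.log B.det - Real.log A.det) / 2) := by
  have : IsProbabilityMeasure (gauss A) := by unfold gauss; infer_instance
  have : IsProbabilityMeasure (gauss B) := by unfold gauss; infer_instance
  obtain ⟨h1, h2, h3⟩ := llr_gauss hA hB
  rw [InformationTheory.klDiv_of_ac_of_integrable h1 h2, h3]
  simp

/-- Gibbs' inequality for centred Gaussian distributions. -/
theorem trace_sub_card_add_log_nonneg {A B : Matrix V V ℝ} (hA : A.PosDef) (hB : B.PosDef) :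
    0 ≤ (B⁻¹ * A).trace - Fintype.card V + Real.log B.det - Real.log A.det := by
  have : IsProbabilityMeasure (gauss A) := by unfold gauss; infer_instance
  have : IsProbabilityMeasure (gauss B) := by unfold gauss; infer_instance
  obtain ⟨h1, h2, h3⟩ := llr_gauss hA hB
  have h := InformationTheory.integral_llr_add_sub_measure_univ_nonneg h1 h2
  rw [h3] at h
  simp at h
  linarith

end Gaussian

/-! ### The loss function that replaces the divergence. -/

section Loss

variable {V : Type} [Fintype V] [DecidableEq V]

/-- The part of the Gaussian cross-entropy that depends on the information matrix `J`. -/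
def gaussLoss (S J : Matrix V V ℝ) : ℝ := (J * S).trace - Real.log J.det

/-- With `S` fixed, the divergence is half the loss plus a term depending only on `S`, so minimising
divergences reduces to a real inequality between losses. -/
theorem klDiv_gauss_inv_le {S J J' : Matrix V V ℝ} (hS : S.PosDef) (hJ : J.PosDef)
    (hJ' : J'.PosDef) (h : gaussLoss S J ≤ gaussLoss S J') :
    InformationTheory.klDiv (gauss S) (gauss J⁻¹) ≤
      InformationTheory.klDiv (gauss S) (gauss J'⁻¹) := by
  have hu := hJ.det_pos.ne'.isUnit
  have hu' := hJ'.det_pos.ne'.isUnit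
  rw [klDiv_gauss hS hJ.inv, klDiv_gauss hS hJ'.inv, Matrix.nonsing_inv_nonsing_inv _ hu,
    Matrix.nonsing_inv_nonsing_inv _ hu', Matrix.det_nonsing_inv, Matrix.det_nonsing_inv,
    Ring.inverse_eq_inv', Real.log_inv, Real.log_inv]
  unfold gaussLoss at h
  apply ENNReal.ofReal_le_ofReal
  linarith

/-- Gibbs' inequality in terms of the loss: without a sparsity constraint the best information
matrix is the inverse covariance. -/
theorem gaussLoss_inv_le {S J : Matrix V V ℝ} (hS : S.PosDef) (hJ : J.PosDef) :
    gaussLoss S S⁻¹ ≤ gaussLoss S J := by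
  have h := trace_sub_card_add_log_nonneg hS hJ.inv
  rw [Matrix.nonsing_inv_nonsing_inv _ hJ.det_pos.ne'.isUnit, Matrix.det_nonsing_inv,
    Ring.inverse_eq_inv', Real.log_inv] at h
  unfold gaussLoss
  rw [Matrix.nonsing_inv_mul _ hS.det_pos.ne'.isUnit, trace_one, Matrix.det_nonsing_inv,
    Ring.inverse_eq_inv', Real.log_inv]
  linarith

theorem gaussLoss_submatrix {W : Type} [Fintype W] [DecidableEq W] (e : W ≃ V)
    (S J : Matrix V V ℝ) :
    gaussLoss (S.submatrix e e) (J.submatrix e e) = gaussLoss S J := by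
  unfold gaussLoss
  rw [Matrix.submatrix_mul_equiv, Matrix.det_submatrix_equiv_self]
  congr 1
  exact Fintype.sum_equiv e _ _ fun i => rfl

/-- Writing P = RᵀR and cycling the trace turns the expression into the trace of (RX) S (RX)ᵀ. -/
theorem trace_mul_conj_nonneg {W : Type} [Fintype W] [DecidableEq W] {P : Matrix V V ℝ}
    {S : Matrix W W ℝ} (hP : P.PosDef) (hS : S.PosDef) (X : Matrix V W ℝ) :
    0 ≤ (P * (X * S * Xᵀ)).trace := by
  open scoped MatrixOrder in
  obtain ⟨R, rfl⟩ : ∃ R : Matrix V V ℝ, P = Rᵀ * R := by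
    refine ⟨CFC.sqrt P, ?_⟩
    have := (CFC.sqrt_nonneg P).isSelfAdjoint
    rw [IsSelfAdjoint, star_eq_conjTranspose, conjTranspose_eq_transpose_of_trivial] at this
    rw [this, CFC.sqrt_mul_sqrt_self _ hP.posSemidef.nonneg]
  have h := (hS.posSemidef.mul_mul_conjTranspose_same (R * X)).trace_nonneg
  rw [conjTranspose_eq_transpose_of_trivial, transpose_mul] at h
  rw [Matrix.mul_assoc, Matrix.trace_mul_comm]
  simpa only [Matrix.mul_assoc] using h

end Loss

/-! ### Schur complements and the chain rule for the loss. -/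

section Blocks

variable {F T : Type}

theorem posDef_toBlocks₁₁ {M : Matrix (F ⊕ T) (F ⊕ T) ℝ} (hM : M.PosDef) :
    M.toBlocks₁₁.PosDef := hM.submatrix (e := Sum.inl) Sum.inl_injective

theorem posDef_toBlocks₂₂ {M : Matrix (F ⊕ T) (F ⊕ T) ℝ} (hM : M.PosDef) :
    M.toBlocks₂₂.PosDef := hM.submatrix (e := Sum.inr) Sum.inr_injective

theorem transpose_toBlocks₂₁ {M : Matrix (F ⊕ T) (F ⊕ T) ℝ} (hM : M.PosDef) :
    M.toBlocks₂₁ᵀ = M.toBlocks₁₂ := by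
  ext i j
  have := hM.isHermitian.apply (Sum.inl i) (Sum.inr j)
  simpa [toBlocks₂₁, toBlocks₁₂] using this

theorem transpose_of_posDef {M : Matrix T T ℝ} (hM : M.PosDef) : Mᵀ = M := by
  have := hM.isHermitian
  rwa [IsHermitian, conjTranspose_eq_transpose_of_trivial] at this

/-- Interchanging the two index sets lets each Schur complement identity serve for conditioning on T
as well as on F. -/
theorem posDef_swap {M : Matrix (F ⊕ T) (F ⊕ T) ℝ} (hM : M.PosDef) :
    (M.submatrix (Equiv.sumComm T F) (Equiv.sumComm T F)).PosDef :=
  hM.submatrix (Equiv.injective _)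

variable [Fintype F] [DecidableEq F]

theorem correction_fromBlocks (A : Matrix F F ℝ) (M : Matrix T F ℝ) (D : Matrix T T ℝ) :
    correction (fromBlocks A Mᵀ M D) = M * A⁻¹ * Mᵀ := by
  simp [correction]

theorem correction_def' {S : Matrix (F ⊕ T) (F ⊕ T) ℝ} (hS : S.PosDef) :
    correction S = S.toBlocks₂₁ * S.toBlocks₁₁⁻¹ * S.toBlocks₁₂ := by
  unfold correction
  rw [transpose_toBlocks₂₁ hS]

variable [Fintype T] [DecidableEq T]

/-- The blocks of the second block row of a left inverse. -/
theorem blocks_of_mul_eq_one {X M : Matrix (F ⊕ T) (F ⊕ T) ℝ} (h : X * M = 1) :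
    X.toBlocks₂₁ * M.toBlocks₁₁ + X.toBlocks₂₂ * M.toBlocks₂₁ = 0 ∧
      X.toBlocks₂₁ * M.toBlocks₁₂ + X.toBlocks₂₂ * M.toBlocks₂₂ = 1 := by
  rw [← fromBlocks_toBlocks X, ← fromBlocks_toBlocks M, fromBlocks_multiply,
    ← fromBlocks_one, fromBlocks_inj] at h
  exact ⟨by simpa using h.2.2.1, by simpa using h.2.2.2⟩

/-- S_M S_F⁻¹ is the regression matrix of T on F. It reappears in the information matrix as −J_T⁻¹
J_M, which makes regression matrices comparable between a covariance and an information matrix. -/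
theorem inv_toBlocks₂₁ {S : Matrix (F ⊕ T) (F ⊕ T) ℝ} (hS : S.PosDef) :
    S⁻¹.toBlocks₂₁ = -(S⁻¹.toBlocks₂₂ * (S.toBlocks₂₁ * S.toBlocks₁₁⁻¹)) := by
  have h := (blocks_of_mul_eq_one (Matrix.nonsing_inv_mul S hS.det_pos.ne'.isUnit)).1
  have hu := (posDef_toBlocks₁₁ hS).det_pos.ne'.isUnit
  have h2 := congrArg (· * S.toBlocks₁₁⁻¹) (eq_neg_of_add_eq_zero_left h)
  simp only [Matrix.neg_mul] at h2
  rwa [Matrix.mul_nonsing_inv_cancel_right _ _ hu, Matrix.mul_assoc] at h2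

theorem inv_toBlocks₂₂_mul {S : Matrix (F ⊕ T) (F ⊕ T) ℝ} (hS : S.PosDef) :
    S⁻¹.toBlocks₂₂ * (S.toBlocks₂₂ - correction S) = 1 := by
  have h := (blocks_of_mul_eq_one (Matrix.nonsing_inv_mul S hS.det_pos.ne'.isUnit)).2
  rw [inv_toBlocks₂₁ hS] at h
  rw [← h, correction_def' hS, Matrix.mul_sub]
  simp only [Matrix.neg_mul, Matrix.mul_assoc]
  abel

/-- The Schur complement of a block of the covariance matrix is the covariance matrix of the
conditional distribution. -/
theorem inv_toBlocks₂₂ {S : Matrix (F ⊕ T) (F ⊕ T) ℝ} (hS : S.PosDef) :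
    S⁻¹.toBlocks₂₂ = (S.toBlocks₂₂ - correction S)⁻¹ :=
  (Matrix.inv_eq_left_inv (inv_toBlocks₂₂_mul hS)).symm

theorem schur_eq_inv {S : Matrix (F ⊕ T) (F ⊕ T) ℝ} (hS : S.PosDef) :
    S.toBlocks₂₂ - correction S = S⁻¹.toBlocks₂₂⁻¹ :=
  (Matrix.inv_eq_right_inv (inv_toBlocks₂₂_mul hS)).symm

theorem posDef_schur {S : Matrix (F ⊕ T) (F ⊕ T) ℝ} (hS : S.PosDef) :
    (S.toBlocks₂₂ - correction S).PosDef := by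
  rw [schur_eq_inv hS]
  exact (posDef_toBlocks₂₂ hS.inv).inv

theorem det_eq_mul_schur {S : Matrix (F ⊕ T) (F ⊕ T) ℝ} (hS : S.PosDef) :
    S.det = S.toBlocks₁₁.det * (S.toBlocks₂₂ - correction S).det := by
  have hu := (posDef_toBlocks₁₁ hS).isUnit
  let _ := hu.invertible
  conv_lhs => rw [← fromBlocks_toBlocks S]
  rw [det_fromBlocks₁₁, invOf_eq_nonsing_inv, correction_def' hS]

/-- A block matrix with positive definite first block and Schur complement. -/
theorem posDef_fromBlocks {A : Matrix F F ℝ} {C : Matrix T T ℝ} (hA : A.PosDef) (hC : C.PosDef)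
    (M : Matrix T F ℝ) : (fromBlocks A Mᵀ M (C + M * A⁻¹ * Mᵀ)).PosDef := by
  let _ := hA.isUnit.invertible
  -- The Schur criterion gives semidefiniteness; the determinant, a product of two nonzero
  -- determinants, then excludes a kernel.
  have h1 : (fromBlocks A Mᵀ M (C + M * A⁻¹ * Mᵀ)).PosSemidef := by
    have := Matrix.PosDef.fromBlocks₁₁ (A := A) Mᵀ (C + M * A⁻¹ * Mᵀ) hA
    simp only [conjTranspose_eq_transpose_of_trivial, transpose_transpose] at this
    rw [this]
    simpa using hC.posSemidef
  rw [h1.posDef_iff_det_ne_zero, det_fromBlocks₁₁, invOf_eq_nonsing_inv]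
  simpa using ⟨hA.det_pos.ne', hC.det_pos.ne'⟩

/-- Chain rule for the Gaussian loss: the loss of the conditional distribution of `T` given `F`, the
loss of the marginal distribution of `F`, and a term that compares the regression matrices. -/
theorem gaussLoss_blocks {S J : Matrix (F ⊕ T) (F ⊕ T) ℝ} (hS : S.PosDef) (hJ : J.PosDef) :
    gaussLoss S J = gaussLoss (S.toBlocks₂₂ - correction S) J.toBlocks₂₂ +
      gaussLoss S.toBlocks₁₁ J⁻¹.toBlocks₁₁⁻¹ +
      (J.toBlocks₂₂ * ((J.toBlocks₂₂⁻¹ * J.toBlocks₂₁ + S.toBlocks₂₁ * S.toBlocks₁₁⁻¹) *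
        S.toBlocks₁₁ *
        (J.toBlocks₂₂⁻¹ * J.toBlocks₂₁ + S.toBlocks₂₁ * S.toBlocks₁₁⁻¹)ᵀ)).trace := by
  have hJT := posDef_toBlocks₂₂ hJ
  have hSF := posDef_toBlocks₁₁ hS
  have hJu := hJT.det_pos.ne'.isUnit
  have hSu := hSF.det_pos.ne'.isUnit
  have hJ0 := hJ.det_pos.ne'.isUnit
  -- The information matrix of the marginal of F is the Schur complement of J_T; this is
  -- `schur_eq_inv` with the blocks interchanged.
  have hK : J⁻¹.toBlocks₁₁⁻¹ =
      J.toBlocks₁₁ - J.toBlocks₂₁ᵀ * J.toBlocks₂₂⁻¹ * J.toBlocks₂₁ := by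
    have h := schur_eq_inv (posDef_swap hJ)
    rw [correction_def' (posDef_swap hJ), Matrix.inv_submatrix_equiv] at h
    rw [transpose_toBlocks₂₁ hJ]
    exact h.symm
  have hdet : J.det = J.toBlocks₂₂.det * (J⁻¹.toBlocks₁₁⁻¹).det := by
    have h := det_eq_mul_schur (posDef_swap hJ)
    rw [schur_eq_inv (posDef_swap hJ), Matrix.inv_submatrix_equiv,
      Matrix.det_submatrix_equiv_self] at h
    exact h
  have hKpd : (J⁻¹.toBlocks₁₁⁻¹).PosDef := (posDef_toBlocks₁₁ hJ.inv).inv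
  have htrace : ∀ (A : Matrix F F ℝ) (B : Matrix F T ℝ) (C : Matrix T F ℝ) (D : Matrix T T ℝ),
      (fromBlocks A B C D).trace = A.trace + D.trace := by
    intro A B C D
    simp [trace]
  have htr : (J * S).trace = (J.toBlocks₁₁ * S.toBlocks₁₁).trace +
      (J.toBlocks₂₁ * S.toBlocks₂₁ᵀ).trace + (J.toBlocks₂₁ * S.toBlocks₂₁ᵀ).trace +
      (J.toBlocks₂₂ * S.toBlocks₂₂).trace := by
    conv_lhs => rw [← fromBlocks_toBlocks J, ← fromBlocks_toBlocks S]
    rw [fromBlocks_multiply, htrace, trace_add, trace_add,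
      ← transpose_toBlocks₂₁ hJ, ← transpose_toBlocks₂₁ hS]
    have : (J.toBlocks₂₁ᵀ * S.toBlocks₂₁).trace = (J.toBlocks₂₁ * S.toBlocks₂₁ᵀ).trace := by
      rw [← trace_transpose, transpose_mul, transpose_transpose, trace_mul_comm]
    rw [this]
    ring
  have hSFt : S.toBlocks₁₁⁻¹ᵀ = S.toBlocks₁₁⁻¹ := transpose_of_posDef hSF.inv
  have hJTt : J.toBlocks₂₂⁻¹ᵀ = J.toBlocks₂₂⁻¹ := transpose_of_posDef hJT.inv
  have hl : J.toBlocks₂₂ * (J.toBlocks₂₂⁻¹ * J.toBlocks₂₁ + S.toBlocks₂₁ * S.toBlocks₁₁⁻¹) =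
      J.toBlocks₂₁ + J.toBlocks₂₂ * (S.toBlocks₂₁ * S.toBlocks₁₁⁻¹) := by
    rw [Matrix.mul_add, Matrix.mul_nonsing_inv_cancel_left _ _ hJu]
  have hr : S.toBlocks₁₁ *
      (J.toBlocks₂₂⁻¹ * J.toBlocks₂₁ + S.toBlocks₂₁ * S.toBlocks₁₁⁻¹)ᵀ =
      S.toBlocks₁₁ * J.toBlocks₂₁ᵀ * J.toBlocks₂₂⁻¹ + S.toBlocks₂₁ᵀ := by
    rw [transpose_add, transpose_mul, transpose_mul, hSFt, hJTt, Matrix.mul_add,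
      Matrix.mul_nonsing_inv_cancel_left _ _ hSu, Matrix.mul_assoc]
  -- Multiplying out the square gives the two cross terms of tr(J S) together with exactly the terms
  -- by which J_F and S_T differ from the Schur complements in the other two losses.
  have hlast : (J.toBlocks₂₂ * ((J.toBlocks₂₂⁻¹ * J.toBlocks₂₁ + S.toBlocks₂₁ * S.toBlocks₁₁⁻¹) *
        S.toBlocks₁₁ *
        (J.toBlocks₂₂⁻¹ * J.toBlocks₂₁ + S.toBlocks₂₁ * S.toBlocks₁₁⁻¹)ᵀ)).trace =
      (J.toBlocks₂₁ᵀ * J.toBlocks₂₂⁻¹ * J.toBlocks₂₁ * S.toBlocks₁₁).trace +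
      (J.toBlocks₂₁ * S.toBlocks₂₁ᵀ).trace + (J.toBlocks₂₁ * S.toBlocks₂₁ᵀ).trace +
      (J.toBlocks₂₂ * correction S).trace := by
    rw [Matrix.mul_assoc _ S.toBlocks₁₁, hr, ← Matrix.mul_assoc, hl, Matrix.add_mul,
      Matrix.mul_add, Matrix.mul_add, trace_add, trace_add, trace_add]
    have e1 : (J.toBlocks₂₁ * (S.toBlocks₁₁ * J.toBlocks₂₁ᵀ * J.toBlocks₂₂⁻¹)).trace =
        (J.toBlocks₂₁ᵀ * J.toBlocks₂₂⁻¹ * J.toBlocks₂₁ * S.toBlocks₁₁).trace := by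
      rw [Matrix.mul_assoc S.toBlocks₁₁, ← Matrix.mul_assoc, Matrix.trace_mul_comm,
        ← Matrix.mul_assoc]
    have e2 : (J.toBlocks₂₂ * (S.toBlocks₂₁ * S.toBlocks₁₁⁻¹) *
        (S.toBlocks₁₁ * J.toBlocks₂₁ᵀ * J.toBlocks₂₂⁻¹)).trace =
        (J.toBlocks₂₁ * S.toBlocks₂₁ᵀ).trace := by
      have : S.toBlocks₂₁ * S.toBlocks₁₁⁻¹ * (S.toBlocks₁₁ * J.toBlocks₂₁ᵀ * J.toBlocks₂₂⁻¹) =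
          S.toBlocks₂₁ * J.toBlocks₂₁ᵀ * J.toBlocks₂₂⁻¹ := by
        rw [Matrix.mul_assoc S.toBlocks₁₁, Matrix.mul_assoc,
          Matrix.nonsing_inv_mul_cancel_left _ _ hSu, Matrix.mul_assoc]
      rw [Matrix.mul_assoc, this, Matrix.trace_mul_comm,
        Matrix.nonsing_inv_mul_cancel_right _ _ hJu, ← trace_transpose, transpose_mul,
        transpose_transpose]
    have e3 : (J.toBlocks₂₂ * (S.toBlocks₂₁ * S.toBlocks₁₁⁻¹) * S.toBlocks₂₁ᵀ).trace =
        (J.toBlocks₂₂ * correction S).trace := by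
      unfold correction
      rw [Matrix.mul_assoc]
    rw [e1, e2, e3]
    ring
  rw [hlast]
  unfold gaussLoss
  rw [hdet, Real.log_mul hJT.det_pos.ne' hKpd.det_pos.ne', htr, Matrix.mul_sub, trace_sub]
  have : (J⁻¹.toBlocks₁₁⁻¹ * S.toBlocks₁₁).trace = (J.toBlocks₁₁ * S.toBlocks₁₁).trace -
      (J.toBlocks₂₁ᵀ * J.toBlocks₂₂⁻¹ * J.toBlocks₂₁ * S.toBlocks₁₁).trace := by
    rw [hK, Matrix.sub_mul, trace_sub]
  rw [this]
  ring

theorem gaussLoss_blocks_le {S J : Matrix (F ⊕ T) (F ⊕ T) ℝ} (hS : S.PosDef) (hJ : J.PosDef) :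
    gaussLoss (S.toBlocks₂₂ - correction S) J.toBlocks₂₂ +
      gaussLoss S.toBlocks₁₁ J⁻¹.toBlocks₁₁⁻¹ ≤ gaussLoss S J := by
  rw [gaussLoss_blocks hS hJ]
  have := trace_mul_conj_nonneg (posDef_toBlocks₂₂ hJ) (posDef_toBlocks₁₁ hS)
    (J.toBlocks₂₂⁻¹ * J.toBlocks₂₁ + S.toBlocks₂₁ * S.toBlocks₁₁⁻¹)
  linarith

/-- The hypothesis says that both models have the same regression of T on F, which makes the squared
term vanish. -/
theorem gaussLoss_blocks_eq {S J : Matrix (F ⊕ T) (F ⊕ T) ℝ} (hS : S.PosDef) (hJ : J.PosDef)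
    (h : J.toBlocks₂₁ = -(J.toBlocks₂₂ * (S.toBlocks₂₁ * S.toBlocks₁₁⁻¹))) :
    gaussLoss S J = gaussLoss (S.toBlocks₂₂ - correction S) J.toBlocks₂₂ +
      gaussLoss S.toBlocks₁₁ J⁻¹.toBlocks₁₁⁻¹ := by
  rw [gaussLoss_blocks hS hJ, h, Matrix.mul_neg, Matrix.nonsing_inv_mul_cancel_left _ _
    (posDef_toBlocks₂₂ hJ).det_pos.ne'.isUnit]
  simp

end Blocks

/-! ### Edge exchange and maximum weight spanning trees. -/

section Exchange

open SimpleGraph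

variable {V : Type}

/-- The graph obtained by replacing the edge `xy` by the edge `ab`. -/
def swapEdge (G : SimpleGraph V) (x y a b : V) : SimpleGraph V :=
  G.deleteEdges {s(x, y)} ⊔ SimpleGraph.edge a b

theorem swapEdge_adj {G : SimpleGraph V} {x y a b i j : V} :
    (swapEdge G x y a b).Adj i j ↔
      (G.Adj i j ∧ s(i, j) ≠ s(x, y)) ∨ (s(i, j) = s(a, b) ∧ i ≠ j) := by
  simp only [swapEdge, SimpleGraph.sup_adj, SimpleGraph.deleteEdges_adj, Set.mem_singleton_iff,
    SimpleGraph.edge_adj, Sym2.eq_iff, ne_eq]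

/-- Paths in a tree are unique: a walk avoiding the edge would shorten to a path avoiding it, yet
that path would be `p`. -/
theorem not_reachable_of_mem_edges {G : SimpleGraph V} (hG : G.IsTree) {a b x y : V}
    {p : G.Walk a b} (hp : p.IsPath) (h : s(x, y) ∈ p.edges) :
    ¬ (G.deleteEdges {s(x, y)}).Reachable a b := by
  classical
  rw [SimpleGraph.reachable_deleteEdges_iff_exists_walk]
  rintro ⟨q, hq⟩
  obtain ⟨r, -, hr⟩ := hG.existsUnique_path a b
  have h1 : q.bypass = p := (hr _ q.bypass_isPath).trans (hr _ hp).symm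
  exact hq (q.edges_bypass_subset_edges (h1 ▸ h))

theorem isTree_swapEdge {G : SimpleGraph V} (hG : G.IsTree) {x y a b : V} (hxy : G.Adj x y)
    (hab : ¬ (G.deleteEdges {s(x, y)}).Reachable a b) : (swapEdge G x y a b).IsTree := by
  set H := G.deleteEdges {s(x, y)} with hH
  have hle : H ≤ swapEdge G x y a b := le_sup_left
  -- Deleting xy leaves only the side of x and the side of y. Since a and b are separated, they lie
  -- on different sides, and the edge ab joins these again.
  have hside : ∀ v, H.Reachable x v ∨ H.Reachable y v := by
    intro v
    obtain ⟨p⟩ := hG.connected.preconnected v x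
    induction p with
    | nil => exact Or.inl (Reachable.refl _)
    | @cons u w z huw p ih =>
      by_cases he : s(u, w) = s(z, y)
      · rcases Sym2.eq_iff.1 he with h | h
        · rw [h.1]; exact Or.inl (Reachable.refl _)
        · rw [h.1]; exact Or.inr (Reachable.refl _)
      · have hadj : H.Adj w u := by
          rw [hH, SimpleGraph.deleteEdges_adj]
          exact ⟨huw.symm, by rwa [Set.mem_singleton_iff, Sym2.eq_swap]⟩
        exact (ih hxy hab hH hle).imp (fun h => h.trans hadj.reachable)
          fun h => h.trans hadj.reachable
  have hne : a ≠ b := fun h => hab (h ▸ Reachable.refl _)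
  have hedge : (swapEdge G x y a b).Reachable a b :=
    (swapEdge_adj.2 (Or.inr ⟨rfl, hne⟩)).reachable
  have hxy' : (swapEdge G x y a b).Reachable x y := by
    rcases hside a with ha | ha <;> rcases hside b with hb | hb
    · exact absurd (ha.symm.trans hb) hab
    · exact ((ha.mono hle).trans hedge).trans (hb.mono hle).symm
    · exact ((hb.mono hle).trans hedge.symm).trans (ha.mono hle).symm
    · exact absurd (ha.symm.trans hb) hab
  have hx : ∀ v, (swapEdge G x y a b).Reachable x v := fun v =>
    (hside v).elim (fun h => h.mono hle) fun h => hxy'.trans (h.mono hle)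
  have := hG.connected.nonempty
  refine ⟨⟨fun u v => (hx u).symm.trans (hx v)⟩, ?_⟩
  exact (hG.isAcyclic.anti (SimpleGraph.deleteEdges_le _)).sup_edge_of_not_reachable hab

theorem IsTree.eq_of_le {G H : SimpleGraph V} (hG : G.IsTree) (hH : H.IsTree) (h : H ≤ G) :
    H = G :=
  le_antisymm h ((SimpleGraph.isTree_iff_maximal_isAcyclic.1 hH).2.2 hG.isAcyclic h)

variable [Fintype V]

open Classical in
/-- Total weight of the adjacent ordered pairs of a graph. -/
def pairWeight (w : V → V → ℝ) (G : SimpleGraph V) : ℝ :=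
  ∑ i, ∑ j, if G.Adj i j then w i j else 0

theorem sum_ite_sym2 (w : V → V → ℝ) {x y : V} (hxy : x ≠ y) [DecidableEq V] :
    ∑ i, ∑ j, (if s(i, j) = s(x, y) then w i j else 0) = w x y + w y x := by
  have h : ∀ i j, (if s(i, j) = s(x, y) then w i j else 0) =
      (if i = x then if j = y then w i j else 0 else 0) +
        (if i = y then if j = x then w i j else 0 else 0) := by
    intro i j
    simp only [Sym2.eq_iff]
    by_cases h1 : i = x <;> by_cases h2 : j = y <;> by_cases h3 : i = y <;> by_cases h4 : j = x <;>
      simp_all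
  simp_rw [h, Finset.sum_add_distrib]
  congr 1 <;> simp

theorem pairWeight_swapEdge {G : SimpleGraph V} (w : V → V → ℝ) (hw : ∀ i j, w i j = w j i)
    {x y a b : V} (hxy : G.Adj x y) (hab : ¬ (G.deleteEdges {s(x, y)}).Reachable a b) :
    pairWeight w (swapEdge G x y a b) = pairWeight w G - 2 * w x y + 2 * w a b := by
  classical
  have hne : a ≠ b := fun h => hab (h ▸ Reachable.refl _)
  -- If ab is already an edge it can only be the deleted edge xy, as any other edge would keep a and
  -- b connected. Hence adding ab never counts a surviving edge twice.
  have hG : G.Adj a b → s(a, b) = s(x, y) := by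
    intro h
    by_contra hc
    exact hab (SimpleGraph.deleteEdges_adj.2 ⟨h, hc⟩ : (G.deleteEdges {s(x, y)}).Adj a b).reachable
  have aux : ∀ (P Q R N : Prop) (r : ℝ), (P → R) → (Q → N) → (Q → R → P) →
      (if (R ∧ ¬ P) ∨ (Q ∧ N) then r else 0) + (if P then r else 0) =
        (if R then r else 0) + (if Q then r else 0) := by
    intro P Q R N r h1 h2 h3
    by_cases c1 : P <;> by_cases c2 : Q <;> by_cases c3 : R <;> simp_all
  have key : ∀ i j, (if (swapEdge G x y a b).Adj i j then w i j else 0) +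
      (if s(i, j) = s(x, y) then w i j else 0) =
      (if G.Adj i j then w i j else 0) + (if s(i, j) = s(a, b) then w i j else 0) := by
    intro i j
    have h1 : s(i, j) = s(x, y) → G.Adj i j := by
      intro h
      rcases Sym2.eq_iff.1 h with ⟨rfl, rfl⟩ | ⟨rfl, rfl⟩
      exacts [hxy, hxy.symm]
    have h2 : s(i, j) = s(a, b) → i ≠ j := by
      intro h
      rcases Sym2.eq_iff.1 h with ⟨rfl, rfl⟩ | ⟨rfl, rfl⟩
      exacts [hne, hne.symm]
    have h3 : s(i, j) = s(a, b) → G.Adj i j → s(i, j) = s(x, y) := by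
      intro h h'
      rw [h]
      apply hG
      rcases Sym2.eq_iff.1 h with ⟨rfl, rfl⟩ | ⟨rfl, rfl⟩
      exacts [h', h'.symm]
    rw [if_congr (swapEdge_adj (G := G) (x := x) (y := y) (a := a) (b := b)) rfl rfl]
    convert aux _ _ _ _ (w i j) h1 h2 h3
  have hsum : pairWeight w (swapEdge G x y a b) +
      ∑ i, ∑ j, (if s(i, j) = s(x, y) then w i j else 0) =
      pairWeight w G + ∑ i, ∑ j, (if s(i, j) = s(a, b) then w i j else 0) := by
    unfold pairWeight
    simp only [← Finset.sum_add_distrib]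
    refine Finset.sum_congr rfl fun i _ => Finset.sum_congr rfl fun j _ => ?_
    convert key i j
  rw [sum_ite_sym2 w hxy.ne, sum_ite_sym2 w hne, hw y x, hw b a] at hsum
  linarith

/-- Maximum weight spanning trees for a weight function on pairs. -/
def IsMaxTree (w : V → V → ℝ) (G : SimpleGraph V) : Prop :=
  G.IsTree ∧ ∀ G' : SimpleGraph V, G'.IsTree → pairWeight w G' ≤ pairWeight w G

theorem exists_isMaxTree [Nonempty V] (w : V → V → ℝ) : ∃ G, IsMaxTree w G := by
  classical
  obtain ⟨G₀, -, hG₀⟩ := (SimpleGraph.connected_top (V := V)).exists_isTree_le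
  obtain ⟨G, hG, hmax⟩ := Set.exists_max_image {G : SimpleGraph V | G.IsTree} (pairWeight w)
    (Set.toFinite _) ⟨G₀, hG₀⟩
  exact ⟨G, hG, hmax⟩

/-- Every edge on the tree path between two nodes is at least as heavy as the pair itself. -/
theorem IsMaxTree.le_of_not_reachable {w : V → V → ℝ} (hw : ∀ i j, w i j = w j i)
    {G : SimpleGraph V} (hG : IsMaxTree w G) {x y a b : V} (hxy : G.Adj x y)
    (hab : ¬ (G.deleteEdges {s(x, y)}).Reachable a b) : w a b ≤ w x y := by
  have h := hG.2 _ (isTree_swapEdge hG.1 hxy hab)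
  rw [pairWeight_swapEdge w hw hxy hab] at h
  linarith

/-- A maximum weight spanning tree stays one under a monotone change of the weights. -/
theorem IsMaxTree.mono {w w' : V → V → ℝ} (hw : ∀ i j, w i j = w j i)
    (hw' : ∀ i j, w' i j = w' j i)
    (hmono : ∀ a b x y, a ≠ b → x ≠ y → w a b ≤ w x y → w' a b ≤ w' x y) {G : SimpleGraph V}
    (hG : IsMaxTree w G) : IsMaxTree w' G := by
  classical
  refine ⟨hG.1, fun H hH => ?_⟩
  -- Induction on the number of edges of the competitor `H` outside `G`: each exchange moves `H`
  -- towards `G` without lowering its `w'`-weight.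
  induction hn : (H.edgeSet \ G.edgeSet).ncard using Nat.strong_induction_on generalizing H with
  | _ n ih =>
  subst hn
  by_cases hle : H ≤ G
  · rw [IsTree.eq_of_le hG.1 hH hle]
  · obtain ⟨a, b, hHab, hGab⟩ : ∃ a b, H.Adj a b ∧ ¬ G.Adj a b := by
      by_contra hc
      push Not at hc
      exact hle fun a b h => hc a b h
    have hbr : ¬ (H.deleteEdges {s(a, b)}).Reachable a b :=
      SimpleGraph.isBridge_iff.1
        (SimpleGraph.isAcyclic_iff_forall_isBridge.1 hH.isAcyclic (H.mem_edgeSet.2 hHab))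
    obtain ⟨p, hp, -⟩ := hG.1.existsUnique_path a b
    -- Removing ab splits `H`, and the `G`-path from a to b must cross this cut. The crossing edge
    -- is at least as heavy as ab, because `G` is maximal for `w`, and it reconnects `H`.
    obtain ⟨d, hd, hd1, hd2⟩ := p.exists_boundary_dart
      {v | (H.deleteEdges {s(a, b)}).Reachable a v} (Reachable.refl _) hbr
    have hadj : G.Adj d.fst d.snd := d.adj
    have hsep : ¬ (H.deleteEdges {s(a, b)}).Reachable d.fst d.snd := fun h => hd2 (hd1.trans h)
    have hmem : s(d.fst, d.snd) ∈ p.edges := List.mem_map.2 ⟨d, hd, rfl⟩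
    have hwle : w' a b ≤ w' d.fst d.snd := hmono _ _ _ _ hHab.ne hadj.ne
      (hG.le_of_not_reachable hw hadj (not_reachable_of_mem_edges hG.1 hp hmem))
    have htree := isTree_swapEdge hH hHab hsep
    have hlt : ((swapEdge H a b d.fst d.snd).edgeSet \ G.edgeSet).ncard <
        (H.edgeSet \ G.edgeSet).ncard := by
      apply Set.ncard_lt_ncard _ (Set.toFinite _)
      refine ⟨?_, fun h => ?_⟩
      · rintro e ⟨he, heG⟩
        induction e with
        | _ i j =>
        refine ⟨?_, heG⟩
        rw [SimpleGraph.mem_edgeSet] at he heG ⊢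
        rcases swapEdge_adj.1 he with h | h
        · exact h.1
        · exfalso
          apply heG
          rcases Sym2.eq_iff.1 h.1 with ⟨rfl, rfl⟩ | ⟨rfl, rfl⟩
          exacts [hadj, hadj.symm]
      · have h1 : s(a, b) ∈ (swapEdge H a b d.fst d.snd).edgeSet \ G.edgeSet := h ⟨hHab, hGab⟩
        rcases swapEdge_adj.1 (SimpleGraph.mem_edgeSet _ |>.1 h1.1) with h2 | h2
        · exact h2.2 rfl
        · apply hGab
          rcases Sym2.eq_iff.1 h2.1 with ⟨rfl, rfl⟩ | ⟨rfl, rfl⟩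
          exacts [hadj, hadj.symm]
    have := ih _ hlt _ htree rfl
    rw [pairWeight_swapEdge w' hw' hHab hsep] at this
    linarith

/-- A maximum weight spanning tree can be changed so that it contains a heaviest edge across a cut,
without changing it inside the cut. -/
theorem IsMaxTree.exists_adj_of_cut {w : V → V → ℝ} (hw : ∀ i j, w i j = w j i)
    {G : SimpleGraph V} (hG : IsMaxTree w G) {X : Set V} {a b : V} (ha : a ∈ X) (hb : b ∉ X)
    (hmax : ∀ u ∈ X, ∀ v ∉ X, w u v ≤ w a b) :
    ∃ G', IsMaxTree w G' ∧ G'.Adj a b ∧ ∀ u ∈ X, ∀ v ∈ X, G.Adj u v → G'.Adj u v := by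
  classical
  obtain ⟨p, hp, -⟩ := hG.1.existsUnique_path a b
  -- The tree path from a to b leaves `X` through some edge, which is no heavier than ab. Exchanging
  -- it for ab loses no weight and touches no edge inside `X`.
  obtain ⟨d, hd, hd1, hd2⟩ := p.exists_boundary_dart X ha hb
  have hadj : G.Adj d.fst d.snd := d.adj
  have hmem : s(d.fst, d.snd) ∈ p.edges := List.mem_map.2 ⟨d, hd, rfl⟩
  have hsep := not_reachable_of_mem_edges hG.1 hp hmem
  have htree := isTree_swapEdge hG.1 hadj hsep
  refine ⟨swapEdge G d.fst d.snd a b, ⟨htree, fun H hH => ?_⟩, ?_, ?_⟩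
  · rw [pairWeight_swapEdge w hw hadj hsep]
    have h1 := hG.2 H hH
    have h2 := hmax _ hd1 _ hd2
    linarith
  · exact swapEdge_adj.2 (Or.inr ⟨rfl, fun h => hb (h ▸ ha)⟩)
  · intro u hu v hv huv
    refine swapEdge_adj.2 (Or.inl ⟨huv, fun h => ?_⟩)
    rcases Sym2.eq_iff.1 h with ⟨rfl, rfl⟩ | ⟨rfl, rfl⟩
    exacts [hd2 hv, hd2 hu]

end Exchange

/-! ### Covariance and information matrix of a tree model. -/

section TreeCovariance

variable {V : Type}

/-- The path between two nodes of a tree. -/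
def treePath {G : SimpleGraph V} (hG : G.IsTree) (i j : V) : G.Walk i j :=
  (hG.existsUnique_path i j).choose

theorem treePath_isPath {G : SimpleGraph V} (hG : G.IsTree) (i j : V) :
    (treePath hG i j).IsPath := (hG.existsUnique_path i j).choose_spec.1

theorem eq_treePath {G : SimpleGraph V} (hG : G.IsTree) {i j : V} {p : G.Walk i j}
    (hp : p.IsPath) : p = treePath hG i j := (hG.existsUnique_path i j).choose_spec.2 p hp

theorem treePath_self {G : SimpleGraph V} (hG : G.IsTree) (i : V) :
    treePath hG i i = SimpleGraph.Walk.nil :=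
  (eq_treePath hG SimpleGraph.Walk.IsPath.nil).symm

/-- Of two adjacent nodes, one is the first step of the other towards a given node. -/
theorem treePath_adj {G : SimpleGraph V} (hG : G.IsTree) {i l : V} (h : G.Adj i l) (j : V) :
    treePath hG i j = SimpleGraph.Walk.cons h (treePath hG l j) ∨
      treePath hG l j = SimpleGraph.Walk.cons h.symm (treePath hG i j) := by
  by_cases hi : i ∈ (treePath hG l j).support
  · right
    classical
    by_cases hl : l ∈ (treePath hG i j).support
    · exfalso
      have h1 := hG.isAcyclic.ne_mem_support_of_support_of_adj_of_isPath
        (treePath_isPath hG l j).reverse (treePath_isPath hG i j).reverse h.symm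
        (by simpa using hi)
      exact h1 (by simpa using hl)
    · refine (eq_treePath hG ?_).symm
      rw [SimpleGraph.Walk.cons_isPath_iff]
      exact ⟨treePath_isPath hG i j, hl⟩
  · left
    refine (eq_treePath hG ?_).symm
    rw [SimpleGraph.Walk.cons_isPath_iff]
    exact ⟨treePath_isPath hG l j, hi⟩

/-- The covariance matrix of the tree model with given variances and edge covariances. -/
def treeCov {G : SimpleGraph V} (hG : G.IsTree) (A : Matrix V V ℝ) : Matrix V V ℝ :=
  fun i j => √(A i i * A j j) *
    ((treePath hG i j).darts.map fun d => corr A d.fst d.snd).prod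

variable {G : SimpleGraph V} (hG : G.IsTree) {A : Matrix V V ℝ}

theorem treeCov_self (hA : ∀ i, 0 < A i i) (i : V) : treeCov hG A i i = A i i := by
  unfold treeCov
  rw [treePath_self]
  simp [Real.sqrt_mul_self (hA i).le]

/-- The Markov property along the path: the standard deviation of the intermediate node cancels,
leaving the regression coefficient of i on l. Both the inverse formula and Prim's algorithm use only
this recursion. -/
theorem treeCov_cons (hA : ∀ i, 0 < A i i) {i l j : V} (h : G.Adj i l)
    (hp : treePath hG i j = SimpleGraph.Walk.cons h (treePath hG l j)) :
    treeCov hG A i j = A i l / A l l * treeCov hG A l j := by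
  unfold treeCov
  rw [hp, SimpleGraph.Walk.darts_cons, List.map_cons, List.prod_cons]
  simp only [corr]
  rw [Real.sqrt_mul (hA i).le, Real.sqrt_mul (hA i).le, Real.sqrt_mul (hA l).le]
  have h1 := Real.sqrt_pos.2 (hA i)
  have h2 := Real.sqrt_pos.2 (hA l)
  have h3 := Real.mul_self_sqrt (hA l).le
  generalize (List.map (fun d : G.Dart => A d.fst d.snd / √(A d.fst d.fst * A d.snd d.snd))
    (treePath hG l j).darts).prod = c
  field_simp
  rw [sq, h3]
  rw [eq_div_iff (hA l).ne']
  ring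

theorem treeCov_edge (hA : ∀ i, 0 < A i i) {i j : V} (h : G.Adj i j) :
    treeCov hG A i j = A i j := by
  rw [treeCov_cons hG hA h, treeCov_self hG hA, div_mul_cancel₀ _ (hA j).ne']
  refine (eq_treePath hG ?_).symm
  rw [treePath_self, SimpleGraph.Walk.cons_isPath_iff]
  simpa using h.ne

theorem treeCov_symm (hs : ∀ i j, A i j = A j i) (i j : V) :
    treeCov hG A i j = treeCov hG A j i := by
  unfold treeCov
  rw [mul_comm (A i i), ← eq_treePath hG (treePath_isPath hG j i).reverse,
    SimpleGraph.Walk.darts_reverse, List.map_reverse, List.prod_reverse, List.map_map]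
  congr 3
  ext d
  simp only [corr, Function.comp, SimpleGraph.Dart.symm_toProd, Prod.fst_swap, Prod.snd_swap]
  rw [hs, mul_comm]

variable [Fintype V]

/-- The diagonal and edge cases of the algorithm are the path formula for paths of length zero and
one, so one formula covers all entries. -/
theorem isChowLiu_iff {C : Matrix V V ℝ} (hA : ∀ i, 0 < A i i) :
    IsChowLiu A G C ↔ IsMaxSpanningTree A G ∧ C = treeCov hG A := by
  constructor
  · rintro ⟨h1, h2, h3, h4⟩
    refine ⟨h1, ?_⟩
    ext i j
    by_cases hij : i = j
    · subst hij
      rw [h2, treeCov_self hG hA]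
    by_cases hadj : G.Adj i j
    · rw [h3 i j hadj, treeCov_edge hG hA hadj]
    · rw [h4 i j hij hadj _ (treePath_isPath hG i j)]
      rfl
  · rintro ⟨h1, rfl⟩
    refine ⟨h1, treeCov_self hG hA, fun i j h => treeCov_edge hG hA h, fun i j _ _ p hp => ?_⟩
    rw [eq_treePath hG hp]
    rfl

variable [DecidableEq V]

open Classical in
/-- The information matrix of the tree model with given variances and edge covariances. -/
def treePrec (G : SimpleGraph V) (A : Matrix V V ℝ) : Matrix V V ℝ := fun i j =>
  (if i = j then 1 / A i i + ∑ l, (if G.Adj i l then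
    A i l ^ 2 / (A i i * (A i i * A l l - A i l ^ 2)) else 0) else 0) -
    (if G.Adj i j then A i j / (A i i * A j j - A i j ^ 2) else 0)

/-- In row i and column j, a neighbour l of i with i on its path to j contributes zero: its share of
the diagonal entry cancels its off-diagonal entry. If i = j, all neighbours are of this kind and 1 /
A_ii times A_ii remains. Otherwise the one exception is the first step q from i towards j, whose
contribution cancels the term with 1 / A_ii. -/
theorem treePrec_mul_treeCov (hA : ∀ i, 0 < A i i)
    (hd : ∀ i j, i ≠ j → 0 < A i i * A j j - A i j ^ 2) (hs : ∀ i j, A i j = A j i) :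
    treePrec G A * treeCov hG A = 1 := by
  classical
  ext i j
  rw [Matrix.mul_apply]
  simp only [treePrec, sub_mul, ite_mul, zero_mul, Finset.sum_sub_distrib, Finset.sum_ite_eq,
    Finset.mem_univ, if_true, add_mul, Finset.sum_mul]
  rw [add_sub_assoc, ← Finset.sum_sub_distrib]
  have hterm : ∀ l (hl : G.Adj i l), treePath hG l j = SimpleGraph.Walk.cons hl.symm
      (treePath hG i j) → A i l ^ 2 / (A i i * (A i i * A l l - A i l ^ 2)) * treeCov hG A i j -
      A i l / (A i i * A l l - A i l ^ 2) * treeCov hG A l j = 0 := by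
    intro l hl hp
    rw [treeCov_cons hG hA hl.symm hp, hs l i]
    have := hd i l hl.ne
    have := hA i
    field_simp
    ring
  by_cases hij : i = j
  · subst hij
    rw [Finset.sum_eq_zero, treeCov_self hG hA, Matrix.one_apply_eq, add_zero,
      one_div_mul_cancel (hA i).ne']
    intro l _
    by_cases hl : G.Adj i l
    · rw [if_pos hl, if_pos hl]
      refine hterm l hl ?_
      rcases treePath_adj hG hl i with h | h
      · rw [treePath_self] at h
        cases h
      · exact h
    · rw [if_neg hl, if_neg hl, sub_self]
  · rw [Matrix.one_apply_ne hij]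
    obtain ⟨q, hq, hp⟩ : ∃ q, ∃ h : G.Adj i q,
        treePath hG i j = SimpleGraph.Walk.cons h (treePath hG q j) := by
      have h := treePath_isPath hG i j
      cases hp : treePath hG i j with
      | nil => exact absurd rfl hij
      | @cons _ q _ h' r =>
        rw [hp, SimpleGraph.Walk.cons_isPath_iff] at h
        exact ⟨q, h', by rw [eq_treePath hG h.1]⟩
    rw [Finset.sum_eq_single q]
    · rw [if_pos hq, if_pos hq, treeCov_cons hG hA hq hp]
      have h1 := hd i q hq.ne
      have h2 := hA i
      have h3 := hA q
      field_simp
      ring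
    · intro l _ hlq
      by_cases hl : G.Adj i l
      · rw [if_pos hl, if_pos hl]
        refine hterm l hl ?_
        rcases treePath_adj hG hl j with h | h
        · rw [hp] at h
          cases h
          exact absurd rfl hlq
        · exact h
      · rw [if_neg hl, if_neg hl, sub_self]
    · simp

end TreeCovariance

/-! ### Rooted trees. -/

section Rooted

variable {V : Type}

/-- A tree rooted at `r`, described by a parent function and a height function. -/
structure IsRooted (G : SimpleGraph V) (r : V) (par : V → V) (h : V → ℕ) : Prop where
  adj : ∀ v, v ≠ r → G.Adj v (par v)
  lt : ∀ v, v ≠ r → h (par v) < h v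
  cover : ∀ i j, G.Adj i j → (i ≠ r ∧ par i = j) ∨ (j ≠ r ∧ par j = i)

/-- The parent is the first step of the path to the root and the height is the length of that path.
-/
theorem exists_isRooted {G : SimpleGraph V} (hG : G.IsTree) (r : V) :
    ∃ par h, IsRooted G r par h := by
  classical
  have hex : ∀ v, v ≠ r → ∃ q, ∃ h : G.Adj v q,
      treePath hG v r = SimpleGraph.Walk.cons h (treePath hG q r) := by
    intro v hv
    have h := treePath_isPath hG v r
    cases hp : treePath hG v r with
    | nil => exact absurd rfl hv
    | @cons _ q _ h' s =>
      rw [hp, SimpleGraph.Walk.cons_isPath_iff] at h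
      exact ⟨q, h', by rw [eq_treePath hG h.1]⟩
  choose! par hpar using hex
  refine ⟨par, fun v => (treePath hG v r).length, ⟨fun v hv => (hpar v hv).1, fun v hv => ?_,
    fun i j hij => ?_⟩⟩
  · obtain ⟨h1, h2⟩ := hpar v hv
    simp only [h2, SimpleGraph.Walk.length_cons]
    omega
  · have aux : ∀ i j, ∀ hij : G.Adj i j,
        treePath hG i r = SimpleGraph.Walk.cons hij (treePath hG j r) → i ≠ r ∧ par i = j := by
      intro i j hij h
      have hir : i ≠ r := by
        rintro rfl
        rw [treePath_self] at h
        cases h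
      refine ⟨hir, ?_⟩
      obtain ⟨h1, h2⟩ := hpar i hir
      have h3 := h2.symm.trans h
      have h4 := congrArg SimpleGraph.Walk.snd h3
      simpa using h4
    rcases treePath_adj hG hij r with h | h
    · exact Or.inl (aux i j hij h)
    · exact Or.inr (aux j i hij.symm h)

variable {G : SimpleGraph V} {r : V} {par : V → V} {h : V → ℕ}

theorem IsRooted.not_both (hR : IsRooted G r par h) {i j : V} (hi : i ≠ r) (hij : par i = j)
    (hj : j ≠ r) : par j ≠ i := by
  intro hji
  have h1 := hR.lt i hi
  have h2 := hR.lt j hj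
  rw [hij] at h1
  rw [hji] at h2
  omega

variable [DecidableEq V]

-- Each edge joins a child to its parent in exactly one direction, since heights drop along parents.
-- Sums over edges thereby become sums over the nodes other than the root.
open Classical in
theorem IsRooted.ite_adj (hR : IsRooted G r par h) (i j : V) (x : ℝ) :
    (if G.Adj i j then x else 0) =
      (if i ≠ r ∧ par i = j then x else 0) + (if j ≠ r ∧ par j = i then x else 0) := by
  by_cases hadj : G.Adj i j
  · rw [if_pos hadj]
    rcases hR.cover i j hadj with h1 | h1
    · rw [if_pos h1, if_neg, add_zero]
      exact fun h2 => hR.not_both h1.1 h1.2 h2.1 h2.2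
    · rw [if_neg, if_pos h1, zero_add]
      exact fun h2 => hR.not_both h1.1 h1.2 h2.1 h2.2
  · rw [if_neg hadj, if_neg, if_neg, add_zero]
    · rintro ⟨h1, rfl⟩
      exact hadj (hR.adj j h1).symm
    · rintro ⟨h1, rfl⟩
      exact hadj (hR.adj i h1)

variable [Fintype V]

theorem IsRooted.pairWeight_eq (hR : IsRooted G r par h) (w : V → V → ℝ)
    (hw : ∀ i j, w i j = w j i) :
    pairWeight w G = 2 * ∑ v, if v = r then 0 else w v (par v) := by
  classical
  unfold pairWeight
  simp_rw [hR.ite_adj, Finset.sum_add_distrib]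
  rw [Finset.sum_comm (f := fun i j => if j ≠ r ∧ par j = i then w i j else 0), two_mul]
  congr 1
  · refine Finset.sum_congr rfl fun i _ => ?_
    by_cases hi : i = r <;> simp [hi]
  · refine Finset.sum_congr rfl fun i _ => ?_
    by_cases hi : i = r <;> simp [hi, hw]

end Rooted

/-! ### Triangular factorisation of the tree information matrix. -/

section RootedFactor

variable {V : Type} [DecidableEq V] {G : SimpleGraph V} {r : V} {par : V → V}
  {h : V → ℕ} {A : Matrix V V ℝ}

/-- The matrix that subtracts from each node its regression on its parent. -/
def innovation (r : V) (par : V → V) (A : Matrix V V ℝ) : Matrix V V ℝ := fun v i =>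
  (if v = i then 1 else 0) - (if v ≠ r ∧ par v = i then A v i / A i i else 0)

/-- The conditional variance of a node given its parent. -/
def innovVar (r : V) (par : V → V) (A : Matrix V V ℝ) (v : V) : ℝ :=
  if v = r then A v v else A v v - A v (par v) ^ 2 / A (par v) (par v)

theorem IsRooted.innovVar_pos (hR : IsRooted G r par h) (hA : ∀ i, 0 < A i i)
    (hd : ∀ i j, i ≠ j → 0 < A i i * A j j - A i j ^ 2) (v : V) : 0 < innovVar r par A v := by
  unfold innovVar
  split_ifs with hv
  · exact hA v
  · have h1 := hd v (par v) (hR.adj v hv).ne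
    have h2 := hA (par v)
    have : A v v - A v (par v) ^ 2 / A (par v) (par v) =
        (A v v * A (par v) (par v) - A v (par v) ^ 2) / A (par v) (par v) := by
      field_simp
    rw [this]
    positivity

variable [Fintype V]

/-- The only off-diagonal entries sit at (v, par v), and a parent has smaller height. Ordered by
height, the matrix is block triangular with identity blocks; the order dual selects the lower
triangular convention. -/
theorem IsRooted.det_innovation (hR : IsRooted G r par h) : (innovation r par A).det = 1 := by
  have hent : ∀ i j, h i ≤ h j → innovation r par A i j = if i = j then 1 else 0 := by
    intro i j hij
    unfold innovation
    rw [if_neg (c := i ≠ r ∧ par i = j), sub_zero]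
    rintro ⟨h1, rfl⟩
    exact absurd (hR.lt i h1) (by omega)
  have htri : (innovation r par A).BlockTriangular (fun v => OrderDual.toDual (h v)) := by
    intro i j hij
    have hij : h i < h j := hij
    rw [hent i j hij.le, if_neg]
    rintro rfl
    exact lt_irrefl _ hij
  rw [htri.det]
  refine Finset.prod_eq_one fun a _ => ?_
  rw [← Matrix.det_one (n := {v // OrderDual.toDual (h v) = a})]
  congr 1
  ext ⟨i, hi⟩ ⟨j, hj⟩
  rw [Matrix.toSquareBlock_def, Matrix.of_apply, hent i j (OrderDual.toDual.injective
    (hi.trans hj.symm)).le, Matrix.one_apply]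
  simp

/-- The density of a tree model is the product of the root density and the conditional densities of
the nodes given their parents, so its quadratic form is the sum of the squared innovations divided
by their variances. -/
theorem IsRooted.treePrec_eq (hR : IsRooted G r par h) (hA : ∀ i, 0 < A i i)
    (hd : ∀ i j, i ≠ j → 0 < A i i * A j j - A i j ^ 2) (hs : ∀ i j, A i j = A j i) :
    treePrec G A = (innovation r par A)ᵀ * diagonal (fun v => (innovVar r par A v)⁻¹) *
      innovation r par A := by
  classical
  have hbd : ∀ v, v ≠ r → A v (par v) / A (par v) (par v) * (innovVar r par A v)⁻¹ =
      A v (par v) / (A v v * A (par v) (par v) - A v (par v) ^ 2) := by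
    intro v hv
    have h1 := hd v (par v) (hR.adj v hv).ne
    have h2 := hA (par v)
    have h3 := hR.innovVar_pos hA hd v
    rw [innovVar, if_neg hv] at h3 ⊢
    have : A v v - A v (par v) ^ 2 / A (par v) (par v) =
        (A v v * A (par v) (par v) - A v (par v) ^ 2) / A (par v) (par v) := by
      field_simp
    rw [this]
    field_simp
  -- The inverse innovation variance supplies the node term of the diagonal and the share of the
  -- edge to the parent; the shares of the edges to the children come from the innovations of the
  -- children.
  have hdiag : ∀ i, (innovVar r par A i)⁻¹ = 1 / A i i + if i ≠ r then
      A i (par i) ^ 2 / (A i i * (A i i * A (par i) (par i) - A i (par i) ^ 2)) else 0 := by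
    intro i
    by_cases hi : i = r
    · simp [innovVar, hi]
    · have h1 := hd i (par i) (hR.adj i hi).ne
      have h2 := hA (par i)
      have h4 := hA i
      rw [innovVar, if_neg hi, if_pos hi]
      have : A i i - A i (par i) ^ 2 / A (par i) (par i) =
          (A i i * A (par i) (par i) - A i (par i) ^ 2) / A (par i) (par i) := by
        field_simp
      rw [this]
      field_simp
      ring
  ext i j
  rw [Matrix.mul_apply]
  simp only [Matrix.mul_diagonal, Matrix.transpose_apply]
  -- The row of v is nonzero only at v and par v. A product of two of its entries is therefore the
  -- square at v, a mixed term for the edge to the parent in either order, or the square at the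
  -- parent.
  have hexp : ∀ v, innovation r par A v i * (innovVar r par A v)⁻¹ * innovation r par A v j =
      (if v = i then (if i = j then (innovVar r par A i)⁻¹ else 0) -
        (if i ≠ r ∧ par i = j then A i j / A j j * (innovVar r par A i)⁻¹ else 0) else 0) -
      (if v = j then (if j ≠ r ∧ par j = i then A j i / A i i * (innovVar r par A j)⁻¹ else 0)
        else 0) +
      (if i = j then (if v ≠ r ∧ par v = i then
        (A v i / A i i) ^ 2 * (innovVar r par A v)⁻¹ else 0) else 0) := by
    intro v
    unfold innovation
    have hpar : ∀ v, ¬ (v ≠ r ∧ par v = v) := fun v c => (hR.adj v c.1).ne' c.2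
    by_cases c1 : v = i
    · subst c1
      by_cases c2 : v = j
      · subst c2
        simp only [eq_false (hpar v), if_true, if_false]
        ring
      · by_cases c5 : v ≠ r ∧ par v = j
        · simp only [c2, eq_false (hpar v), eq_true c5, if_true, if_false]
          ring
        · simp only [c2, eq_false (hpar v), eq_false c5, if_true, if_false]
          ring
    · by_cases c2 : v = j
      · subst c2
        by_cases c5 : v ≠ r ∧ par v = i
        · simp only [c1, Ne.symm c1, eq_false (hpar v), eq_true c5, if_true, if_false]
          ring
        · simp only [c1, Ne.symm c1, eq_false (hpar v), eq_false c5, if_true, if_false]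
          ring
      · by_cases c3 : i = j
        · subst c3
          by_cases c5 : v ≠ r ∧ par v = i
          · simp only [c1, eq_true c5, if_true, if_false]
            ring
          · simp only [c1, eq_false c5, if_true, if_false]
            ring
        · by_cases c5 : v ≠ r ∧ par v = i
          · have c6 : ¬ (v ≠ r ∧ par v = j) := fun c => c3 (c5.2.symm.trans c.2)
            simp only [c1, c2, c3, eq_false c6, if_false]
            ring
          · simp only [c1, c2, c3, eq_false c5, if_false]
            ring
  simp_rw [hexp, Finset.sum_add_distrib, Finset.sum_sub_distrib]
  simp only [Finset.sum_ite_eq', Finset.mem_univ, if_true]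
  have hi' : (if i ≠ r ∧ par i = j then A i j / A j j * (innovVar r par A i)⁻¹ else 0) =
      if i ≠ r ∧ par i = j then A i j / (A i i * A j j - A i j ^ 2) else 0 := by
    split_ifs with c
    · obtain ⟨c1, rfl⟩ := c
      exact hbd i c1
    · rfl
  have hj' : (if j ≠ r ∧ par j = i then A j i / A i i * (innovVar r par A j)⁻¹ else 0) =
      if j ≠ r ∧ par j = i then A i j / (A i i * A j j - A i j ^ 2) else 0 := by
    split_ifs with c
    · obtain ⟨c1, rfl⟩ := c
      rw [hbd j c1, hs (par j) j, mul_comm (A j j)]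
    · rfl
  rw [hi', hj', treePrec, hR.ite_adj i j]
  by_cases hij : i = j
  · subst hij
    have c4 : ¬ (i ≠ r ∧ par i = i) := fun c => (hR.adj i c.1).ne' c.2
    simp only [if_true, c4, if_false, sub_zero, add_zero]
    rw [hdiag, add_assoc]
    congr 1
    simp_rw [hR.ite_adj, Finset.sum_add_distrib]
    congr 1
    · by_cases hi : i = r <;> simp [hi]
    · refine Finset.sum_congr rfl fun v _ => ?_
      split_ifs with c
      · obtain ⟨c1, rfl⟩ := c
        have h1 := hbd v c1
        have h2 : (A v (par v) / A (par v) (par v)) ^ 2 * (innovVar r par A v)⁻¹ =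
            A v (par v) / A (par v) (par v) *
              (A v (par v) / A (par v) (par v) * (innovVar r par A v)⁻¹) := by ring
        rw [h2, h1, hs (par v) v, mul_comm (A v v)]
        have h3 := hd v (par v) (hR.adj v c1).ne
        have h4 := hA (par v)
        rw [mul_comm (A v v)] at h3
        field_simp
      · rfl
  · simp only [hij, if_false, Finset.sum_const_zero]
    ring

theorem IsRooted.posDef_treePrec (hR : IsRooted G r par h) (hA : ∀ i, 0 < A i i)
    (hd : ∀ i j, i ≠ j → 0 < A i i * A j j - A i j ^ 2) (hs : ∀ i j, A i j = A j i) :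
    (treePrec G A).PosDef := by
  rw [hR.treePrec_eq hA hd hs]
  have h1 : (diagonal fun v => (innovVar r par A v)⁻¹).PosDef :=
    Matrix.posDef_diagonal_iff.2 fun v => inv_pos.2 (hR.innovVar_pos hA hd v)
  have h2 : IsUnit (innovation r par A) := by
    rw [Matrix.isUnit_iff_isUnit_det, hR.det_innovation]
    exact isUnit_one
  have := h1.conjTranspose_mul_mul_same (Matrix.mulVec_injective_of_isUnit h2)
  rwa [conjTranspose_eq_transpose_of_trivial] at this

/-- The innovation variance of a node other than the root is A_vv (1 − ρ²), with ρ the correlation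
with the parent. The sum over nodes is thus a sum over edges and independent of the root; the
division by 2 corrects for ordered pairs. -/
theorem IsRooted.log_det_treePrec (hR : IsRooted G r par h) (hA : ∀ i, 0 < A i i)
    (hd : ∀ i j, i ≠ j → 0 < A i i * A j j - A i j ^ 2) (hs : ∀ i j, A i j = A j i) :
    Real.log (treePrec G A).det = -(∑ v, Real.log (A v v)) +
      pairWeight (fun i j => -Real.log (1 - A i j ^ 2 / (A i i * A j j))) G / 2 := by
  rw [hR.treePrec_eq hA hd hs, det_mul, det_mul, det_transpose, hR.det_innovation, det_diagonal,
    one_mul, mul_one, Real.log_prod fun v _ => (inv_pos.2 (hR.innovVar_pos hA hd v)).ne',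
    hR.pairWeight_eq _ fun i j => by rw [hs i j, mul_comm (A i i)]]
  rw [mul_div_cancel_left₀ _ two_ne_zero, ← Finset.sum_neg_distrib, ← Finset.sum_add_distrib]
  refine Finset.sum_congr rfl fun v _ => ?_
  rw [Real.log_inv]
  by_cases hv : v = r
  · simp [innovVar, hv]
  · have h1 := hd v (par v) (hR.adj v hv).ne
    have h2 := hA (par v)
    have h3 := hA v
    rw [innovVar, if_neg hv, if_neg hv]
    have h4 : A v v - A v (par v) ^ 2 / A (par v) (par v) =
        A v v * (1 - A v (par v) ^ 2 / (A v v * A (par v) (par v))) := by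
      field_simp
    have h5 : 1 - A v (par v) ^ 2 / (A v v * A (par v) (par v)) =
        (A v v * A (par v) (par v) - A v (par v) ^ 2) / (A v v * A (par v) (par v)) := by
      field_simp
    rw [h4, Real.log_mul h3.ne' (by rw [h5]; positivity)]
    ring

end RootedFactor

/-! ### Optimality of the Chow-Liu algorithm. -/

section ChowLiu

variable {V : Type} {A : Matrix V V ℝ}

theorem symm_of_posDef (hA : A.PosDef) (i j : V) : A i j = A j i := by
  have := hA.isHermitian.apply j i
  simpa using this

theorem minor_pos_of_posDef (hA : A.PosDef) {i j : V} (hij : i ≠ j) :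
    0 < A i i * A j j - A i j ^ 2 := by
  have hinj : Function.Injective ![i, j] := by
    intro a b
    fin_cases a <;> fin_cases b <;> simp [hij, hij.symm]
  have h := (hA.submatrix hinj).det_pos
  rw [det_fin_two] at h
  simp only [submatrix_apply, Matrix.cons_val_zero, Matrix.cons_val_one] at h
  rwa [symm_of_posDef hA j i, ← sq] at h

theorem corr_symm (hA : A.PosDef) (i j : V) : corr A i j = corr A j i := by
  simp only [corr]
  rw [symm_of_posDef hA i j, mul_comm (A i i)]

theorem sq_corr (hA : A.PosDef) (i j : V) : |corr A i j| ^ 2 = A i j ^ 2 / (A i i * A j j) := by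
  rw [sq_abs, corr, div_pow, Real.sq_sqrt (mul_pos hA.diag_pos hA.diag_pos).le]

theorem not_sparsityGraph_adj {Q : Matrix V V ℝ} {i j : V} (hij : i ≠ j)
    (h : ¬ (sparsityGraph Q).Adj i j) : Q i j = 0 := by
  by_contra hc
  exact h (by rw [sparsityGraph, SimpleGraph.fromRel_adj]; exact ⟨hij, Or.inl hc⟩)

variable [Fintype V]

theorem isMaxSpanningTree_iff {G : SimpleGraph V} :
    IsMaxSpanningTree A G ↔ IsMaxTree (fun i j => |corr A i j|) G := by
  have h : ∀ G, graphWeight A G = pairWeight (fun i j => |corr A i j|) G / 2 := fun _ => rfl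
  simp only [IsMaxSpanningTree, IsMaxTree, h, div_le_div_iff_of_pos_right (zero_lt_two' ℝ)]

variable [DecidableEq V]

theorem treePrec_apply_eq_zero {G : SimpleGraph V} {i j : V} (hij : i ≠ j) (h : ¬ G.Adj i j) :
    treePrec G A i j = 0 := by
  simp [treePrec, hij, h]

/-- The trace meets only entries on the diagonal and on tree edges, where `treeCov` agrees with `A`.
-/
theorem trace_mul_treeCov {G : SimpleGraph V} (hG : G.IsTree) (hA : A.PosDef) {Q : Matrix V V ℝ}
    (hQ : ∀ i j, i ≠ j → ¬ G.Adj i j → Q i j = 0) :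
    (Q * treeCov hG A).trace = (Q * A).trace := by
  simp only [trace, diag, mul_apply]
  refine Finset.sum_congr rfl fun i _ => Finset.sum_congr rfl fun j _ => ?_
  by_cases hij : i = j
  · subst hij
    rw [treeCov_self hG fun i => hA.diag_pos]
  · by_cases hadj : G.Adj i j
    · rw [treeCov_edge hG (fun i => hA.diag_pos) hadj.symm]
    · rw [hQ i j hij hadj, zero_mul, zero_mul]

theorem treeCov_eq_inv {G : SimpleGraph V} (hG : G.IsTree) (hA : A.PosDef) :
    (treeCov hG A)⁻¹ = treePrec G A :=
  Matrix.inv_eq_left_inv (treePrec_mul_treeCov hG (fun _ => hA.diag_pos)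
    (fun _ _ => minor_pos_of_posDef hA) (symm_of_posDef hA))

theorem posDef_treePrec {G : SimpleGraph V} (hG : G.IsTree) (hA : A.PosDef) :
    (treePrec G A).PosDef := by
  obtain ⟨r⟩ := hG.connected.nonempty
  obtain ⟨par, h, hR⟩ := exists_isRooted hG r
  exact hR.posDef_treePrec (fun _ => hA.diag_pos) (fun _ _ => minor_pos_of_posDef hA)
    (symm_of_posDef hA)

theorem posDef_treeCov {G : SimpleGraph V} (hG : G.IsTree) (hA : A.PosDef) :
    (treeCov hG A).PosDef := by
  rw [← posDef_inv_iff, treeCov_eq_inv hG hA]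
  exact posDef_treePrec hG hA

/-- The trace part equals the number of nodes for every tree, so trees are compared by log det
alone: each edge contributes −log(1 − ρ²), twice its mutual information. -/
theorem gaussLoss_treePrec {G : SimpleGraph V} (hG : G.IsTree) (hA : A.PosDef) :
    gaussLoss A (treePrec G A) = Fintype.card V + ∑ v, Real.log (A v v) -
      pairWeight (fun i j => -Real.log (1 - A i j ^ 2 / (A i i * A j j))) G / 2 := by
  obtain ⟨r⟩ := hG.connected.nonempty
  obtain ⟨par, h, hR⟩ := exists_isRooted hG r
  unfold gaussLoss
  rw [← trace_mul_treeCov hG hA fun i j hij h => treePrec_apply_eq_zero hij h,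
    treePrec_mul_treeCov hG (fun _ => hA.diag_pos) (fun _ _ => minor_pos_of_posDef hA)
    (symm_of_posDef hA), trace_one, hR.log_det_treePrec (fun _ => hA.diag_pos)
    (fun _ _ => minor_pos_of_posDef hA) (symm_of_posDef hA)]
  ring

/-- The tree model is the best approximation with a sparsity graph contained in the tree. -/
theorem gaussLoss_treePrec_le {G : SimpleGraph V} (hG : G.IsTree) (hA : A.PosDef)
    {Q : Matrix V V ℝ} (hQ : Q.PosDef) (hQG : ∀ i j, i ≠ j → ¬ G.Adj i j → Q i j = 0) :
    gaussLoss A (treePrec G A) ≤ gaussLoss A Q := by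
  -- For information matrices supported on the tree, `A` may be replaced by `treeCov`, whose
  -- unconstrained optimum `treePrec` is itself supported on the tree.
  have h1 : ∀ P : Matrix V V ℝ, (∀ i j, i ≠ j → ¬ G.Adj i j → P i j = 0) →
      gaussLoss A P = gaussLoss (treeCov hG A) P := by
    intro P hP
    unfold gaussLoss
    rw [trace_mul_treeCov hG hA hP]
  rw [h1 Q hQG, h1 _ fun i j hij h => treePrec_apply_eq_zero hij h, ← treeCov_eq_inv hG hA]
  exact gaussLoss_inv_le (posDef_treeCov hG hA) hQ

/-- On distinct nodes ρ² < 1, and −log(1 − ρ²) increases with |ρ|. By `IsMaxTree.mono` the tree that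
is maximal for |ρ| is maximal for this weight too. -/
theorem IsMaxSpanningTree.gaussLoss_le {G H : SimpleGraph V} (hG : IsMaxSpanningTree A G)
    (hH : H.IsTree) (hA : A.PosDef) :
    gaussLoss A (treePrec G A) ≤ gaussLoss A (treePrec H A) := by
  have hmax : IsMaxTree (fun i j => -Real.log (1 - A i j ^ 2 / (A i i * A j j))) G := by
    refine (isMaxSpanningTree_iff.1 hG).mono (fun i j => by rw [corr_symm hA]) (fun i j => ?_) ?_
    · rw [symm_of_posDef hA i j, mul_comm (A i i)]
    · intro a b x y hab hxy hle
      have h1 : |corr A a b| ^ 2 ≤ |corr A x y| ^ 2 :=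
        pow_le_pow_left₀ (abs_nonneg _) hle 2
      rw [sq_corr hA, sq_corr hA] at h1
      have h2 : 0 < 1 - A x y ^ 2 / (A x x * A y y) := by
        have h3 := minor_pos_of_posDef hA hxy
        have h4 : 0 < A x x * A y y := mul_pos hA.diag_pos hA.diag_pos
        rw [sub_pos, div_lt_one h4]
        linarith
      exact neg_le_neg (Real.log_le_log h2 (by linarith))
  have := hmax.2 H hH
  rw [gaussLoss_treePrec hG.1 hA, gaussLoss_treePrec hH hA]
  linarith

/-- The Chow-Liu algorithm finds the best approximation with an acyclic sparsity graph. -/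
theorem IsChowLiu.gaussLoss_le {G : SimpleGraph V} {C Q : Matrix V V ℝ} (hA : A.PosDef)
    (hC : IsChowLiu A G C) (hQ : Q.PosDef) (hac : (sparsityGraph Q).IsAcyclic) :
    gaussLoss A C⁻¹ ≤ gaussLoss A Q := by
  have h1 := hC.tree
  obtain rfl := ((isChowLiu_iff h1.1 fun _ => hA.diag_pos).1 hC).2
  have := h1.1.connected.nonempty
  -- The acyclic graph of `Q` is extended to a spanning tree `H`. The model `treePrec H` is at least
  -- as good as `Q`, and the maximal tree at least as good as `H`.
  obtain ⟨H, hle, -, hH⟩ := (SimpleGraph.connected_top (V := V)).exists_isTree_le_of_le_of_isAcyclic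
    le_top hac
  rw [treeCov_eq_inv _ hA]
  exact (h1.gaussLoss_le hH hA).trans (gaussLoss_treePrec_le hH hA hQ fun i j hij h =>
    not_sparsityGraph_adj hij fun h' => h (hle h'))

theorem IsChowLiu.posDef {G : SimpleGraph V} {C : Matrix V V ℝ} (hA : A.PosDef)
    (hC : IsChowLiu A G C) : C.PosDef := by
  have h1 := hC.tree
  obtain rfl := ((isChowLiu_iff h1.1 fun _ => hA.diag_pos).1 hC).2
  exact posDef_treeCov _ hA

theorem IsChowLiu.inv_eq {G : SimpleGraph V} {C : Matrix V V ℝ} (hA : A.PosDef)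
    (hC : IsChowLiu A G C) : C⁻¹ = treePrec G A := by
  have h1 := hC.tree
  obtain rfl := ((isChowLiu_iff h1.1 fun _ => hA.diag_pos).1 hC).2
  exact treeCov_eq_inv _ hA

theorem IsChowLiu.isAcyclic_inv {G : SimpleGraph V} {C : Matrix V V ℝ} (hA : A.PosDef)
    (hC : IsChowLiu A G C) : (sparsityGraph C⁻¹).IsAcyclic := by
  rw [hC.inv_eq hA]
  refine hC.tree.1.isAcyclic.anti fun i j hij => ?_
  rw [sparsityGraph, SimpleGraph.fromRel_adj] at hij
  by_contra hadj
  rcases hij.2 with h | h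
  · exact h (treePrec_apply_eq_zero hij.1 hadj)
  · exact h (treePrec_apply_eq_zero hij.1.symm fun h => hadj h.symm)

end ChowLiu

/-! ### The two projections and monotonicity of the observed divergence. -/

section Projections

variable {F T : Type} [Fintype F] [Fintype T] [DecidableEq F] [DecidableEq T]
  {S S' J J' : Matrix (F ⊕ T) (F ⊕ T) ℝ} {ST : Matrix T T ℝ}

theorem IsCCL.posDef (hS : S.PosDef) (h : IsCCL S S') : S'.PosDef := by
  obtain ⟨G, C, hC, rfl⟩ := h
  exact posDef_fromBlocks (posDef_toBlocks₁₁ hS) (hC.posDef (posDef_schur hS)) _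

/-- Adding the correction back makes the Chow-Liu output the Schur complement of `S'`, so the
T-block of the new information matrix is that of a tree model. -/
theorem IsCCL.inv_toBlocks₂₂ (hS : S.PosDef) (h : IsCCL S S') :
    ∃ G C, IsChowLiu (S.toBlocks₂₂ - correction S) G C ∧ S'⁻¹.toBlocks₂₂ = C⁻¹ := by
  have hS' := h.posDef hS
  obtain ⟨G, C, hC, rfl⟩ := h
  refine ⟨G, C, hC, ?_⟩
  rw [LatentChowLiu.inv_toBlocks₂₂ hS', correction_fromBlocks, toBlocks_fromBlocks₂₂, correction,
    add_sub_cancel_right]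

theorem IsCCL.hasFVS (hS : S.PosDef) (h : IsCCL S S') : HasFVS S'⁻¹ := by
  refine ⟨(h.posDef hS).inv, ?_⟩
  obtain ⟨G, C, hC, h2⟩ := h.inv_toBlocks₂₂ hS
  rw [h2]
  exact hC.isAcyclic_inv (posDef_schur hS)

/-- The conditioned Chow-Liu algorithm is an exact projection. -/
theorem IsCCL.gaussLoss_le (hS : S.PosDef) (h : IsCCL S S') (hJ : HasFVS J) :
    gaussLoss S S'⁻¹ ≤ gaussLoss S J := by
  have hS' := h.posDef hS
  have hS'u := hS'.det_pos.ne'.isUnit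
  obtain ⟨G, C, hC, h2⟩ := h.inv_toBlocks₂₂ hS
  have hF : S'.toBlocks₁₁ = S.toBlocks₁₁ := by
    obtain ⟨_, _, _, rfl⟩ := h
    simp
  have hM : S'.toBlocks₂₁ = S.toBlocks₂₁ := by
    obtain ⟨_, _, _, rfl⟩ := h
    simp
  have h21 := inv_toBlocks₂₁ hS'
  rw [hF, hM] at h21
  -- Since S' keeps the F-block and the regression of `S`, the squared term vanishes for it, and the
  -- conditional and the marginal loss are minimised separately.
  rw [gaussLoss_blocks_eq hS hS'.inv h21, h2, Matrix.nonsing_inv_nonsing_inv _ hS'u, hF]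
  refine le_trans (add_le_add ?_ ?_) (gaussLoss_blocks_le hS hJ.1)
  · exact hC.gaussLoss_le (posDef_schur hS) (posDef_toBlocks₂₂ hJ.1) hJ.2
  · exact gaussLoss_inv_le (posDef_toBlocks₁₁ hS) (posDef_toBlocks₁₁ hJ.1.inv).inv

theorem posDef_projInfo (hST : ST.PosDef) (hJ : J.PosDef) : (projInfo ST J).PosDef :=
  posDef_fromBlocks (posDef_toBlocks₁₁ hJ) hST.inv _

theorem posDef_projCov (hST : ST.PosDef) (hJ : J.PosDef) : (projCov ST J).PosDef :=
  (posDef_projInfo hST hJ).inv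

/-- The observed marginal of the first projection is the empirical covariance matrix. -/
theorem projCov_toBlocks₂₂ (hST : ST.PosDef) (hJ : J.PosDef) :
    (projCov ST J).toBlocks₂₂ = ST := by
  rw [projCov, inv_toBlocks₂₂ (posDef_projInfo hST hJ), projInfo, correction_fromBlocks,
    toBlocks_fromBlocks₂₂, add_sub_cancel_right,
    Matrix.nonsing_inv_nonsing_inv _ hST.det_pos.ne'.isUnit]

theorem projCov_toBlocks₂₁ (hST : ST.PosDef) (hJ : J.PosDef) :
    (projCov ST J).toBlocks₂₁ = -(ST * (J.toBlocks₂₁ * J.toBlocks₁₁⁻¹)) := by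
  have h := inv_toBlocks₂₁ (posDef_projInfo hST hJ)
  rw [← projCov, projCov_toBlocks₂₂ hST hJ] at h
  simpa [projInfo] using h

/-- The loss of a model splits into the loss of the observed marginal and the loss of the
conditional distribution of the latent nodes. -/
theorem gaussLoss_observed_le (hS : S.PosDef) (hJ : J.PosDef) :
    gaussLoss S⁻¹.toBlocks₁₁⁻¹ J.toBlocks₁₁ + gaussLoss S.toBlocks₂₂ J⁻¹.toBlocks₂₂⁻¹ ≤
      gaussLoss S J := by
  have h := gaussLoss_blocks_le (posDef_swap hS) (posDef_swap hJ)
  rw [schur_eq_inv (posDef_swap hS), Matrix.inv_submatrix_equiv, Matrix.inv_submatrix_equiv,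
    gaussLoss_submatrix] at h
  exact h

/-- The blocks J_F and J_M determine the conditional law of F given T. P1 leaves them unchanged,
hence the chain rule holds without a squared term. -/
theorem gaussLoss_observed_eq (hS : S.PosDef) (hJ : J.PosDef)
    (h11 : S⁻¹.toBlocks₁₁ = J.toBlocks₁₁) (h21 : S⁻¹.toBlocks₂₁ = J.toBlocks₂₁) :
    gaussLoss S J =
      gaussLoss S⁻¹.toBlocks₁₁⁻¹ J.toBlocks₁₁ + gaussLoss S.toBlocks₂₂ J⁻¹.toBlocks₂₂⁻¹ := by
  have h1 := inv_toBlocks₂₁ (posDef_swap hS)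
  have e1 : (S.submatrix (Equiv.sumComm T F) (Equiv.sumComm T F))⁻¹.toBlocks₂₁ =
      (J.submatrix (Equiv.sumComm T F) (Equiv.sumComm T F)).toBlocks₂₁ := by
    rw [Matrix.inv_submatrix_equiv]
    change S⁻¹.toBlocks₁₂ = J.toBlocks₁₂
    rw [← transpose_toBlocks₂₁ hS.inv, ← transpose_toBlocks₂₁ hJ, h21]
  have e2 : (S.submatrix (Equiv.sumComm T F) (Equiv.sumComm T F))⁻¹.toBlocks₂₂ =
      (J.submatrix (Equiv.sumComm T F) (Equiv.sumComm T F)).toBlocks₂₂ := by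
    rw [Matrix.inv_submatrix_equiv]
    exact h11
  rw [e1, e2] at h1
  have h := gaussLoss_blocks_eq (posDef_swap hS) (posDef_swap hJ) h1
  rw [schur_eq_inv (posDef_swap hS), Matrix.inv_submatrix_equiv, Matrix.inv_submatrix_equiv,
    gaussLoss_submatrix] at h
  exact h

/-- One iteration does not increase the divergence from the empirical distribution. -/
theorem gaussLoss_marginal_le (hST : ST.PosDef) (hJ : HasFVS J)
    (h : IsCCL (projCov ST J) S') :
    gaussLoss ST S'.toBlocks₂₂⁻¹ ≤ gaussLoss ST J⁻¹.toBlocks₂₂⁻¹ := by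
  have hP := posDef_projCov hST hJ.1
  have hS' := h.posDef hP
  have hinv : (projCov ST J)⁻¹ = projInfo ST J :=
    Matrix.nonsing_inv_nonsing_inv _ (posDef_projInfo hST hJ.1).det_pos.ne'.isUnit
  have h11 : (projCov ST J)⁻¹.toBlocks₁₁ = J.toBlocks₁₁ := by
    rw [hinv, projInfo, toBlocks_fromBlocks₁₁]
  have h21 : (projCov ST J)⁻¹.toBlocks₂₁ = J.toBlocks₂₁ := by
    rw [hinv, projInfo, toBlocks_fromBlocks₂₁]
  -- With the total loss split into the conditional loss of F given T and the observed loss: `e1`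
  -- bounds the new total from below, `e2` evaluates the old total, `e3` says that P2 does not raise
  -- the total, and `e4` that the old conditional law was already optimal. Adding these leaves the
  -- observed losses.
  have e1 := gaussLoss_observed_le hP hS'.inv
  have e2 := gaussLoss_observed_eq hP hJ.1 h11 h21
  have e3 := h.gaussLoss_le hP hJ
  have e4 := gaussLoss_inv_le (posDef_toBlocks₁₁ hP.inv).inv (posDef_toBlocks₁₁ hS'.inv)
  rw [Matrix.nonsing_inv_nonsing_inv _ hS'.det_pos.ne'.isUnit, projCov_toBlocks₂₂ hST hJ.1] at e1
  rw [Matrix.nonsing_inv_nonsing_inv _ (posDef_toBlocks₁₁ hP.inv).det_pos.ne'.isUnit] at e4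
  rw [projCov_toBlocks₂₂ hST hJ.1, ← h11] at e2
  linarith

theorem IsRun.hasFVS {J S : ℕ → Matrix (F ⊕ T) (F ⊕ T) ℝ} (hST : ST.PosDef)
    (h : IsRun ST J S) (t : ℕ) : HasFVS (J t) := by
  induction t with
  | zero => exact h.init
  | succ t ih =>
    rw [h.info]
    exact (h.cov t).hasFVS (posDef_projCov hST ih.1)

theorem IsRun.cov_eq_inv {J S : ℕ → Matrix (F ⊕ T) (F ⊕ T) ℝ} (hST : ST.PosDef)
    (h : IsRun ST J S) (t : ℕ) : S t = (J t)⁻¹ := by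
  cases t with
  | zero => exact h.init_cov
  | succ t =>
    have := (h.cov t).posDef (posDef_projCov hST (h.hasFVS hST t).1)
    rw [h.info, Matrix.nonsing_inv_nonsing_inv _ this.det_pos.ne'.isUnit]

theorem IsRun.projection_exact {J S : ℕ → Matrix (F ⊕ T) (F ⊕ T) ℝ} (hST : ST.PosDef)
    (h : IsRun ST J S) (t : ℕ) :
    (projCov ST (J t)).PosDef ∧ (S (t + 1)).PosDef ∧ HasFVS (J (t + 1)) ∧
      gauss (S (t + 1)) ∈ familyQ F T ∧
      IsMinOn (fun q => InformationTheory.klDiv (gauss (projCov ST (J t))) q)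
        (familyQ F T) (gauss (S (t + 1))) := by
  have hP := posDef_projCov hST (h.hasFVS hST t).1
  have hJ := h.hasFVS hST (t + 1)
  have hinv := h.cov_eq_inv hST (t + 1)
  refine ⟨hP, (h.cov t).posDef hP, hJ, ⟨_, hJ, by rw [hinv]⟩, ?_⟩
  rintro _ ⟨Q, hQ, rfl⟩
  change InformationTheory.klDiv _ _ ≤ InformationTheory.klDiv _ _
  rw [hinv]
  refine klDiv_gauss_inv_le hP hJ.1 hQ.1 ?_
  rw [h.info]
  exact (h.cov t).gaussLoss_le hP hQ

theorem IsRun.klDiv_le {J S : ℕ → Matrix (F ⊕ T) (F ⊕ T) ℝ} (hST : ST.PosDef)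
    (h : IsRun ST J S) (t : ℕ) :
    InformationTheory.klDiv (gauss ST) (gauss (S (t + 1)).toBlocks₂₂) ≤
      InformationTheory.klDiv (gauss ST) (gauss (S t).toBlocks₂₂) := by
  have hJ := h.hasFVS hST t
  have hS : (S (t + 1)).PosDef := (h.cov t).posDef (posDef_projCov hST hJ.1)
  have h1 := posDef_toBlocks₂₂ hS
  have h2 := posDef_toBlocks₂₂ hJ.1.inv
  have := klDiv_gauss_inv_le hST h1.inv h2.inv (gaussLoss_marginal_le hST hJ (h.cov t))
  rwa [Matrix.nonsing_inv_nonsing_inv _ h1.det_pos.ne'.isUnit,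
    Matrix.nonsing_inv_nonsing_inv _ h2.det_pos.ne'.isUnit, ← h.cov_eq_inv hST t] at this

end Projections

/-! ### Loop rules and cost bounds for the machine. -/

section Machine

/-- The program `p` takes the memory `s` to the memory `s'` in at most `c` steps. -/
def Runs (p : Prog) (s : Mem) (c : ℕ) (s' : Mem) : Prop := ∃ c' ≤ c, Exec p s c' s'

theorem Exec.runs {p : Prog} {s s' : Mem} {c c' : ℕ} (h : Exec p s c s') (hc : c ≤ c') :
    Runs p s c' s' := ⟨c, hc, h⟩

theorem Runs.mono {p : Prog} {s s' : Mem} {c c' : ℕ} (h : Runs p s c s') (hc : c ≤ c') :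
    Runs p s c' s' := by
  obtain ⟨d, hd, hx⟩ := h
  exact ⟨d, hd.trans hc, hx⟩

theorem Runs.seq {p q : Prog} {s s' s'' : Mem} {c c' : ℕ} (hp : Runs p s c s')
    (hq : Runs q s' c' s'') : Runs (.seq p q) s (c + c') s'' := by
  obtain ⟨d, hd, hx⟩ := hp
  obtain ⟨d', hd', hx'⟩ := hq
  exact ⟨d + d', add_le_add hd hd', .seq hx hx'⟩

/-- Run `p` for the values `0, 1, …` of register `x` below the value of register `b`. -/
def forLoop (x b : ℕ) (p : Prog) : Prog :=
  .seq (.setIReg x (.const 0))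
    (.while (.ilt (.reg x) (.reg b)) (.seq p (.setIReg x (.add (.reg x) (.const 1)))))

/-- Here `d` counts the remaining rounds. A round costs 3 for the test, at most `B` for the body and
4 for the increment; the final failing test costs 3. The invariant is stated at the test, thus after
the increment. -/
theorem runs_while {x b : ℕ} {p : Prog} {N B : ℕ} {I : ℕ → Mem → Prop}
    (hb : ∀ i s, I i s → s.nreg b = N)
    (hstep : ∀ i < N, ∀ s, I i s → s.nreg x = i → ∃ s', Runs p s B s' ∧ s'.nreg x = i ∧
      I (i + 1) (s'.setIReg x (i + 1))) (d : ℕ) :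
    ∀ i, i + d = N → ∀ s, I i s → s.nreg x = i → ∃ s',
      Runs (.while (.ilt (.reg x) (.reg b)) (.seq p (.setIReg x (.add (.reg x) (.const 1))))) s
        (3 + d * (B + 7)) s' ∧ I N s' ∧ s'.nreg x = N := by
  induction d with
  | zero =>
    intro i hi s hI hx
    obtain rfl : i = N := hi
    refine ⟨s, (Exec.whileFalse ?_).runs (by simp [BExp.cost, IExp.cost]), hI, hx⟩
    simp [BExp.holds, IExp.eval, hb i s hI, hx]
  | succ d ih =>
    intro i hi s hI hx
    obtain ⟨s', ⟨c', hc', hx'⟩, hxi, hI'⟩ := hstep i (by omega) s hI hx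
    obtain ⟨s'', ⟨c'', hc'', hx''⟩, h2, h3⟩ := ih (i + 1) (by omega) _ hI' (by simp [Mem.setIReg])
    have hcond : (BExp.ilt (.reg x) (.reg b)).holds s := by
      simp only [BExp.holds, IExp.eval, hb i s hI, hx]
      omega
    have hinc : (IExp.add (.reg x) (.const 1)).eval s' = i + 1 := by simp only [IExp.eval, hxi]
    rw [← hinc] at hx''
    refine ⟨s'', (Exec.whileTrue hcond (Exec.seq hx' (Exec.setIReg x _ s')) hx'').runs ?_, h2, h3⟩
    simp only [BExp.cost, IExp.cost]
    have : (d + 1) * (B + 7) = d * (B + 7) + (B + 7) := by ring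
    omega

/-- The invariant rule for counting loops. -/
theorem runs_forLoop {x b : ℕ} {p : Prog} {N B : ℕ} {s : Mem} (I : ℕ → Mem → Prop)
    (h0 : I 0 (s.setIReg x 0)) (hb : ∀ i s, I i s → s.nreg b = N)
    (hstep : ∀ i < N, ∀ s, I i s → s.nreg x = i → ∃ s', Runs p s B s' ∧ s'.nreg x = i ∧
      I (i + 1) (s'.setIReg x (i + 1))) :
    ∃ s', Runs (forLoop x b p) s ((N + 1) * (B + 7)) s' ∧ I N s' ∧ s'.nreg x = N := by
  obtain ⟨s', h1, h2, h3⟩ := runs_while hb hstep N 0 (by omega) _ h0 (by simp [Mem.setIReg])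
  refine ⟨s', ?_, h2, h3⟩
  have h4 := ((Exec.setIReg x (.const 0) s).runs le_rfl).seq h1
  refine h4.mono ?_
  simp only [IExp.cost]
  have : (N + 1) * (B + 7) = N * (B + 7) + (B + 7) := by ring
  omega

/-- The real registers read by an expression. -/
def RExp.usesReg : RExp → ℕ → Prop
  | const _, _ => False
  | reg y, x => y = x
  | arr _ _ _, _ => False
  | add e₁ e₂, x => e₁.usesReg x ∨ e₂.usesReg x
  | sub e₁ e₂, x => e₁.usesReg x ∨ e₂.usesReg x
  | mul e₁ e₂, x => e₁.usesReg x ∨ e₂.usesReg x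
  | div e₁ e₂, x => e₁.usesReg x ∨ e₂.usesReg x
  | sqrt e, x => e.usesReg x

/-- The real matrices read by an expression. -/
def RExp.usesArr : RExp → ℕ → Prop
  | const _, _ => False
  | reg _, _ => False
  | arr b _ _, a => b = a
  | add e₁ e₂, a => e₁.usesArr a ∨ e₂.usesArr a
  | sub e₁ e₂, a => e₁.usesArr a ∨ e₂.usesArr a
  | mul e₁ e₂, a => e₁.usesArr a ∨ e₂.usesArr a
  | div e₁ e₂, a => e₁.usesArr a ∨ e₂.usesArr a
  | sqrt e, a => e.usesArr a

theorem IExp.eval_congr {s s' : Mem} (hn : s.nreg = s'.nreg) (ha : s.narr = s'.narr) (e : IExp) :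
    e.eval s = e.eval s' := by
  induction e with
  | const c => rfl
  | reg x => simp only [IExp.eval, hn]
  | arr a i ih => simp only [IExp.eval, ha, ih]
  | add e₁ e₂ h₁ h₂ => simp only [IExp.eval, h₁, h₂]
  | sub e₁ e₂ h₁ h₂ => simp only [IExp.eval, h₁, h₂]

theorem RExp.eval_congr {s s' : Mem} (hn : s.nreg = s'.nreg) (ha : s.narr = s'.narr) (e : RExp)
    (hr : ∀ x, e.usesReg x → s.rreg x = s'.rreg x)
    (hm : ∀ a, e.usesArr a → s.rarr a = s'.rarr a) : e.eval s = e.eval s' := by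
  induction e with
  | const c => rfl
  | reg x => exact hr x rfl
  | arr a i j =>
    simp only [RExp.eval, IExp.eval_congr hn ha, hm a rfl]
  | sqrt e ih => simp only [RExp.eval, ih hr hm]
  | _ e₁ e₂ h₁ h₂ =>
    simp only [RExp.eval, h₁ (fun x hx => hr x (Or.inl hx)) (fun x hx => hm x (Or.inl hx)),
      h₂ (fun x hx => hr x (Or.inr hx)) (fun x hx => hm x (Or.inr hx))]

/-- Only index registers in `N` and real matrices in `A` may differ. -/
structure Frame (N A : Set ℕ) (s s' : Mem) : Prop where
  nreg : ∀ x, x ∉ N → s'.nreg x = s.nreg x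
  rarr : ∀ a, a ∉ A → s'.rarr a = s.rarr a

theorem Frame.refl (N A : Set ℕ) (s : Mem) : Frame N A s s := ⟨fun _ _ => rfl, fun _ _ => rfl⟩

theorem Frame.trans {N A : Set ℕ} {s s' s'' : Mem} (h : Frame N A s s') (h' : Frame N A s' s'') :
    Frame N A s s'' :=
  ⟨fun x hx => (h'.nreg x hx).trans (h.nreg x hx), fun a ha => (h'.rarr a ha).trans (h.rarr a ha)⟩

theorem Frame.mono {N A N' A' : Set ℕ} {s s' : Mem} (h : Frame N A s s') (hN : N ⊆ N')
    (hA : A ⊆ A') : Frame N' A' s s' :=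
  ⟨fun x hx => h.nreg x fun h' => hx (hN h'), fun a ha => h.rarr a fun h' => ha (hA h')⟩

theorem Frame.stores {N A : Set ℕ} {s s' : Mem} (h : Frame N A s s') {a : ℕ} (ha : a ∉ A)
    {r c : ℕ} {M : Matrix (Fin r) (Fin c) ℝ} (hM : s.Stores a M) : s'.Stores a M := by
  intro i j
  rw [h.rarr a ha]
  exact hM i j

/-- The memory in which the loop registers 2, 3, 4 hold `i`, `j`, `t`. -/
def Mem.loopAt (s : Mem) (i j t : ℕ) : Mem := ((s.setIReg 2 i).setIReg 3 j).setIReg 4 t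

/-- Matrix `a` receives, for `i` and `j` below the values of registers `r` and `q`, the value of `f`
with the sum of the values of `e` over `t` below the value of register `l` in real register 0. -/
def fillSum (a r q l : ℕ) (e f : RExp) : Prog :=
  forLoop 2 r (forLoop 3 q (.seq (.setRReg 0 (.const 0))
    (.seq (forLoop 4 l (.setRReg 0 (.add (.reg 0) e))) (.setRArr a (.reg 2) (.reg 3) f))))

/-- The value that `fillSum` stores in the entry `(i, j)`. -/
def fillSumVal (s : Mem) (l : ℕ) (e f : RExp) (i j : ℕ) : ℝ :=
  f.eval ((s.loopAt i j (s.nreg l)).setRReg 0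
    (∑ t ∈ Finset.range (s.nreg l), e.eval (s.loopAt i j t)))

/-- The bound for the number of steps of `fillSum` is this constant times the volume. -/
def fillSumCost (e f : RExp) : ℕ := e.cost + f.cost + 31

/-- The summand reads neither the accumulator nor the target matrix, and the final expression does
not read the target. Their values in the running memory are therefore those in the original memory
with the loop registers set. -/
theorem runs_fillSum (s : Mem) (a r q l : ℕ) (e f : RExp)
    (hr : r ∉ ({2, 3, 4} : Set ℕ)) (hq : q ∉ ({2, 3, 4} : Set ℕ)) (hl : l ∉ ({2, 3, 4} : Set ℕ))
    (he : ¬ e.usesReg 0) (hea : ¬ e.usesArr a) (hfa : ¬ f.usesArr a) :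
    ∃ s', Runs (fillSum a r q l e f) s
        (fillSumCost e f * ((s.nreg r + 1) * (s.nreg q + 1) * (s.nreg l + 1))) s' ∧
      Frame {2, 3, 4} {a} s s' ∧ s'.narr = s.narr ∧ (∀ x, x ≠ 0 → s'.rreg x = s.rreg x) ∧
      ∀ i < s.nreg r, ∀ j < s.nreg q, s'.rarr a i j = fillSumVal s l e f i j := by
  set nr := s.nreg r
  set nq := s.nreg q
  set nl := s.nreg l
  let Base : Mem → Prop := fun s' => Frame {2, 3, 4} {a} s s' ∧ s'.narr = s.narr ∧
    (∀ x, x ≠ 0 → s'.rreg x = s.rreg x)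
  have hbase : ∀ s' x v, (x = 2 ∨ x = 3 ∨ x = 4) → Base s' → Base (s'.setIReg x v) := by
    rintro s' x v hx ⟨h1, h2, h3⟩
    refine ⟨⟨fun y hy => ?_, h1.rarr⟩, h2, h3⟩
    rw [← h1.nreg y hy]
    refine Function.update_of_ne ?_ _ _
    rintro rfl
    exact hy (by simpa using hx)
  have hat : ∀ s' i j t, Base s' → s'.nreg 2 = i → s'.nreg 3 = j → s'.nreg 4 = t →
      s'.nreg = (s.loopAt i j t).nreg := by
    rintro s' i j t ⟨h1, -, -⟩ rfl rfl rfl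
    ext x
    by_cases h4 : x = 4
    · subst h4; simp [Mem.loopAt, Mem.setIReg]
    by_cases h3 : x = 3
    · subst h3; simp [Mem.loopAt, Mem.setIReg]
    by_cases h2 : x = 2
    · subst h2; simp [Mem.loopAt, Mem.setIReg]
    rw [h1.nreg x (by simp [h2, h3, h4])]
    simp [Mem.loopAt, Mem.setIReg, h2, h3, h4]
  -- Entries are finished in lexicographic order; in this form, finishing a row is the same as
  -- starting the next row at column 0.
  let Done : ℕ → ℕ → Mem → Prop := fun i j s' => ∀ i' j', (i' < i ∨ (i' = i ∧ j' < j)) →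
    j' < nq → s'.rarr a i' j' = fillSumVal s l e f i' j'
  have hbody : ∀ i j, ∀ s₁, Base s₁ → s₁.nreg 2 = i → s₁.nreg 3 = j → Done i j s₁ →
      ∃ s₂, Runs (.seq (.setRReg 0 (.const 0)) (.seq (forLoop 4 l (.setRReg 0 (.add (.reg 0) e)))
        (.setRArr a (.reg 2) (.reg 3) f))) s₁ ((nl + 1) * (e.cost + f.cost + 16)) s₂ ∧ Base s₂ ∧
        s₂.nreg 2 = i ∧ s₂.nreg 3 = j ∧ Done i (j + 1) s₂ := by
    intro i j s₁ hB hi hj hD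
    obtain ⟨s₂, hrun, ⟨hB2, hi2, hj2, hacc, harr⟩, ht2⟩ := runs_forLoop (x := 4) (b := l)
      (p := .setRReg 0 (.add (.reg 0) e)) (N := nl) (B := e.cost + 3) (s := s₁.setRReg 0 0)
      (fun t s' => Base s' ∧ s'.nreg 2 = i ∧ s'.nreg 3 = j ∧
        s'.rreg 0 = ∑ t ∈ Finset.range t, e.eval (s.loopAt i j t) ∧ s'.rarr = s₁.rarr)
      (by
        refine ⟨hbase _ _ _ (by simp) ⟨⟨hB.1.nreg, hB.1.rarr⟩, hB.2.1, fun x hx => ?_⟩, ?_, ?_, ?_,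
          rfl⟩
        · rw [← hB.2.2 x hx]
          exact Function.update_of_ne hx _ _
        · simpa [Mem.setIReg, Mem.setRReg] using hi
        · simpa [Mem.setIReg, Mem.setRReg] using hj
        · simp [Mem.setIReg, Mem.setRReg])
      (fun t s' h => h.1.1.nreg l hl)
      (by
        rintro t - s' ⟨hB', hi', hj', hacc', harr'⟩ ht'
        refine ⟨_, (Exec.setRReg 0 _ s').runs (by simp only [RExp.cost]; omega), ht',
          hbase _ _ _ (by simp) ⟨⟨hB'.1.nreg, hB'.1.rarr⟩, hB'.2.1, fun x hx => ?_⟩, ?_, ?_, ?_,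
          harr'⟩
        · rw [← hB'.2.2 x hx]
          exact Function.update_of_ne hx _ _
        · simpa [Mem.setIReg, Mem.setRReg] using hi'
        · simpa [Mem.setIReg, Mem.setRReg] using hj'
        · rw [Finset.sum_range_succ, ← hacc']
          have : e.eval s' = e.eval (s.loopAt i j t) := by
            refine RExp.eval_congr (hat s' i j t hB' hi' hj' ht') hB'.2.1 e (fun x hx => ?_)
              fun b hb => ?_
            · exact hB'.2.2 x fun h => he (h ▸ hx)
            · exact hB'.1.rarr b fun h => hea (by rwa [Set.mem_singleton_iff.1 h] at hb)
          simp [Mem.setIReg, Mem.setRReg, RExp.eval, this])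
    -- After the summation loop its counter rests at the bound, which is why the final expression is
    -- evaluated with register 4 equal to `nl`.
    have hval : f.eval s₂ = fillSumVal s l e f i j := by
      refine RExp.eval_congr (s' := (s.loopAt i j nl).setRReg 0
        (∑ t ∈ Finset.range nl, e.eval (s.loopAt i j t))) (hat s₂ i j nl hB2 hi2 hj2 ht2) hB2.2.1 f
        (fun x hx => ?_) fun b hb => ?_
      · by_cases h0 : x = 0
        · subst h0
          rw [hacc]
          simp [Mem.setRReg, nl]
        · rw [hB2.2.2 x h0]
          simp [Mem.setRReg, Mem.loopAt, Mem.setIReg, h0]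
      · exact hB2.1.rarr b fun h => hfa (by rwa [Set.mem_singleton_iff.1 h] at hb)
    refine ⟨_, (((Exec.setRReg 0 (.const 0) s₁).runs le_rfl).seq ((by
      simpa [RExp.eval] using hrun : Runs _ _ _ _).seq
        ((Exec.setRArr a (.reg 2) (.reg 3) f s₂).runs le_rfl))).mono ?_, ?_, hi2, hj2, ?_⟩
    · simp only [RExp.cost, IExp.cost]
      nlinarith [Nat.zero_le nl, Nat.zero_le f.cost, Nat.zero_le e.cost,
        Nat.zero_le (nl * f.cost)]
    · refine ⟨⟨hB2.1.nreg, fun b hb => ?_⟩, hB2.2.1, hB2.2.2⟩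
      rw [← hB2.1.rarr b hb]
      ext i' j'
      have : b ≠ a := hb
      simp [Mem.setRArr, this]
    · intro i' j' hij hj'
      simp only [Mem.setRArr, IExp.eval, hi2, hj2, hval]
      split_ifs with h
      · rw [h.2.1, h.2.2]
      · rw [harr]
        refine hD i' j' ?_ hj'
        simp only [true_and] at h
        omega
  have hmid : ∀ i, ∀ s₁, Base s₁ → s₁.nreg 2 = i → Done i 0 s₁ →
      ∃ s₂, Runs (forLoop 3 q (.seq (.setRReg 0 (.const 0))
        (.seq (forLoop 4 l (.setRReg 0 (.add (.reg 0) e))) (.setRArr a (.reg 2) (.reg 3) f)))) s₁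
        ((nq + 1) * ((nl + 1) * (e.cost + f.cost + 16) + 7)) s₂ ∧ Base s₂ ∧
        s₂.nreg 2 = i ∧ Done (i + 1) 0 s₂ := by
    intro i s₁ hB hi hD
    obtain ⟨s₂, hrun, ⟨hB2, hi2, hD2⟩, -⟩ := runs_forLoop (x := 3) (b := q) (N := nq)
      (p := .seq (.setRReg 0 (.const 0)) (.seq (forLoop 4 l (.setRReg 0 (.add (.reg 0) e)))
        (.setRArr a (.reg 2) (.reg 3) f))) (B := (nl + 1) * (e.cost + f.cost + 16)) (s := s₁)
      (fun j s' => Base s' ∧ s'.nreg 2 = i ∧ Done i j s')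
      ⟨hbase _ _ _ (by simp) hB, by simpa [Mem.setIReg] using hi, hD⟩
      (fun j s' h => h.1.1.nreg q hq)
      (by
        rintro j - s' ⟨hB', hi', hD'⟩ hj'
        obtain ⟨s₂, h1, h2, h3, h4, h5⟩ := hbody i j s' hB' hi' hj' hD'
        exact ⟨s₂, h1, h4, hbase _ _ _ (by simp) h2, by simpa [Mem.setIReg] using h3, h5⟩)
    refine ⟨s₂, hrun, hB2, hi2, fun i' j' hij hj' => hD2 i' j' ?_ hj'⟩
    omega
  obtain ⟨s₂, hrun, ⟨hB2, hD2⟩, -⟩ := runs_forLoop (x := 2) (b := r) (N := nr)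
    (p := forLoop 3 q (.seq (.setRReg 0 (.const 0))
        (.seq (forLoop 4 l (.setRReg 0 (.add (.reg 0) e))) (.setRArr a (.reg 2) (.reg 3) f))))
    (B := (nq + 1) * ((nl + 1) * (e.cost + f.cost + 16) + 7)) (s := s)
    (fun i s' => Base s' ∧ Done i 0 s')
    ⟨hbase _ _ _ (by simp) ⟨Frame.refl _ _ _, rfl, fun _ _ => rfl⟩, fun i' j' h => by omega⟩
    (fun i s' h => h.1.1.nreg r hr)
    (by
      rintro i - s' ⟨hB', hD'⟩ hi'
      obtain ⟨s₂, h1, h2, h3, h4⟩ := hmid i s' hB' hi' hD'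
      exact ⟨s₂, h1, h3, hbase _ _ _ (by simp) h2, h4⟩)
  refine ⟨s₂, hrun.mono ?_, hB2.1, hB2.2.1, hB2.2.2, fun i hi j hj => hD2 i j (Or.inl hi) hj⟩
  unfold fillSumCost
  calc (nr + 1) * ((nq + 1) * ((nl + 1) * (e.cost + f.cost + 16) + 7) + 7)
      ≤ (nr + 1) * ((nq + 1) * ((nl + 1) * (e.cost + f.cost + 16) + 7 * (nl + 1)) +
        7 * ((nq + 1) * (nl + 1))) := by
        gcongr
        · omega
        · nlinarith [Nat.zero_le (nq * nl)]
    _ = (e.cost + f.cost + 30) * ((nr + 1) * (nq + 1) * (nl + 1)) := by ring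
    _ ≤ (e.cost + f.cost + 31) * ((nr + 1) * (nq + 1) * (nl + 1)) := by gcongr; omega

end Machine

/-! ### Gauss-Jordan inversion without pivoting. -/

section Sweep

variable {k : ℕ} {A M : Matrix (Fin k) (Fin k) ℝ}

/-- The Gauss-Jordan exchange step with pivot `p`. -/
def sweep (M : Matrix (Fin k) (Fin k) ℝ) (p : Fin k) : Matrix (Fin k) (Fin k) ℝ := fun i j =>
  M i j - (M i p + if i = p then 1 else 0) * (M p j - if p = j then 1 else 0) / M p p

/-- The result of the exchange steps with the first `p` pivots. -/
def sweepIter (A : Matrix (Fin k) (Fin k) ℝ) : ℕ → Matrix (Fin k) (Fin k) ℝ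
  | 0 => A
  | p + 1 => if h : p < k then sweep (sweepIter A p) ⟨p, h⟩ else sweepIter A p

/-- The vector that agrees with `y` before position `p` and with `x` from there on. -/
def mixVec (p : ℕ) (y x : Fin k → ℝ) : Fin k → ℝ := fun i => if (i : ℕ) < p then y i else x i

/-- If each coordinate of either Ax or x vanishes according to its position, then xᵀAx = 0 and x =
0. The mixing map is thus an injective endomorphism, hence surjective. -/
theorem exists_mixVec_eq (hA : A.PosDef) (p : ℕ) (u : Fin k → ℝ) :
    ∃ x, mixVec p (A *ᵥ x) x = u := by
  let Φ : (Fin k → ℝ) →ₗ[ℝ] (Fin k → ℝ) :=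
    { toFun := fun x => mixVec p (A *ᵥ x) x
      map_add' := fun x y => by
        ext i
        simp only [mixVec, Matrix.mulVec_add, Pi.add_apply]
        split_ifs <;> rfl
      map_smul' := fun c x => by
        ext i
        simp only [mixVec, Matrix.mulVec_smul, Pi.smul_apply, RingHom.id_apply]
        split_ifs <;> rfl }
  have hinj : Function.Injective Φ := by
    rw [injective_iff_map_eq_zero]
    intro x hx
    by_contra hne
    have h1 := hA.dotProduct_mulVec_pos hne
    refine h1.ne' (Finset.sum_eq_zero fun i _ => ?_)
    have h2 : mixVec p (A *ᵥ x) x i = 0 := congrFun hx i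
    simp only [mixVec] at h2
    split_ifs at h2 with h
    · rw [h2, mul_zero]
    · simp [h2]
  exact LinearMap.injective_iff_surjective.1 hinj u

/-- Choose x with mixed vector e_p. The invariant gives M_pp = (Ax)_p, and this equals xᵀAx because
the earlier coordinates of Ax and the later ones of x are zero while x_p = 1. -/
theorem sweep_pivot_pos (hA : A.PosDef) {p : Fin k}
    (hM : ∀ x, M *ᵥ mixVec p (A *ᵥ x) x = mixVec p x (A *ᵥ x)) : 0 < M p p := by
  obtain ⟨x, hx⟩ := exists_mixVec_eq hA p (Pi.single p 1)
  have h1 : M p p = (A *ᵥ x) p := by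
    have := congrFun (hM x) p
    rw [hx, Matrix.mulVec_single_one] at this
    simpa [mixVec] using this
  have hxi : ∀ i : Fin k, ¬ (i : ℕ) < p → x i = Pi.single (M := fun _ => ℝ) p 1 i := by
    intro i hi
    rw [← hx]
    simp [mixVec, hi]
  have hyi : ∀ i : Fin k, (i : ℕ) < p → (A *ᵥ x) i = 0 := by
    intro i hi
    have h2 := congrFun hx i
    simp only [mixVec, if_pos hi] at h2
    rw [h2, Pi.single_eq_of_ne]
    rintro rfl
    exact lt_irrefl _ hi
  have hxp : x p = 1 := by rw [hxi p (lt_irrefl _)]; simp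
  have hne : x ≠ 0 := by
    rintro rfl
    simp at hxp
  have h3 := hA.dotProduct_mulVec_pos hne
  have h4 : star x ⬝ᵥ A *ᵥ x = (A *ᵥ x) p := by
    rw [dotProduct, Finset.sum_eq_single p]
    · simp [hxp]
    · intro i _ hip
      by_cases hi : (i : ℕ) < p
      · rw [hyi i hi, mul_zero]
      · simp [hxi i hi, Pi.single_eq_of_ne hip]
    · simp
  rwa [h4, ← h1] at h3

/-- The invariant: with y = Ax, the current matrix sends the vector made of y before the pivot and x
from there on to the one with the roles of x and y interchanged. A step solves row p for x_p and
substitutes. The two indicators in `sweep` merge the four cases pivot, pivot row, pivot column and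
remainder into one formula. -/
theorem sweep_mulVec (hA : A.PosDef) {p : Fin k}
    (hM : ∀ x, M *ᵥ mixVec p (A *ᵥ x) x = mixVec p x (A *ᵥ x)) (x : Fin k → ℝ) :
    sweep M p *ᵥ mixVec (p + 1) (A *ᵥ x) x = mixVec (p + 1) x (A *ᵥ x) := by
  have hd := (sweep_pivot_pos hA hM).ne'
  have hmix : ∀ y z : Fin k → ℝ, mixVec (p + 1) y z =
      mixVec p y z + Pi.single p (y p - z p) := by
    intro y z
    ext i
    simp only [mixVec, Pi.add_apply]
    rcases lt_trichotomy i p with h | h | h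
    · have h' : (i : ℕ) < p := h
      simp [h', h'.trans (Nat.lt_succ_self _), h.ne]
    · subst h
      simp
    · have h' : (p : ℕ) < i := h
      simp [h'.not_gt, (Nat.succ_le_of_lt h').not_gt, h.ne']
  have hv := hM x
  have hvp : ∑ j, M p j * mixVec p (A *ᵥ x) x j = (A *ᵥ x) p := by
    have := congrFun hv p
    simpa [mixVec, mulVec, dotProduct] using this
  have hup : mixVec p (A *ᵥ x) x p = x p := by simp [mixVec]
  ext i
  have hvi : ∑ j, M i j * mixVec p (A *ᵥ x) x j = mixVec p x (A *ᵥ x) i := congrFun hv i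
  rw [hmix, hmix, Matrix.mulVec_add, Pi.add_apply, Pi.add_apply, Matrix.mulVec_single]
  have h1 : (sweep M p *ᵥ mixVec p (A *ᵥ x) x) i = mixVec p x (A *ᵥ x) i -
      (M i p + if i = p then 1 else 0) / M p p * ((A *ᵥ x) p - x p) := by
    set u := mixVec p (A *ᵥ x) x
    have hsum : (sweep M p *ᵥ u) i = ∑ j, sweep M p i j * u j := rfl
    rw [hsum, ← hvi, ← hup, ← hvp]
    have : ∀ j, sweep M p i j * u j = M i j * u j -
        (M i p + if i = p then 1 else 0) / M p p * (M p j * u j - if p = j then u j else 0) := by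
      intro j
      simp only [sweep]
      split_ifs <;> ring
    rw [Finset.sum_congr rfl fun j _ => this j, Finset.sum_sub_distrib, ← Finset.mul_sum,
      Finset.sum_sub_distrib]
    simp
  rw [h1]
  simp only [Pi.smul_apply, MulOpposite.smul_eq_mul_unop, MulOpposite.unop_op, sweep, if_true,
    Matrix.col_apply]
  by_cases hip : i = p
  · subst hip
    simp only [if_true, Pi.single_eq_same]
    field_simp
    ring
  · simp only [hip, if_false, add_zero, Pi.single_eq_of_ne (M := fun _ => ℝ) hip]
    field_simp
    ring

theorem sweepIter_mulVec (hA : A.PosDef) (p : ℕ) (hp : p ≤ k) (x : Fin k → ℝ) :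
    sweepIter A p *ᵥ mixVec p (A *ᵥ x) x = mixVec p x (A *ᵥ x) := by
  induction p generalizing x with
  | zero =>
    have h : ∀ y z : Fin k → ℝ, mixVec 0 y z = z := fun y z => by ext i; simp [mixVec]
    simp [h, sweepIter]
  | succ p ih =>
    have hpk : p < k := hp
    simp only [sweepIter, dif_pos hpk]
    exact sweep_mulVec (p := ⟨p, hpk⟩) hA (ih hpk.le) x

/-- Gauss-Jordan exchange inverts a positive definite matrix without pivoting. -/
theorem sweepIter_eq_inv (hA : A.PosDef) : sweepIter A k = A⁻¹ := by
  refine (Matrix.inv_eq_left_inv ?_).symm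
  refine Matrix.ext_of_mulVec_single fun i => ?_
  rw [← Matrix.mulVec_mulVec, Matrix.one_mulVec]
  have h := sweepIter_mulVec hA k le_rfl (Pi.single i 1)
  have h2 : ∀ y z : Fin k → ℝ, mixVec k y z = y := fun y z => by ext i; simp [mixVec]
  rwa [h2, h2] at h

end Sweep

/-! ### The inversion program. -/

section Inversion

/-- Kronecker's delta, read off from the matrix number 7. -/
def delta (e₁ e₂ : IExp) : RExp := .arr 7 (.const 0) (.add (.sub e₁ e₂) (.sub e₂ e₁))

/-- Matrix number 7 starts with the row `1, 0, …, 0`. -/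
def HasDelta (s : Mem) (n : ℕ) : Prop := ∀ d ≤ n, s.rarr 7 0 d = if d = 0 then 1 else 0

/-- Of the two truncated differences one is zero and the other is the distance of the indices.
Looking the distance up in a table brings a case distinction into arithmetic expressions, which have
no conditional. -/
theorem HasDelta.eval {s : Mem} {n : ℕ} (h : HasDelta s n) {e₁ e₂ : IExp} (h₁ : e₁.eval s ≤ n)
    (h₂ : e₂.eval s ≤ n) : (delta e₁ e₂).eval s = if e₁.eval s = e₂.eval s then 1 else 0 := by
  simp only [delta, RExp.eval, IExp.eval]
  rw [h _ (by omega)]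
  exact if_congr (by omega) rfl rfl

theorem HasDelta.frame {s s' : Mem} {n : ℕ} {N A : Set ℕ} (h : HasDelta s n)
    (hF : Frame N A s s') (h7 : 7 ∉ A) : HasDelta s' n := by
  intro d hd
  rw [hF.rarr 7 h7]
  exact h d hd

/-- Evaluation of a `fillSum` without summation. -/
theorem fillSumVal_const {s : Mem} {l : ℕ} {f : RExp} (hl : s.nreg l = 0) (i j : ℕ) :
    fillSumVal s l (.const 0) f i j = f.eval ((s.loopAt i j 0).setRReg 0 0) := by
  simp [fillSumVal, hl]

/-- The entry formula of the exchange step, with the pivot in register 5. -/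
def sweepExp (b : ℕ) : RExp :=
  .sub (.arr b (.reg 2) (.reg 3))
    (.div (.mul (.add (.arr b (.reg 2) (.reg 5)) (delta (.reg 2) (.reg 5)))
      (.sub (.arr b (.reg 5) (.reg 3)) (delta (.reg 5) (.reg 3)))) (.arr b (.reg 5) (.reg 5)))

/-- Matrix `b` receives the inverse of matrix `a`; the size is in register 0. -/
def invert (a b : ℕ) : Prog :=
  .seq (fillSum b 0 0 10 (.const 0) (.arr a (.reg 2) (.reg 3)))
    (forLoop 5 0 (.seq (fillSum 9 0 0 10 (.const 0) (sweepExp b))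
      (fillSum b 0 0 10 (.const 0) (.arr 9 (.reg 2) (.reg 3)))))

/-- Register 10 holds zero, so the summation loop is empty and the cost is only quadratic. -/
theorem runs_copy (s : Mem) (a b : ℕ) (hab : a ≠ b) (h10 : s.nreg 10 = 0) {k : ℕ}
    (h0 : s.nreg 0 = k) {M : Matrix (Fin k) (Fin k) ℝ} (hM : s.Stores a M) :
    ∃ s', Runs (fillSum b 0 0 10 (.const 0) (.arr a (.reg 2) (.reg 3))) s
      (36 * ((k + 1) * (k + 1))) s' ∧ Frame {2, 3, 4} {b} s s' ∧ s'.Stores b M := by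
  obtain ⟨s', h1, h2, -, -, h3⟩ := runs_fillSum s b 0 0 10 (.const 0) (.arr a (.reg 2) (.reg 3))
    (by simp) (by simp) (by simp) (by simp [RExp.usesReg]) (by simp [RExp.usesArr])
    (by simpa [RExp.usesArr] using hab)
  refine ⟨s', h1.mono ?_, h2, fun i j => ?_⟩
  · rw [h0, h10]
    simp only [fillSumCost, RExp.cost, IExp.cost]
    omega
  · rw [h3 i (h0 ▸ i.2) j (h0 ▸ j.2), fillSumVal_const h10, ← hM i j]
    simp [RExp.eval, IExp.eval, Mem.loopAt, Mem.setIReg, Mem.setRReg]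

/-- Every new entry depends on the old pivot row and column, so the step is computed in matrix 9 and
then copied back. -/
theorem runs_sweep (s : Mem) (b : ℕ) (hb : b ≠ 9) (h10 : s.nreg 10 = 0) {k : ℕ}
    (h0 : s.nreg 0 = k) (hδ : HasDelta s k) {M : Matrix (Fin k) (Fin k) ℝ} (hM : s.Stores b M)
    (p : Fin k) (h5 : s.nreg 5 = p) :
    ∃ s', Runs (.seq (fillSum 9 0 0 10 (.const 0) (sweepExp b))
      (fillSum b 0 0 10 (.const 0) (.arr 9 (.reg 2) (.reg 3)))) s
      (200 * ((k + 1) * (k + 1))) s' ∧ Frame {2, 3, 4} {b, 9} s s' ∧ s'.Stores b (sweep M p) := by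
  obtain ⟨s₁, h1, h2, -, -, h3⟩ := runs_fillSum s 9 0 0 10 (.const 0) (sweepExp b)
    (by simp) (by simp) (by simp) (by simp [RExp.usesReg]) (by simp [RExp.usesArr])
    (by simpa [RExp.usesArr, sweepExp, delta] using hb)
  have hS : s₁.Stores 9 (sweep M p) := by
    intro i j
    rw [h3 i (h0 ▸ i.2) j (h0 ▸ j.2), fillSumVal_const h10]
    set s' := (s.loopAt i j 0).setRReg 0 0 with hs'
    have e2 : s'.nreg 2 = i := by simp [hs', Mem.loopAt, Mem.setIReg, Mem.setRReg]
    have e3 : s'.nreg 3 = j := by simp [hs', Mem.loopAt, Mem.setIReg, Mem.setRReg]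
    have e5 : s'.nreg 5 = p := by simp [hs', Mem.loopAt, Mem.setIReg, Mem.setRReg, h5]
    have hδ' : HasDelta s' k := hδ
    have d1 := hδ'.eval (e₁ := .reg 2) (e₂ := .reg 5) (by simp only [IExp.eval, e2]; omega)
      (by simp only [IExp.eval, e5]; omega)
    have d2 := hδ'.eval (e₁ := .reg 5) (e₂ := .reg 3) (by simp only [IExp.eval, e5]; omega)
      (by simp only [IExp.eval, e3]; omega)
    simp only [IExp.eval, e2, e3, e5, ← Fin.ext_iff] at d1 d2
    simp only [sweepExp, RExp.eval, IExp.eval, e2, e3, e5, d1, d2, sweep, ← hM _ _]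
    rfl
  obtain ⟨s₂, h4, h5, h6⟩ := runs_copy s₁ 9 b hb.symm (by rw [h2.nreg 10 (by simp), h10])
    (by rw [h2.nreg 0 (by simp), h0]) hS
  refine ⟨s₂, (h1.seq h4).mono ?_, (h2.mono le_rfl (by simp)).trans (h5.mono le_rfl (by simp)), h6⟩
  rw [h0, h10]
  simp only [fillSumCost, RExp.cost, IExp.cost, sweepExp, delta]
  nlinarith

theorem runs_invert (s : Mem) (a b : ℕ) (hab : a ≠ b) (hb : b ≠ 9) (hb7 : b ≠ 7)
    (h10 : s.nreg 10 = 0) {k : ℕ} (h0 : s.nreg 0 = k) (hδ : HasDelta s k)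
    {M : Matrix (Fin k) (Fin k) ℝ} (hM : M.PosDef) (hs : s.Stores a M) :
    ∃ s', Runs (invert a b) s (243 * ((k + 1) * (k + 1) * (k + 1))) s' ∧
      Frame {2, 3, 4, 5} {b, 9} s s' ∧ s'.Stores b M⁻¹ := by
  obtain ⟨s₁, h1, h2, h3⟩ := runs_copy s a b hab h10 h0 hs
  have hinit : Frame {2, 3, 4, 5} {b, 9} s (s₁.setIReg 5 0) := by
    refine ⟨fun x hx => ?_, fun c hc => h2.rarr c fun h => hc (by simp at h ⊢; tauto)⟩
    rw [← h2.nreg x (fun h => hx (by simp at h ⊢; tauto))]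
    exact Function.update_of_ne (fun h => hx (by simp [h])) _ _
  obtain ⟨s₂, h4, ⟨h5, h6⟩, -⟩ := runs_forLoop (x := 5) (b := 0) (N := k)
    (p := .seq (fillSum 9 0 0 10 (.const 0) (sweepExp b))
      (fillSum b 0 0 10 (.const 0) (.arr 9 (.reg 2) (.reg 3))))
    (B := 200 * ((k + 1) * (k + 1))) (s := s₁)
    (fun p s' => Frame {2, 3, 4, 5} {b, 9} s s' ∧ s'.Stores b (sweepIter M p))
    ⟨hinit, h3⟩ (fun p s' h => by rw [h.1.nreg 0 (by simp), h0]) (by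
      rintro p hp s' ⟨hF, hS⟩ h5
      obtain ⟨s'', r1, r2, r3⟩ := runs_sweep s' b hb (by rw [hF.nreg 10 (by simp), h10])
        (by rw [hF.nreg 0 (by simp), h0]) (hδ.frame hF (by simp [hb7.symm])) hS ⟨p, hp⟩ h5
      refine ⟨s'', r1, by rw [r2.nreg 5 (by simp), h5], ⟨fun x hx => ?_, fun c hc => ?_⟩, ?_⟩
      · rw [← hF.nreg x hx, ← r2.nreg x (fun h => hx (by simp at h ⊢; tauto))]
        exact Function.update_of_ne (fun h => hx (by simp [h])) _ _
      · rw [← hF.rarr c hc, ← r2.rarr c hc]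
        rfl
      · have : sweepIter M (p + 1) = sweep (sweepIter M p) ⟨p, hp⟩ := by simp [sweepIter, hp]
        rw [this]
        exact r3)
  rw [sweepIter_eq_inv hM] at h6
  refine ⟨s₂, (h1.seq h4).mono ?_, h5, h6⟩
  nlinarith [Nat.zero_le k, Nat.zero_le (k * k), Nat.zero_le (k * k * k)]

end Inversion

/-! ### Prim's algorithm and the covariances along its tree. -/

section Prim

variable {V : Type} [Fintype V] {r : V} {n : ℕ} {vis : V → ℕ} {par : V → V} {w : V → V → ℝ}
  {A C : Matrix V V ℝ}

/-- The state of Prim's algorithm, started in `r`, after `n` nodes have been visited: `vis v` is the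
time at which `v` was visited (zero if it was not), `par v` is the parent of a visited node and the
best visited neighbour of a node not yet visited, and `C` holds the covariances between visited
nodes. -/
structure PrimState (w : V → V → ℝ) (A : Matrix V V ℝ) (r : V) (n : ℕ) (vis : V → ℕ) (par : V → V)
    (C : Matrix V V ℝ) : Prop where
  card : (Finset.univ.filter fun v => vis v ≠ 0).card = n
  le : ∀ v, vis v ≤ n
  inj : ∀ u v, vis u = vis v → vis u ≠ 0 → u = v
  root : vis r = 1
  par_visited : ∀ v, v ≠ r → vis (par v) ≠ 0
  par_lt : ∀ v, v ≠ r → vis v ≠ 0 → vis (par v) < vis v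
  best : ∀ v, vis v = 0 → ∀ u, vis u ≠ 0 → w v u ≤ w v (par v)
  tree : ∃ G, IsMaxTree w G ∧ ∀ v, v ≠ r → vis v ≠ 0 → G.Adj v (par v)
  diag : ∀ v, vis v ≠ 0 → C v v = A v v
  cov : ∀ v u, vis u ≠ 0 → vis u < vis v →
    C v u = A v (par v) / A (par v) (par v) * C (par v) u ∧ C u v = C v u

open Classical in
theorem PrimState.init (w : V → V → ℝ) (A : Matrix V V ℝ) (r : V) (hC : C r r = A r r)
    (hv : ∀ v, vis v = if v = r then 1 else 0) (hp : ∀ v, par v = r) :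
    PrimState w A r 1 vis par C := by
  have hvr : vis r = 1 := by simp [hv]
  have h0 : ∀ v, vis v ≠ 0 → v = r := by
    intro v h
    by_contra hvr
    exact h (by simp [hv, hvr])
  have : Nonempty V := ⟨r⟩
  obtain ⟨G, hG⟩ := exists_isMaxTree w
  refine ⟨?_, ?_, ?_, hvr, ?_, ?_, ?_, ⟨G, hG, fun v hv hv' => absurd (h0 v hv') hv⟩, ?_, ?_⟩
  · have : (Finset.univ.filter fun v => vis v ≠ 0) = {r} := by
      ext v
      simp only [Finset.mem_filter, Finset.mem_univ, true_and, Finset.mem_singleton]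
      exact ⟨h0 v, fun h => by simp [h, hvr]⟩
    rw [this, Finset.card_singleton]
  · intro v
    rw [hv]
    split_ifs <;> omega
  · intro u v h hu
    rw [h0 u hu, h0 v (h ▸ hu)]
  · intro v _
    rw [hp, hvr]
    exact one_ne_zero
  · intro v hvr' hv'
    exact absurd (h0 v hv') hvr'
  · intro v _ u hu
    rw [hp, h0 u hu]
  · intro v hv'
    rw [h0 v hv', hC]
  · intro v u hu huv
    rw [h0 u hu, h0 v (by omega)] at huv
    exact absurd huv (lt_irrefl _)

theorem PrimState.exists_unvisited (h : PrimState w A r n vis par C) (hn : n < Fintype.card V) :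
    ∃ v, vis v = 0 := by
  by_contra! hc
  have := h.card
  rw [Finset.filter_true_of_mem fun v _ => hc v, Finset.card_univ] at this
  omega

-- The edge from b to par b is heaviest between visited and unvisited nodes, so
-- `IsMaxTree.exists_adj_of_cut` provides a maximum tree containing it and all edges chosen before.
-- The covariances of b with the visited nodes come from those of its parent by the Markov
-- recursion.
open Classical in
theorem PrimState.step (hw : ∀ i j, w i j = w j i) (h : PrimState w A r n vis par C) {b : V}
    (hb : vis b = 0) (hbest : ∀ v, vis v = 0 → w v (par v) ≤ w b (par b)) {vis' : V → ℕ}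
    {par' : V → V} {C' : Matrix V V ℝ} (hvis : ∀ v, vis' v = if v = b then n + 1 else vis v)
    (hpar : ∀ v, par' v = if vis' v = 0 ∧ w v (par v) < w v b then b else par v)
    (hCb : C' b b = A b b)
    (hCu : ∀ u, vis u ≠ 0 →
      C' b u = A b (par b) / A (par b) (par b) * C (par b) u ∧ C' u b = C' b u)
    (hC : ∀ u v, vis u ≠ 0 → vis v ≠ 0 → C' u v = C u v) :
    PrimState w A r (n + 1) vis' par' C' := by
  have hbr : b ≠ r := by
    rintro rfl
    rw [h.root] at hb
    exact one_ne_zero hb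
  have hvb : vis' b = n + 1 := by simp [hvis]
  have hvo : ∀ v, v ≠ b → vis' v = vis v := fun v hv => by simp [hvis, hv]
  have hne : ∀ v, vis v ≠ 0 → v ≠ b := fun v hv hvb => hv (hvb ▸ hb)
  have hv0 : ∀ v, vis' v = 0 → vis v = 0 ∧ v ≠ b := by
    intro v hv
    have : v ≠ b := by
      rintro rfl
      omega
    exact ⟨hvo v this ▸ hv, this⟩
  have hvn : ∀ v, vis' v ≠ 0 → par' v = par v := fun v hv => by simp [hpar, hv]
  have hvp : ∀ v, vis v ≠ 0 → vis' v ≠ 0 := fun v hv => by rwa [hvo v (hne v hv)]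
  have hmem : ∀ v, vis' v ≠ 0 → v = b ∨ vis v ≠ 0 := by
    intro v hv
    by_cases hvb : v = b
    · exact Or.inl hvb
    · exact Or.inr (hvo v hvb ▸ hv)
  have hpb := h.par_visited b hbr
  refine ⟨?_, ?_, ?_, ?_, ?_, ?_, ?_, ?_, ?_, ?_⟩
  · have : (Finset.univ.filter fun v => vis' v ≠ 0) =
        insert b (Finset.univ.filter fun v => vis v ≠ 0) := by
      ext v
      simp only [Finset.mem_filter, Finset.mem_univ, true_and, Finset.mem_insert]
      refine ⟨hmem v, ?_⟩
      rintro (rfl | hv)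
      · omega
      · exact hvp v hv
    rw [this, Finset.card_insert_of_notMem (by simp [hb]), h.card]
  · intro v
    rw [hvis]
    split_ifs
    · exact le_rfl
    · exact (h.le v).trans (Nat.le_succ n)
  · intro u v huv hu
    have := h.le u
    have := h.le v
    by_cases hub : u = b
    · by_cases hvb' : v = b
      · rw [hub, hvb']
      · rw [hub, hvb, hvo v hvb'] at huv
        omega
    · by_cases hvb' : v = b
      · rw [hvb', hvb, hvo u hub] at huv
        omega
      · rw [hvo u hub] at huv hu
        rw [hvo v hvb'] at huv
        exact h.inj u v huv hu
  · rw [hvo r hbr.symm, h.root]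
  · intro v hvr
    rw [hpar]
    split_ifs
    · omega
    · exact hvp _ (h.par_visited v hvr)
  · intro v hvr hv
    rw [hvn v hv]
    rcases hmem v hv with rfl | hv'
    · rw [hvb, hvo _ (hne _ hpb)]
      exact Nat.lt_succ_of_le (h.le _)
    · rw [hvo v (hne v hv'), hvo _ (hne _ (h.par_visited v hvr))]
      exact h.par_lt v hvr hv'
  · intro v hv u hu
    have hv1 := hv0 v hv
    rw [hpar]
    split_ifs with hlt
    · rcases hmem u hu with rfl | hu'
      · exact le_rfl
      · exact (h.best v hv1.1 u hu').trans hlt.2.le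
    · rcases hmem u hu with rfl | hu'
      · exact not_lt.1 fun h' => hlt ⟨hv, h'⟩
      · exact h.best v hv1.1 u hu'
  · obtain ⟨G, hG, hadj⟩ := h.tree
    obtain ⟨G', hG', hab, hkeep⟩ := hG.exists_adj_of_cut hw (X := {v | vis v ≠ 0}) (a := par b)
      (b := b) hpb (by simp [hb]) (fun u hu v hv => by
        have hv' : vis v = 0 := by simpa using hv
        rw [hw u v, hw (par b) b]
        exact (h.best v hv' u hu).trans (hbest v hv'))
    refine ⟨G', hG', fun v hvr hv => ?_⟩
    rw [hvn v hv]
    rcases hmem v hv with rfl | hv'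
    · exact hab.symm
    · exact hkeep v hv' (par v) (h.par_visited v hvr) (hadj v hvr hv')
  · intro v hv
    rcases hmem v hv with rfl | hv'
    · exact hCb
    · rw [hC v v hv' hv', h.diag v hv']
  · intro v u hu huv
    have hv : vis' v ≠ 0 := by omega
    rw [hvn v hv]
    rcases hmem v hv with rfl | hv'
    · have hub : u ≠ v := by
        rintro rfl
        exact lt_irrefl _ huv
      have hu' : vis u ≠ 0 := hvo u hub ▸ hu
      rw [hC _ u hpb hu']
      exact hCu u hu'
    · have hvb' := hne v hv'
      have hub : u ≠ b := by
        rintro rfl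
        rw [hvb, hvo v hvb'] at huv
        have := h.le v
        omega
      rw [hvo u hub] at hu huv
      rw [hvo v hvb'] at huv
      have hvr : v ≠ r := by
        rintro rfl
        rw [h.root] at huv
        omega
      rw [hC v u hv' hu, hC u v hu hv', hC _ u (h.par_visited v hvr) hu]
      exact h.cov v u hu huv

/-- The tree of a completed run of Prim's algorithm. -/
def parentGraph (r : V) (par : V → V) : SimpleGraph V where
  Adj i j := i ≠ j ∧ ((i ≠ r ∧ par i = j) ∨ (j ≠ r ∧ par j = i))
  symm := ⟨fun _ _ h => ⟨h.1.symm, h.2.symm⟩⟩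
  loopless := ⟨fun _ h => h.1 rfl⟩

theorem PrimState.adj_par (h : PrimState w A r n vis par C) (hall : ∀ v, vis v ≠ 0) {v : V}
    (hv : v ≠ r) : (parentGraph r par).Adj v (par v) := by
  refine ⟨fun he => ?_, Or.inl ⟨hv, rfl⟩⟩
  have := h.par_lt v hv (hall v)
  rw [← he] at this
  exact lt_irrefl _ this

/-- Following parents leads to the root, and visiting times drop on the way. The bound on the times
later keeps such walks away from nodes visited afterwards. -/
theorem PrimState.exists_walk (h : PrimState w A r n vis par C) (hall : ∀ v, vis v ≠ 0) (v : V) :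
    ∃ p : (parentGraph r par).Walk v r, ∀ x ∈ p.support, vis x ≤ vis v := by
  induction hn : vis v using Nat.strong_induction_on generalizing v with
  | _ N ih =>
    subst hn
    by_cases hv : v = r
    · subst hv
      exact ⟨.nil, by simp⟩
    · have hlt := h.par_lt v hv (hall v)
      obtain ⟨p, hp⟩ := ih _ hlt (par v) rfl
      refine ⟨.cons (h.adj_par hall hv) p, fun x hx => ?_⟩
      rw [SimpleGraph.Walk.support_cons, List.mem_cons] at hx
      rcases hx with rfl | hx
      · exact le_rfl
      · exact (hp x hx).trans hlt.le

/-- The parent edges lie in some maximum tree and connect all nodes; a connected spanning subgraph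
of a tree is the whole tree. -/
theorem PrimState.isMaxTree (h : PrimState w A r n vis par C) (hall : ∀ v, vis v ≠ 0) :
    IsMaxTree w (parentGraph r par) := by
  obtain ⟨G, hG, hadj⟩ := h.tree
  have hle : parentGraph r par ≤ G := by
    rintro i j ⟨-, ⟨hi, rfl⟩ | ⟨hj, rfl⟩⟩
    · exact hadj i hi (hall i)
    · exact (hadj j hj (hall j)).symm
  have hconn : (parentGraph r par).Connected := by
    have : Nonempty V := ⟨r⟩
    refine ⟨fun u v => ?_⟩
    obtain ⟨p, -⟩ := h.exists_walk hall u
    obtain ⟨q, -⟩ := h.exists_walk hall v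
    exact ⟨p.append q.reverse⟩
  rwa [IsTree.eq_of_le hG.1 ⟨hconn, hG.1.isAcyclic.anti hle⟩ hle]

/-- The walk from par v through the root to u meets only nodes visited no later than par v or u,
hence before v. The path from par v to u therefore avoids v, and the path from v begins at its
parent. -/
theorem PrimState.treePath_eq (h : PrimState w A r n vis par C) (hall : ∀ v, vis v ≠ 0)
    (hG : (parentGraph r par).IsTree) {u v : V} (huv : vis u < vis v) (hv : v ≠ r) :
    treePath hG v u = SimpleGraph.Walk.cons (h.adj_par hall hv) (treePath hG (par v) u) := by
  classical
  refine (treePath_adj hG (h.adj_par hall hv) u).resolve_right fun hc => ?_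
  obtain ⟨p, hp⟩ := h.exists_walk hall (par v)
  obtain ⟨q, hq⟩ := h.exists_walk hall u
  have hmem : v ∈ (p.append q.reverse).support := by
    refine (p.append q.reverse).support_bypass_subset_support ?_
    rw [eq_treePath hG ((p.append q.reverse).bypass_isPath), hc]
    simp
  rw [SimpleGraph.Walk.mem_support_append_iff, SimpleGraph.Walk.support_reverse,
    List.mem_reverse] at hmem
  have := h.par_lt v hv (hall v)
  rcases hmem with hm | hm
  · exact absurd (hp v hm) (by omega)
  · exact absurd (hq v hm) (by omega)

/-- A completed run of Prim's algorithm computes the covariances along the tree. -/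
theorem PrimState.eq_treeCov (h : PrimState w A r n vis par C) (hall : ∀ v, vis v ≠ 0)
    (hA : ∀ i, 0 < A i i) (hs : ∀ i j, A i j = A j i) (hG : (parentGraph r par).IsTree) :
    C = treeCov hG A := by
  -- Strong induction on the later of the two visiting times. Both orders of the pair are needed
  -- because the recursion may lead to a parent visited before u.
  have key : ∀ N, ∀ u v, vis u ≤ vis v → vis v = N → C v u = treeCov hG A v u ∧
      C u v = treeCov hG A v u := by
    intro N
    induction N using Nat.strong_induction_on with
    | _ N ih =>
      rintro u v huv rfl
      rcases huv.eq_or_lt with he | hlt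
      · obtain rfl := h.inj u v he (hall u)
        rw [h.diag u (hall u), treeCov_self hG hA]
        exact ⟨rfl, rfl⟩
      · have hv : v ≠ r := by
          rintro rfl
          have := hall u
          rw [h.root] at hlt
          omega
        obtain ⟨h1, h2⟩ := h.cov v u (hall u) hlt
        have hpl := h.par_lt v hv (hall v)
        have h3 : C (par v) u = treeCov hG A (par v) u := by
          rcases le_total (vis u) (vis (par v)) with hle | hle
          · exact (ih _ hpl u (par v) hle rfl).1
          · rw [(ih _ hlt (par v) u hle rfl).2, treeCov_symm hG hs]
        rw [h2, h1, h3, treeCov_cons hG hA (h.adj_par hall hv) (h.treePath_eq hall hG hlt hv)]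
        exact ⟨rfl, rfl⟩
  ext i j
  rcases le_total (vis i) (vis j) with hle | hle
  · rw [(key _ i j hle rfl).2, treeCov_symm hG hs]
  · exact (key _ j i hle rfl).1

end Prim

/-! ### Prim's algorithm as a program. -/

section PrimProgram

theorem Frame.setIReg {N A : Set ℕ} {s s' : Mem} (h : Frame N A s s') {x : ℕ} (hx : x ∈ N)
    (v : ℕ) : Frame N A s (s'.setIReg x v) := by
  refine ⟨fun y hy => ?_, h.rarr⟩
  rw [← h.nreg y hy]
  refine Function.update_of_ne ?_ _ _
  rintro rfl
  exact hy hx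

theorem Frame.setIArr {N A : Set ℕ} {s s' : Mem} (h : Frame N A s s') (a i v : ℕ) :
    Frame N A s (s'.setIArr a i v) := ⟨h.nreg, h.rarr⟩

theorem Frame.setRArr {N A : Set ℕ} {s s' : Mem} (h : Frame N A s s') {a : ℕ} (ha : a ∈ A)
    (i j : ℕ) (v : ℝ) : Frame N A s (s'.setRArr a i j v) := by
  refine ⟨h.nreg, fun b hb => ?_⟩
  rw [← h.rarr b hb]
  have : b ≠ a := fun he => hb (he ▸ ha)
  ext i' j'
  simp [Mem.setRArr, this]

theorem setIReg_self (s : Mem) (x v : ℕ) : (s.setIReg x v).nreg x = v := by simp [Mem.setIReg]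

theorem setIReg_of_ne (s : Mem) {x y : ℕ} (h : y ≠ x) (v : ℕ) :
    (s.setIReg x v).nreg y = s.nreg y := by simp [Mem.setIReg, h]

/-- Register 6 receives the node not yet visited whose best weight is largest. -/
def primSelect : Prog :=
  .seq (.setIReg 6 (.reg 1)) (forLoop 2 1 (.ite
    (.and (.ilt (.arr 0 (.reg 2)) (.const 1)) (.not (.and (.ilt (.reg 6) (.reg 1))
      (.not (.rlt (.arr 15 (.reg 6) (.arr 1 (.reg 6))) (.arr 15 (.reg 2) (.arr 1 (.reg 2))))))))
    (.setIReg 6 (.reg 2)) .skip))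

/-- The value m in register 6 marks that no candidate has been found yet; the test accepts the first
unvisited node and afterwards only strictly better ones. -/
theorem runs_primSelect (s : Mem) {m : ℕ} (h1 : s.nreg 1 = m)
    (hex : ∃ v < m, s.narr 0 v = 0) :
    ∃ s', Runs primSelect s (40 * (m + 1)) s' ∧ Frame {2, 6} ∅ s s' ∧ s'.narr = s.narr ∧
      s'.nreg 6 < m ∧ s.narr 0 (s'.nreg 6) = 0 ∧ ∀ v < m, s.narr 0 v = 0 →
        s.rarr 15 v (s.narr 1 v) ≤ s.rarr 15 (s'.nreg 6) (s.narr 1 (s'.nreg 6)) := by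
  obtain ⟨s', hr, ⟨hF, hn, hI⟩, -⟩ := runs_forLoop (x := 2) (b := 1) (N := m) (B := 25)
    (p := .ite
      (.and (.ilt (.arr 0 (.reg 2)) (.const 1)) (.not (.and (.ilt (.reg 6) (.reg 1))
        (.not (.rlt (.arr 15 (.reg 6) (.arr 1 (.reg 6)))
          (.arr 15 (.reg 2) (.arr 1 (.reg 2))))))))
      (.setIReg 6 (.reg 2)) .skip) (s := s.setIReg 6 m)
    (fun i s' => Frame {2, 6} ∅ s s' ∧ s'.narr = s.narr ∧
      ((s'.nreg 6 = m ∧ ∀ v < i, s.narr 0 v ≠ 0) ∨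
        (s'.nreg 6 < m ∧ s.narr 0 (s'.nreg 6) = 0 ∧ ∀ v < i, s.narr 0 v = 0 →
          s.rarr 15 v (s.narr 1 v) ≤ s.rarr 15 (s'.nreg 6) (s.narr 1 (s'.nreg 6)))))
    (by
      refine ⟨((Frame.refl _ _ s).setIReg (by simp) _).setIReg (by simp) _, rfl, Or.inl ⟨?_, ?_⟩⟩
      · simp [Mem.setIReg]
      · intro v hv
        omega)
    (fun i s' h => (h.1.nreg 1 (by simp)).trans h1)
    (by
      rintro i hi s₁ ⟨hF, hn, hI⟩ h2
      have hF1 : s₁.nreg 1 = m := (hF.nreg 1 (by simp)).trans h1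
      have hF15 : s₁.rarr 15 = s.rarr 15 := hF.rarr 15 (by simp)
      by_cases hb : (BExp.and (.ilt (.arr 0 (.reg 2)) (.const 1))
          (.not (.and (.ilt (.reg 6) (.reg 1)) (.not (.rlt (.arr 15 (.reg 6) (.arr 1 (.reg 6)))
            (.arr 15 (.reg 2) (.arr 1 (.reg 2)))))))).holds s₁
      · refine ⟨s₁.setIReg 6 i, ?_, ?_, (hF.setIReg (by simp) _).setIReg (by simp) _, hn,
          Or.inr ?_⟩
        · have := (Exec.iteTrue (q := .skip) hb (Exec.setIReg 6 (.reg 2) s₁)).runs (c' := 25)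
            (by simp [BExp.cost, IExp.cost, RExp.cost])
          simpa [IExp.eval, h2] using this
        · rw [setIReg_of_ne _ (by norm_num), h2]
        · simp only [BExp.holds, IExp.eval, RExp.eval, hn, hF15, h2, hF1, Nat.lt_one_iff, not_and,
            not_not] at hb
          have e6 : ((s₁.setIReg 6 i).setIReg 2 (i + 1)).nreg 6 = i := by
            rw [setIReg_of_ne _ (by norm_num), setIReg_self]
          rw [e6]
          refine ⟨hi, hb.1, fun v hv hv0 => ?_⟩
          rcases Nat.lt_succ_iff_lt_or_eq.1 hv with hv | rfl
          · rcases hI with ⟨-, hI⟩ | ⟨h6, -, hI⟩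
            · exact absurd hv0 (hI v hv)
            · exact (hI v hv hv0).trans (hb.2 h6).le
          · exact le_rfl
      · refine ⟨s₁, (Exec.iteFalse hb (.skip s₁)).runs
          (by simp [BExp.cost, IExp.cost, RExp.cost]), h2, hF.setIReg (by simp) _, hn, ?_⟩
        rw [setIReg_of_ne _ (by norm_num)]
        simp only [BExp.holds, IExp.eval, RExp.eval, hn, hF15, h2, hF1, Nat.lt_one_iff, not_and,
          not_not, not_forall, not_lt] at hb
        rcases hI with ⟨h6, hI⟩ | ⟨h6, h60, hI⟩
        · refine Or.inl ⟨h6, fun v hv hv0 => ?_⟩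
          rcases Nat.lt_succ_iff_lt_or_eq.1 hv with hv | rfl
          · exact hI v hv hv0
          · obtain ⟨h, -⟩ := hb hv0
            omega
        · refine Or.inr ⟨h6, h60, fun v hv hv0 => ?_⟩
          rcases Nat.lt_succ_iff_lt_or_eq.1 hv with hv | rfl
          · exact hI v hv hv0
          · obtain ⟨-, h⟩ := hb hv0
            exact h)
  refine ⟨s', ?_, hF, hn, ?_⟩
  · have := ((Exec.setIReg 6 (.reg 1) s).runs le_rfl).seq
      (by simpa [IExp.eval, h1] using hr : Runs _ (s.setIReg 6 _) _ s')
    refine this.mono ?_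
    simp only [IExp.cost]
    omega
  · rcases hI with ⟨-, hI⟩ | hI
    · obtain ⟨v, hv, hv0⟩ := hex
      exact absurd hv0 (hI v hv)
    · exact hI

/-- The covariances between the new node, in register 6, with parent in register 8, and the visited
nodes. -/
def primRow : Prog :=
  forLoop 2 1 (.ite (.not (.ilt (.arr 0 (.reg 2)) (.const 1)))
    (.seq (.setRArr 16 (.reg 6) (.reg 2) (.mul (.div (.arr 14 (.reg 6) (.reg 8))
        (.arr 14 (.reg 8) (.reg 8))) (.arr 16 (.reg 8) (.reg 2))))
      (.setRArr 16 (.reg 2) (.reg 6) (.arr 16 (.reg 6) (.reg 2)))) .skip)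

/-- Only entries involving the new, still unvisited node are written, while the parent's row is read
only at visited nodes. The values read are therefore the original ones. -/
theorem runs_primRow (s : Mem) {m : ℕ} (h1 : s.nreg 1 = m) (hb : s.narr 0 (s.nreg 6) = 0)
    (hp : s.narr 0 (s.nreg 8) ≠ 0) :
    ∃ s', Runs primRow s (40 * (m + 1)) s' ∧ Frame {2} {16} s s' ∧ s'.narr = s.narr ∧
      (∀ u < m, s.narr 0 u ≠ 0 →
        s'.rarr 16 (s.nreg 6) u = s.rarr 14 (s.nreg 6) (s.nreg 8) /
          s.rarr 14 (s.nreg 8) (s.nreg 8) * s.rarr 16 (s.nreg 8) u ∧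
        s'.rarr 16 u (s.nreg 6) = s'.rarr 16 (s.nreg 6) u) ∧
      ∀ u v, s.narr 0 u ≠ 0 → s.narr 0 v ≠ 0 → s'.rarr 16 u v = s.rarr 16 u v := by
  obtain ⟨s', hr, ⟨hF, hn, hI⟩, -⟩ := runs_forLoop (x := 2) (b := 1) (N := m) (B := 33)
    (p := .ite (.not (.ilt (.arr 0 (.reg 2)) (.const 1)))
      (.seq (.setRArr 16 (.reg 6) (.reg 2) (.mul (.div (.arr 14 (.reg 6) (.reg 8))
          (.arr 14 (.reg 8) (.reg 8))) (.arr 16 (.reg 8) (.reg 2))))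
        (.setRArr 16 (.reg 2) (.reg 6) (.arr 16 (.reg 6) (.reg 2)))) .skip) (s := s)
    (fun i s' => Frame {2} {16} s s' ∧ s'.narr = s.narr ∧
      (∀ u < i, s.narr 0 u ≠ 0 →
        s'.rarr 16 (s.nreg 6) u = s.rarr 14 (s.nreg 6) (s.nreg 8) /
          s.rarr 14 (s.nreg 8) (s.nreg 8) * s.rarr 16 (s.nreg 8) u ∧
        s'.rarr 16 u (s.nreg 6) = s'.rarr 16 (s.nreg 6) u) ∧
      ∀ u v, s.narr 0 u ≠ 0 → s.narr 0 v ≠ 0 → s'.rarr 16 u v = s.rarr 16 u v)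
    ⟨(Frame.refl _ _ s).setIReg (by simp) _, rfl, fun u hu => absurd hu (Nat.not_lt_zero u),
      fun _ _ _ _ => rfl⟩
    (fun i s' h => (h.1.nreg 1 (by simp)).trans h1)
    (by
      rintro i hi s₁ ⟨hF, hn, hI, hK⟩ h2
      have e6 : s₁.nreg 6 = s.nreg 6 := hF.nreg 6 (by simp)
      have e8 : s₁.nreg 8 = s.nreg 8 := hF.nreg 8 (by simp)
      have e14 : s₁.rarr 14 = s.rarr 14 := hF.rarr 14 (by simp)
      have hcond : (BExp.not (.ilt (.arr 0 (.reg 2)) (.const 1))).holds s₁ ↔ s.narr 0 i ≠ 0 := by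
        simp [BExp.holds, IExp.eval, hn, h2]
      by_cases hv : s.narr 0 i ≠ 0
      · have hib : i ≠ s.nreg 6 := fun h => hv (h ▸ hb)
        have hib' : s.nreg 6 ≠ i := hib.symm
        refine ⟨_, (Exec.iteTrue (hcond.2 hv) (Exec.seq (Exec.setRArr 16 _ _ _ s₁)
          (Exec.setRArr 16 _ _ _ _))).runs (by simp [BExp.cost, IExp.cost, RExp.cost]), h2,
          ((hF.setRArr rfl _ _ _).setRArr rfl _ _ _).setIReg rfl _, hn, fun u hu hu0 => ?_,
          fun u v hu hv' => ?_⟩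
        · have hub : u ≠ s.nreg 6 := fun h => hu0 (h ▸ hb)
          have hub' := hub.symm
          rcases Nat.lt_succ_iff_lt_or_eq.1 hu with hu | rfl
          · simpa [Mem.setRArr, Mem.setIReg, IExp.eval, RExp.eval, e6, h2, hib, hub', hub, hu.ne,
              hib'] using hI u hu hu0
          · simp [Mem.setRArr, Mem.setIReg, IExp.eval, RExp.eval, e6, h2, e8, e14, hib, hib',
              hK _ _ hp hu0]
        · have hub : u ≠ s.nreg 6 := fun h => hu (h ▸ hb)
          have hvb : v ≠ s.nreg 6 := fun h => hv' (h ▸ hb)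
          simpa [Mem.setRArr, Mem.setIReg, IExp.eval, RExp.eval, e6, h2, hub, hvb] using
            hK u v hu hv'
      · refine ⟨s₁, (Exec.iteFalse (fun h => hv (hcond.1 h)) (.skip s₁)).runs
          (by simp [BExp.cost, IExp.cost]), h2, hF.setIReg rfl _, hn, fun u hu hu0 => ?_, hK⟩
        rcases Nat.lt_succ_iff_lt_or_eq.1 hu with hu | rfl
        · exact hI u hu hu0
        · exact absurd hu0 hv)
  exact ⟨s', hr.mono (by omega), hF, hn, hI⟩

/-- The nodes not yet visited compare their best neighbour with the new node, in register 6. -/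
def primUpdate : Prog :=
  forLoop 2 1 (.ite (.and (.ilt (.arr 0 (.reg 2)) (.const 1))
    (.rlt (.arr 15 (.reg 2) (.arr 1 (.reg 2))) (.arr 15 (.reg 2) (.reg 6))))
    (.setIArr 1 (.reg 2) (.reg 6)) .skip)

open Classical in
theorem runs_primUpdate (s : Mem) {m : ℕ} (h1 : s.nreg 1 = m) :
    ∃ s', Runs primUpdate s (40 * (m + 1)) s' ∧ Frame {2} ∅ s s' ∧ s'.narr 0 = s.narr 0 ∧
      ∀ v < m, s'.narr 1 v =
        if s.narr 0 v = 0 ∧ s.rarr 15 v (s.narr 1 v) < s.rarr 15 v (s.nreg 6) then s.nreg 6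
        else s.narr 1 v := by
  obtain ⟨s', hr, ⟨hF, hn, hI⟩, -⟩ := runs_forLoop (x := 2) (b := 1) (N := m) (B := 33)
    (p := .ite (.and (.ilt (.arr 0 (.reg 2)) (.const 1))
      (.rlt (.arr 15 (.reg 2) (.arr 1 (.reg 2))) (.arr 15 (.reg 2) (.reg 6))))
      (.setIArr 1 (.reg 2) (.reg 6)) .skip) (s := s)
    (fun i s' => Frame {2} ∅ s s' ∧ s'.narr 0 = s.narr 0 ∧
      (∀ v < i, s'.narr 1 v =
        if s.narr 0 v = 0 ∧ s.rarr 15 v (s.narr 1 v) < s.rarr 15 v (s.nreg 6) then s.nreg 6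
        else s.narr 1 v) ∧ ∀ v, i ≤ v → s'.narr 1 v = s.narr 1 v)
    ⟨(Frame.refl _ _ s).setIReg (by simp) _, rfl, fun u hu => absurd hu (Nat.not_lt_zero u),
      fun _ _ => rfl⟩
    (fun i s' h => (h.1.nreg 1 (by simp)).trans h1)
    (by
      rintro i hi s₁ ⟨hF, hn, hI, hK⟩ h2
      have e6 : s₁.nreg 6 = s.nreg 6 := hF.nreg 6 (by simp)
      have e15 : s₁.rarr 15 = s.rarr 15 := hF.rarr 15 (by simp)
      have hcond : (BExp.and (.ilt (.arr 0 (.reg 2)) (.const 1))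
          (.rlt (.arr 15 (.reg 2) (.arr 1 (.reg 2))) (.arr 15 (.reg 2) (.reg 6)))).holds s₁ ↔
          s.narr 0 i = 0 ∧ s.rarr 15 i (s.narr 1 i) < s.rarr 15 i (s.nreg 6) := by
        simp [BExp.holds, IExp.eval, RExp.eval, hn, h2, e6, e15, hK i le_rfl]
      by_cases hv : s.narr 0 i = 0 ∧ s.rarr 15 i (s.narr 1 i) < s.rarr 15 i (s.nreg 6)
      · refine ⟨_, (Exec.iteTrue (hcond.2 hv) (Exec.setIArr 1 _ _ s₁)).runs
          (by simp [BExp.cost, IExp.cost, RExp.cost]), h2, (hF.setIArr _ _ _).setIReg rfl _, ?_,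
          fun u hu => ?_, fun v hv' => ?_⟩
        · ext v
          simp [Mem.setIArr, Mem.setIReg, hn]
        · rcases Nat.lt_succ_iff_lt_or_eq.1 hu with hu | rfl
          · rw [← hI u hu]
            simp [Mem.setIArr, Mem.setIReg, IExp.eval, h2, hu.ne]
          · rw [if_pos hv]
            simp [Mem.setIArr, Mem.setIReg, IExp.eval, h2, e6]
        · rw [← hK v (by omega)]
          have : v ≠ i := by omega
          simp [Mem.setIArr, Mem.setIReg, IExp.eval, h2, this]
      · refine ⟨s₁, (Exec.iteFalse (fun h => hv (hcond.1 h)) (.skip s₁)).runs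
          (by simp [BExp.cost, IExp.cost, RExp.cost]), h2, hF.setIReg rfl _, hn, fun u hu => ?_,
          fun v hv' => hK v (by omega)⟩
        rcases Nat.lt_succ_iff_lt_or_eq.1 hu with hu | rfl
        · exact hI u hu
        · rw [if_neg hv]
          exact hK u le_rfl)
  exact ⟨s', hr.mono (by omega), hF, hn, hI.1⟩

variable {m : ℕ} {r : Fin m} {n : ℕ} {w W : Fin m → Fin m → ℝ} {A : Matrix (Fin m) (Fin m) ℝ}

/-- The memory holds a state of Prim's algorithm. -/
def HoldsPrim (s : Mem) (w : Fin m → Fin m → ℝ) (A : Matrix (Fin m) (Fin m) ℝ) (r : Fin m)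
    (n : ℕ) : Prop :=
  ∃ vis par C, PrimState w A r n vis par C ∧ (∀ v : Fin m, s.narr 0 v = vis v) ∧
    (∀ v : Fin m, s.narr 1 v = par v) ∧ s.Stores 16 C

/-- One step of Prim's algorithm; register 5 counts the previous steps. -/
def primStep : Prog :=
  .seq primSelect (.seq (.setIReg 8 (.arr 1 (.reg 6))) (.seq primRow
    (.seq (.setRArr 16 (.reg 6) (.reg 6) (.arr 14 (.reg 6) (.reg 6)))
      (.seq (.setIArr 0 (.reg 6) (.add (.reg 5) (.const 2))) primUpdate))))

-- The algorithm only compares weights, so the stored weights `W` need only induce the same order as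
-- `w`. This permits storing ρ² in place of |ρ|.
open Classical in
theorem runs_primStep (s : Mem) (h1 : s.nreg 1 = m) (hA : s.Stores 14 A)
    (hW : s.Stores 15 (Matrix.of W)) (hw : ∀ i j, w i j = w j i)
    (hWw : ∀ i j i' j', W i j ≤ W i' j' ↔ w i j ≤ w i' j')
    (hP : HoldsPrim s w A r n) (hn : n < m) (h5 : s.nreg 5 + 1 = n) :
    ∃ s', Runs primStep s (140 * (m + 1)) s' ∧ Frame {2, 6, 8} {16} s s' ∧
      HoldsPrim s' w A r (n + 1) := by
  obtain ⟨vis, par, C, hP, hvis, hpar, hC⟩ := hP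
  obtain ⟨v₀, hv₀⟩ := hP.exists_unvisited (by simpa using hn)
  obtain ⟨s₁, hr₁, hF₁, hn₁, hbm, hb0, hbest⟩ := runs_primSelect s h1
    ⟨v₀, v₀.2, (hvis v₀).trans hv₀⟩
  obtain ⟨b, hb⟩ : ∃ b : Fin m, s₁.nreg 6 = b := ⟨⟨_, hbm⟩, rfl⟩
  rw [hb] at hb0 hbest
  have hvb : vis b = 0 := (hvis b).symm.trans hb0
  have hbr : b ≠ r := by
    rintro rfl
    rw [hP.root] at hvb
    exact one_ne_zero hvb
  set s₂ := s₁.setIReg 8 (par b) with hs₂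
  have hr₂ : Runs (.setIReg 8 (.arr 1 (.reg 6))) s₁ 3 s₂ := by
    have := (Exec.setIReg 8 (.arr 1 (.reg 6)) s₁).runs (c' := 3) (by simp [IExp.cost])
    simpa only [IExp.eval, hb, hn₁, hpar b] using this
  have hF₂ : Frame {2, 6, 8} {16} s s₂ :=
    (hF₁.mono (by intro x; simp; tauto) (by simp)).setIReg (by simp) _
  have e6 : s₂.nreg 6 = b := by rw [hs₂, setIReg_of_ne _ (by norm_num), hb]
  have e8 : s₂.nreg 8 = par b := by rw [hs₂, setIReg_self]
  have en : s₂.narr = s.narr := hn₁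
  have er : ∀ a, s₂.rarr a = s.rarr a := fun a => hF₁.rarr a (by simp)
  obtain ⟨s₃, hr₃, hF₃, hn₃, hrow, hold⟩ := runs_primRow (m := m) s₂
    ((hF₂.nreg 1 (by simp)).trans h1) (by rw [e6, en, hb0])
    (by rw [e8, en, hvis]; exact hP.par_visited b hbr)
  simp only [e6, e8, er, en] at hrow hold
  set s₄ := s₃.setRArr 16 b b (A b b) with hs₄
  have e63 : s₃.nreg 6 = b := by rw [hF₃.nreg 6 (by simp), e6]
  have hr₄ : Runs (.setRArr 16 (.reg 6) (.reg 6) (.arr 14 (.reg 6) (.reg 6))) s₃ 6 s₄ := by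
    have := (Exec.setRArr 16 (.reg 6) (.reg 6) (.arr 14 (.reg 6) (.reg 6)) s₃).runs (c' := 6)
      (by simp [IExp.cost, RExp.cost])
    have h14 : s₃.rarr 14 b b = A b b := by rw [hF₃.rarr 14 (by simp), er, hA b b]
    simpa only [IExp.eval, RExp.eval, e63, h14] using this
  -- The root has time 1 and register 5 counts from 0, hence the added 2. The time is recorded
  -- before the update so that b no longer counts as unvisited there.
  set s₅ := s₄.setIArr 0 b (n + 1) with hs₅
  have e54 : s₄.nreg 5 = s.nreg 5 := by
    have : s₄.nreg 5 = s₃.nreg 5 := rfl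
    rw [this, hF₃.nreg 5 (by simp), hF₂.nreg 5 (by simp)]
  have e64 : s₄.nreg 6 = b := e63
  have hr₅ : Runs (.setIArr 0 (.reg 6) (.add (.reg 5) (.const 2))) s₄ 5 s₅ := by
    have := (Exec.setIArr 0 (.reg 6) (.add (.reg 5) (.const 2)) s₄).runs (c' := 5)
      (by simp [IExp.cost])
    have e : s.nreg 5 + 2 = n + 1 := by omega
    simpa only [IExp.eval, e54, e64, e] using this
  have hF₅ : Frame {2, 6, 8} {16} s s₅ :=
    ((hF₂.trans (hF₃.mono (by simp) le_rfl)).setRArr rfl _ _ _).setIArr _ _ _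
  obtain ⟨s₆, hr₆, hF₆, hvis₆, hpar₆⟩ := runs_primUpdate (m := m) s₅
    ((hF₅.nreg 1 (by simp)).trans h1)
  have e65 : s₅.nreg 6 = b := e63
  have e15 : s₅.rarr 15 = s.rarr 15 := hF₅.rarr 15 (by simp)
  have e05 : ∀ v : Fin m, s₅.narr 0 v = if v = b then n + 1 else vis v := by
    intro v
    rw [← hvis v, ← en, ← hn₃]
    simp [hs₅, hs₄, Mem.setIArr, Mem.setRArr, Fin.ext_iff]
  have e15' : s₅.narr 1 = s.narr 1 := by
    rw [← en, ← hn₃]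
    ext v
    simp [hs₅, hs₄, Mem.setIArr, Mem.setRArr]
  have hWlt : ∀ v, W v (par v) < W v b ↔ w v (par v) < w v b := fun v => by
    rw [← not_le, hWw, not_le]
  have e16 : ∀ u v : Fin m, ¬ (u = b ∧ v = b) → s₆.rarr 16 u v = s₃.rarr 16 u v := by
    intro u v huv
    rw [hF₆.rarr 16 (by simp)]
    simp only [Fin.ext_iff] at huv
    simp [hs₅, hs₄, Mem.setIArr, Mem.setRArr, huv]
  refine ⟨s₆, (hr₁.seq (hr₂.seq (hr₃.seq (hr₄.seq (hr₅.seq hr₆))))).mono (by omega),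
    hF₅.trans (hF₆.mono (by simp) (by simp)), fun v => if v = b then n + 1 else vis v,
    fun v => if (if v = b then n + 1 else vis v) = 0 ∧ w v (par v) < w v b then b else par v,
    fun u v => s₆.rarr 16 u v, ?_, fun v => by rw [hvis₆, e05], fun v => ?_, fun u v => rfl⟩
  · refine hP.step hw hvb (fun v hv => ?_) (fun v => by split_ifs <;> rfl)
      (fun v => by split_ifs <;> rfl) ?_ (fun u hu => ?_)
      (fun u v hu hv => ?_)
    · have := hbest v v.2 ((hvis v).trans hv)
      rw [hpar, hpar, hW v (par v), hW b (par b)] at this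
      exact (hWw _ _ _ _).1 this
    · rw [hF₆.rarr 16 (by simp)]
      simp [hs₅, hs₄, Mem.setIArr, Mem.setRArr]
    · have hub : u ≠ b := by
        rintro rfl
        exact hu hvb
      rw [e16 _ _ (by tauto), e16 _ _ (by tauto)]
      have := hrow u u.2 (by rwa [hvis])
      rwa [hA b (par b), hA (par b) (par b), hC (par b) u] at this
    · have hub : u ≠ b := by
        rintro rfl
        exact hu hvb
      rw [e16 _ _ (by tauto), hold u v (by rwa [hvis]) (by rwa [hvis]), hC u v]
  · rw [hpar₆ v v.2, e05, e15', hpar, e65, e15, hW v (par v), hW v b]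
    simp only [Matrix.of_apply, hWlt]
    split_ifs <;> rfl

/-- Prim's algorithm for matrix 14, with weights in matrix 15. Matrix 16 receives the covariances
along the tree, and index array 1 the parents; the root has parent `m`. -/
def prim : Prog :=
  .seq (forLoop 2 1 (.seq (.setIArr 0 (.reg 2) (.const 0)) (.setIArr 1 (.reg 2) (.const 0))))
    (.seq (.setIArr 0 (.const 0) (.const 1))
      (.seq (.setRArr 16 (.const 0) (.const 0) (.arr 14 (.const 0) (.const 0)))
        (.seq (.setIReg 13 (.sub (.reg 1) (.const 1)))
          (.seq (forLoop 5 13 primStep) (.setIArr 1 (.const 0) (.reg 1))))))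

theorem runs_primInit (s : Mem) (h1 : s.nreg 1 = m) :
    ∃ s', Runs (forLoop 2 1 (.seq (.setIArr 0 (.reg 2) (.const 0))
        (.setIArr 1 (.reg 2) (.const 0)))) s (20 * (m + 1)) s' ∧ Frame {2} ∅ s s' ∧
      ∀ v < m, s'.narr 0 v = 0 ∧ s'.narr 1 v = 0 := by
  obtain ⟨s', hr, ⟨hF, hI⟩, -⟩ := runs_forLoop (x := 2) (b := 1) (N := m) (B := 6)
    (p := .seq (.setIArr 0 (.reg 2) (.const 0)) (.setIArr 1 (.reg 2) (.const 0))) (s := s)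
    (fun i s' => Frame {2} ∅ s s' ∧ ∀ v < i, s'.narr 0 v = 0 ∧ s'.narr 1 v = 0)
    ⟨(Frame.refl _ _ s).setIReg (by simp) _, fun u hu => absurd hu (Nat.not_lt_zero u)⟩
    (fun i s' h => (h.1.nreg 1 (by simp)).trans h1)
    (by
      rintro i hi s₁ ⟨hF, hI⟩ h2
      refine ⟨_, (Exec.seq (Exec.setIArr 0 _ _ s₁) (Exec.setIArr 1 _ _ _)).runs
        (by simp [IExp.cost]), h2, ((hF.setIArr _ _ _).setIArr _ _ _).setIReg rfl _,
        fun u hu => ?_⟩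
      rcases Nat.lt_succ_iff_lt_or_eq.1 hu with hu | rfl
      · simpa [Mem.setIArr, Mem.setIReg, IExp.eval, h2, hu.ne] using hI u hu
      · simp [Mem.setIArr, Mem.setIReg, IExp.eval, h2])
  exact ⟨s', hr.mono (by omega), hF, hI⟩

theorem runs_prim (s : Mem) (hm : 0 < m) (h1 : s.nreg 1 = m) (hA : s.Stores 14 A)
    (hW : s.Stores 15 (Matrix.of W)) (hw : ∀ i j, w i j = w j i)
    (hWw : ∀ i j i' j', W i j ≤ W i' j' ↔ w i j ≤ w i' j') :
    ∃ s', Runs prim s (200 * ((m + 1) * (m + 1))) s' ∧ Frame {2, 5, 6, 8, 13} {16} s s' ∧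
      ∃ vis par C, PrimState w A ⟨0, hm⟩ m vis par C ∧ s'.Stores 16 C ∧
        ∀ v : Fin m, s'.narr 1 v = if v = ⟨0, hm⟩ then m else par v := by
  obtain ⟨s₁, hr₁, hF₁, h0⟩ := runs_primInit s h1
  set s₂ := s₁.setIArr 0 0 1 with hs₂
  have hr₂ : Runs (.setIArr 0 (.const 0) (.const 1)) s₁ 3 s₂ :=
    (Exec.setIArr 0 (.const 0) (.const 1) s₁).runs (by simp [IExp.cost])
  set s₃ := s₂.setRArr 16 0 0 (s₂.rarr 14 0 0) with hs₃
  have hr₃ : Runs (.setRArr 16 (.const 0) (.const 0) (.arr 14 (.const 0) (.const 0))) s₂ 6 s₃ :=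
    (Exec.setRArr 16 (.const 0) (.const 0) (.arr 14 (.const 0) (.const 0)) s₂).runs
      (by simp [IExp.cost, RExp.cost])
  set s₄ := s₃.setIReg 13 (m - 1) with hs₄
  have hF₃ : Frame {2, 5, 6, 8, 13} {16} s s₃ :=
    ((hF₁.mono (N' := {2, 5, 6, 8, 13}) (A' := {16}) (by simp) (by simp)).setIArr _ _ _).setRArr
      rfl _ _ _
  have hr₄ : Runs (.setIReg 13 (.sub (.reg 1) (.const 1))) s₃ 4 s₄ := by
    have := (Exec.setIReg 13 (.sub (.reg 1) (.const 1)) s₃).runs (c' := 4) (by simp [IExp.cost])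
    have e : s₃.nreg 1 = m := (hF₃.nreg 1 (by simp)).trans h1
    simpa only [IExp.eval, e] using this
  have hF₄ : Frame {2, 5, 6, 8, 13} {16} s s₄ := hF₃.setIReg (by simp) _
  have hinit : HoldsPrim s₄ w A ⟨0, hm⟩ 1 := by
    refine ⟨fun v => s₄.narr 0 v, fun v => ⟨0, hm⟩, fun i j => s₄.rarr 16 i j,
      PrimState.init w A _ ?_ (fun v => ?_) fun _ => rfl, fun _ => rfl, fun v => ?_, fun _ _ => rfl⟩
    · have : s₂.rarr 14 0 0 = A ⟨0, hm⟩ ⟨0, hm⟩ :=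
        (congrFun (congrFun (hF₁.rarr 14 (by simp)) 0) 0).trans (hA ⟨0, hm⟩ ⟨0, hm⟩)
      simp [hs₄, hs₃, Mem.setIReg, Mem.setRArr, this]
    · have := (h0 v v.2).1
      simp [hs₄, hs₃, hs₂, Mem.setIReg, Mem.setRArr, Mem.setIArr, Fin.ext_iff, this]
    · have := (h0 v v.2).2
      simp [hs₄, hs₃, hs₂, Mem.setIReg, Mem.setRArr, Mem.setIArr, this]
  obtain ⟨s₅, hr₅, ⟨hF₅, hP⟩, -⟩ := runs_forLoop (x := 5) (b := 13) (N := m - 1)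
    (B := 140 * (m + 1)) (p := primStep) (s := s₄)
    (fun i s' => Frame {2, 5, 6, 8} {16} s₄ s' ∧ HoldsPrim s' w A ⟨0, hm⟩ (i + 1))
    ⟨(Frame.refl _ _ s₄).setIReg (by simp) _, hinit⟩
    (fun i s' h => by rw [h.1.nreg 13 (by simp), hs₄, setIReg_self])
    (by
      rintro i hi s₁ ⟨hF, hP⟩ h5
      have hF' : Frame {2, 5, 6, 8, 13} {16} s s₁ :=
        hF₄.trans (hF.mono (by intro x; simp; tauto) le_rfl)
      obtain ⟨s₂, hr, hF₂, hP₂⟩ := runs_primStep s₁ ((hF'.nreg 1 (by simp)).trans h1)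
        (hF'.stores (by simp) hA) (hF'.stores (by simp) hW) hw hWw hP (by omega) (by omega)
      exact ⟨s₂, hr, (hF₂.nreg 5 (by simp)).trans h5,
        (hF.trans (hF₂.mono (by intro x; simp; tauto) le_rfl)).setIReg (by simp) _, hP₂⟩)
  have hm1 : m - 1 + 1 = m := by omega
  rw [hm1] at hP hr₅
  obtain ⟨vis, par, C, hP, -, hpar, hC⟩ := hP
  have hF₅' : Frame {2, 5, 6, 8, 13} {16} s s₅ :=
    hF₄.trans (hF₅.mono (by intro x; simp; tauto) le_rfl)
  have hr₆ : Runs (.setIArr 1 (.const 0) (.reg 1)) s₅ 3 (s₅.setIArr 1 0 m) := by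
    have := (Exec.setIArr 1 (.const 0) (.reg 1) s₅).runs (c' := 3) (by simp [IExp.cost])
    have e : s₅.nreg 1 = m := (hF₅'.nreg 1 (by simp)).trans h1
    simpa only [IExp.eval, e] using this
  refine ⟨_, (hr₁.seq (hr₂.seq (hr₃.seq (hr₄.seq (hr₅.seq hr₆))))).mono (by nlinarith),
    hF₅'.setIArr _ _ _, vis, par, C, hP, hC, fun v => ?_⟩
  rw [← hpar v]
  simp [Mem.setIArr, Fin.ext_iff]

theorem PrimState.visited {V : Type} [Fintype V] {r : V} {vis : V → ℕ} {par : V → V}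
    {w : V → V → ℝ} {A C : Matrix V V ℝ} (h : PrimState w A r (Fintype.card V) vis par C) (v : V) :
    vis v ≠ 0 := by
  have h1 : (Finset.univ.filter fun v => vis v ≠ 0) = Finset.univ :=
    (Finset.card_eq_iff_eq_univ _).1 h.card
  have h2 := Finset.mem_univ v
  rw [← h1] at h2
  exact (Finset.mem_filter.1 h2).2

/-- Prim's algorithm carries out the Chow-Liu algorithm. -/
theorem PrimState.isChowLiu {V : Type} [Fintype V] {r : V} {vis : V → ℕ}
    {par : V → V} {A C : Matrix V V ℝ} (hA : A.PosDef)
    (h : PrimState (fun i j => |corr A i j|) A r (Fintype.card V) vis par C) :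
    IsChowLiu A (parentGraph r par) C := by
  have hG := h.isMaxTree h.visited
  exact (isChowLiu_iff hG.1 fun _ => hA.diag_pos).2
    ⟨isMaxSpanningTree_iff.2 hG, h.eq_treeCov h.visited (fun _ => hA.diag_pos) (symm_of_posDef hA) _⟩

end PrimProgram

/-! ### One iteration of the latent algorithm and its cost. -/

section Iteration

variable {k m : ℕ}

/-- This form uses only the inverse of the F-block and products already computed, so the latent
block of an inverse costs no inversion of a T-block. It serves in both projections. -/
theorem inv_toBlocks₁₁ {F T : Type} [Fintype F] [Fintype T] [DecidableEq F] [DecidableEq T]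
    {S : Matrix (F ⊕ T) (F ⊕ T) ℝ} (hS : S.PosDef) :
    S⁻¹.toBlocks₁₁ =
      S.toBlocks₁₁⁻¹ - (S.toBlocks₂₁ * S.toBlocks₁₁⁻¹)ᵀ * S⁻¹.toBlocks₂₁ := by
  have h1 : S * S⁻¹ = 1 := Matrix.mul_nonsing_inv _ hS.det_pos.ne'.isUnit
  rw [← fromBlocks_toBlocks S, ← fromBlocks_toBlocks (fromBlocks _ _ _ _)⁻¹, fromBlocks_multiply,
    ← fromBlocks_one, fromBlocks_inj] at h1
  rw [fromBlocks_toBlocks] at h1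
  have hu := (posDef_toBlocks₁₁ hS).det_pos.ne'.isUnit
  have h2 : S.toBlocks₁₁⁻¹ * (S.toBlocks₁₁ * S⁻¹.toBlocks₁₁ + S.toBlocks₁₂ * S⁻¹.toBlocks₂₁) =
      S.toBlocks₁₁⁻¹ := by rw [h1.1, Matrix.mul_one]
  rw [Matrix.mul_add, ← Matrix.mul_assoc, Matrix.nonsing_inv_mul _ hu, Matrix.one_mul] at h2
  rw [eq_sub_iff_add_eq, Matrix.transpose_mul, transpose_toBlocks₂₁ hS,
    Matrix.transpose_nonsing_inv, transpose_of_posDef (posDef_toBlocks₁₁ hS), Matrix.mul_assoc, h2]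

/-- The index registers that the parts of an iteration use as working space. -/
def workRegs : Set ℕ := {2, 3, 4, 5, 6, 8, 13}

/-- The parts of the memory that stay fixed during an iteration: sizes and constants. -/
structure Constants (s : Mem) (k m : ℕ) : Prop where
  size_F : s.nreg 0 = k
  size_T : s.nreg 1 = m
  zero : s.nreg 10 = 0
  one : s.nreg 11 = 1
  delta : HasDelta s (k + m)

theorem Constants.frame {s s' : Mem} {A : Set ℕ} (h : Constants s k m) (hF : Frame workRegs A s s')
    (h7 : 7 ∉ A) : Constants s' k m :=
  ⟨(hF.nreg 0 (by simp [workRegs])).trans h.size_F, (hF.nreg 1 (by simp [workRegs])).trans h.size_T,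
    (hF.nreg 10 (by simp [workRegs])).trans h.zero, (hF.nreg 11 (by simp [workRegs])).trans h.one,
    h.delta.frame hF h7⟩

theorem Mem.Stores.eq {s : Mem} {a R Q : ℕ} {M : Matrix (Fin R) (Fin Q) ℝ} (h : s.Stores a M)
    (i : Fin R) (j : Fin Q) : s.rarr a i j = M i j := h i j

theorem runs_fill (s : Mem) {a r q l : ℕ} {e f : RExp} {R Q L D : ℕ}
    (hr : r ∉ ({2, 3, 4} : Set ℕ)) (hq : q ∉ ({2, 3, 4} : Set ℕ)) (hl : l ∉ ({2, 3, 4} : Set ℕ))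
    (he : ¬ e.usesReg 0) (hea : ¬ e.usesArr a) (hfa : ¬ f.usesArr a)
    (hR : s.nreg r = R) (hQ : s.nreg q = Q) (hL : s.nreg l = L)
    (hD : (R + 1) * (Q + 1) * (L + 1) ≤ D) (M : Matrix (Fin R) (Fin Q) ℝ)
    (hM : ∀ (i : Fin R) (j : Fin Q), f.eval ((s.loopAt i j L).setRReg 0 (∑ t : Fin L, e.eval (s.loopAt i j t))) =
      M i j) :
    ∃ s', Runs (fillSum a r q l e f) s (fillSumCost e f * D) s' ∧ Frame workRegs {a} s s' ∧
      s'.narr = s.narr ∧ s'.Stores a M := by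
  obtain ⟨s', h1, h2, h3, -, h4⟩ := runs_fillSum s a r q l e f hr hq hl he hea hfa
  refine ⟨s', h1.mono ?_, h2.mono (by intro x; simp [workRegs]; tauto) le_rfl, h3, fun i j => ?_⟩
  · rw [hR, hQ, hL]
    exact Nat.mul_le_mul le_rfl hD
  · rw [h4 i (hR ▸ i.2) j (hQ ▸ j.2), ← hM i j, fillSumVal, hL, Finset.sum_range]

/-- The bound for the volume of the loops in an iteration. -/
def volume (k m : ℕ) : ℕ := (k + m + 1) * (k + m + 1) * (k + 1)

/-- The letters name the ranges of the three loops. At most two of them run over T, which is why no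
cubic term in m arises. -/
theorem volume_TFF : (m + 1) * (k + 1) * (k + 1) ≤ volume k m := by
  unfold volume
  gcongr <;> omega

theorem volume_FFT : (k + 1) * (k + 1) * (m + 1) ≤ volume k m :=
  le_trans (by ring_nf; rfl) volume_TFF

theorem volume_TFT : (m + 1) * (k + 1) * (m + 1) ≤ volume k m := by
  calc (m + 1) * (k + 1) * (m + 1) = (m + 1) * (m + 1) * (k + 1) := by ring
    _ ≤ volume k m := by
      unfold volume
      gcongr <;> omega

theorem volume_TTF : (m + 1) * (m + 1) * (k + 1) ≤ volume k m := by
  unfold volume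
  gcongr <;> omega

theorem volume_FFF : (k + 1) * (k + 1) * (k + 1) ≤ volume k m := by
  unfold volume
  gcongr <;> omega

theorem volume_TT : (m + 1) * (m + 1) ≤ volume k m := by
  refine le_trans ?_ volume_TTF
  exact Nat.le_mul_of_pos_right _ (Nat.succ_pos k)

/-- Set up the constants. -/
def setup : Prog :=
  .seq (.setIReg 10 (.const 0)) (.seq (.setIReg 11 (.const 1))
    (.seq (.setIReg 12 (.add (.add (.reg 0) (.reg 1)) (.const 1)))
      (.seq (fillSum 7 11 12 10 (.const 0) (.const 0))
        (.setRArr 7 (.const 0) (.const 0) (.const 1)))))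

theorem runs_setup (s : Mem) (h0 : s.nreg 0 = k) (h1 : s.nreg 1 = m) :
    ∃ s', Runs setup s (200 * volume k m) s' ∧ Constants s' k m ∧
      ∀ a, a ≠ 7 → s'.rarr a = s.rarr a := by
  set s₁ := ((s.setIReg 10 0).setIReg 11 1).setIReg 12 (k + m + 1) with hs₁
  have hr₃ : Runs (.setIReg 12 (.add (.add (.reg 0) (.reg 1)) (.const 1)))
      ((s.setIReg 10 0).setIReg 11 1) 6 s₁ := by
    have := (Exec.setIReg 12 (.add (.add (.reg 0) (.reg 1)) (.const 1))
      ((s.setIReg 10 0).setIReg 11 1)).runs (c' := 6) (by simp [IExp.cost])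
    simpa [IExp.eval, Mem.setIReg, hs₁, h0, h1] using this
  have hv : (1 + 1) * (k + m + 1 + 1) * (0 + 1) ≤ 4 * volume k m := by
    have : (k + m + 1) * 1 * 1 ≤ volume k m := by
      unfold volume
      gcongr <;> omega
    omega
  obtain ⟨s₂, hr, hF, -, hS⟩ := runs_fill s₁ (a := 7) (r := 11) (q := 12) (l := 10)
    (e := .const 0) (f := .const 0) (by simp) (by simp) (by simp) (by simp [RExp.usesReg])
    (by simp [RExp.usesArr]) (by simp [RExp.usesArr]) (R := 1) (Q := k + m + 1) (L := 0)
    (by simp [hs₁, Mem.setIReg]) (by simp [hs₁, Mem.setIReg]) (by simp [hs₁, Mem.setIReg]) hv 0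
    (fun i j => by simp [RExp.eval])
  refine ⟨s₂.setRArr 7 0 0 1, ((Exec.setIReg 10 (.const 0) s).runs le_rfl |>.seq
    ((Exec.setIReg 11 (.const 1) _).runs le_rfl |>.seq (hr₃.seq (hr.seq
      ((by simpa [IExp.eval, RExp.eval] using Exec.setRArr 7 (.const 0) (.const 0) (.const 1) s₂ :
        Exec _ s₂ _ (s₂.setRArr 7 0 0 1)).runs le_rfl))))).mono ?_,
    ⟨?_, ?_, ?_, ?_, fun d hd => ?_⟩, fun a ha => ?_⟩
  · simp only [fillSumCost, RExp.cost, IExp.cost]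
    have : 1 * 1 * 1 ≤ volume k m := by
      unfold volume
      gcongr <;> omega
    omega
  · exact (hF.nreg 0 (by simp [workRegs])).trans (by simp [hs₁, Mem.setIReg, h0])
  · exact (hF.nreg 1 (by simp [workRegs])).trans (by simp [hs₁, Mem.setIReg, h1])
  · exact (hF.nreg 10 (by simp [workRegs])).trans (by simp [hs₁, Mem.setIReg])
  · exact (hF.nreg 11 (by simp [workRegs])).trans (by simp [hs₁, Mem.setIReg])
  · have h := hS 0 ⟨d, by omega⟩
    by_cases h0 : d = 0
    · simp [Mem.setRArr, h0]
    · simpa [Mem.setRArr, h0] using h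
  · have : s₂.rarr a = s.rarr a := hF.rarr a ha
    rw [← this]
    ext i j
    simp [Mem.setRArr, ha]

/-- The first projection: matrices 4 and 5 receive the blocks of the covariance matrix. -/
def project : Prog :=
  .seq (invert 1 8) (.seq
    (fillSum 10 1 0 0 (.mul (.arr 2 (.reg 2) (.reg 4)) (.arr 8 (.reg 4) (.reg 3))) (.reg 0)) (.seq
    (fillSum 5 1 0 1 (.mul (.arr 0 (.reg 2) (.reg 4)) (.arr 10 (.reg 4) (.reg 3)))
      (.sub (.const 0) (.reg 0)))
    (fillSum 4 0 0 1 (.mul (.arr 10 (.reg 4) (.reg 2)) (.arr 5 (.reg 4) (.reg 3)))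
      (.sub (.arr 8 (.reg 2) (.reg 3)) (.reg 0)))))

theorem runs_invert_work (s : Mem) {a b : ℕ} (hab : a ≠ b) (hb : b ≠ 9) (hb7 : b ≠ 7)
    (hs : Constants s k m) {M : Matrix (Fin k) (Fin k) ℝ} (hM : M.PosDef) (hsM : s.Stores a M) :
    ∃ s', Runs (invert a b) s (243 * volume k m) s' ∧ Frame workRegs {b, 9} s s' ∧
      s'.Stores b M⁻¹ := by
  obtain ⟨s', h1, h2, h3⟩ := runs_invert s a b hab hb hb7 hs.zero hs.size_F
    (fun d hd => hs.delta d (by omega)) hM hsM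
  exact ⟨s', h1.mono (Nat.mul_le_mul le_rfl volume_FFF),
    h2.mono (by intro x; simp [workRegs]; tauto) le_rfl, h3⟩

/-- The observed block of the first projection is the given empirical covariance, so only the other
two blocks are computed, with J_F the only matrix inverted. -/
theorem runs_project (s : Mem) (hs : Constants s k m) {ST : Matrix (Fin m) (Fin m) ℝ}
    (hST : ST.PosDef) {J : Matrix (Fin k ⊕ Fin m) (Fin k ⊕ Fin m) ℝ} (hJ : J.PosDef)
    (h0 : s.Stores 0 ST) (h1 : s.Stores 1 J.toBlocks₁₁) (h2 : s.Stores 2 J.toBlocks₂₁) :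
    ∃ s', Runs project s (400 * volume k m) s' ∧ Frame workRegs {4, 5, 8, 9, 10} s s' ∧
      s'.Stores 4 (projCov ST J).toBlocks₁₁ ∧ s'.Stores 5 (projCov ST J).toBlocks₂₁ := by
  obtain ⟨s₁, r₁, F₁, h8⟩ := runs_invert_work s (a := 1) (b := 8) (by norm_num) (by norm_num)
    (by norm_num) hs (posDef_toBlocks₁₁ hJ) h1
  have G₁ : Frame workRegs {4, 5, 8, 9, 10} s s₁ := F₁.mono le_rfl (by intro x; simp; tauto)
  have C₁ := hs.frame F₁ (by simp)
  have h2₁ := F₁.stores (by simp) h2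
  obtain ⟨s₂, r₂, F₂, -, h10⟩ := runs_fill s₁ (a := 10) (r := 1) (q := 0) (l := 0)
    (e := .mul (.arr 2 (.reg 2) (.reg 4)) (.arr 8 (.reg 4) (.reg 3))) (f := .reg 0)
    (by simp) (by simp) (by simp) (by simp [RExp.usesReg]) (by simp [RExp.usesArr])
    (by simp [RExp.usesArr]) C₁.size_T C₁.size_F C₁.size_F volume_TFF
    (J.toBlocks₂₁ * J.toBlocks₁₁⁻¹) (fun i j => by
      simp [RExp.eval, IExp.eval, Mem.loopAt, Mem.setIReg, Mem.setRReg, Matrix.mul_apply, h2₁.eq,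
        h8.eq])
  have G₂ : Frame workRegs {4, 5, 8, 9, 10} s s₂ := G₁.trans (F₂.mono le_rfl (by simp))
  have C₂ := C₁.frame F₂ (by simp)
  have h0₂ := G₂.stores (by simp) h0
  obtain ⟨s₃, r₃, F₃, -, h5⟩ := runs_fill s₂ (a := 5) (r := 1) (q := 0) (l := 1)
    (e := .mul (.arr 0 (.reg 2) (.reg 4)) (.arr 10 (.reg 4) (.reg 3)))
    (f := .sub (.const 0) (.reg 0))
    (by simp) (by simp) (by simp) (by simp [RExp.usesReg]) (by simp [RExp.usesArr])
    (by simp [RExp.usesArr]) C₂.size_T C₂.size_F C₂.size_T volume_TFT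
    (projCov ST J).toBlocks₂₁ (fun i j => by
      rw [projCov_toBlocks₂₁ hST hJ, Matrix.neg_apply, Matrix.mul_apply]
      simp [RExp.eval, IExp.eval, Mem.loopAt, Mem.setIReg, Mem.setRReg, h0₂.eq, h10.eq])
  have G₃ : Frame workRegs {4, 5, 8, 9, 10} s s₃ := G₂.trans (F₃.mono le_rfl (by simp))
  have C₃ := C₂.frame F₃ (by simp)
  have h8₃ := F₃.stores (by simp) (F₂.stores (by simp) h8)
  have h10₃ := F₃.stores (by simp) h10
  obtain ⟨s₄, r₄, F₄, -, h4⟩ := runs_fill s₃ (a := 4) (r := 0) (q := 0) (l := 1)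
    (e := .mul (.arr 10 (.reg 4) (.reg 2)) (.arr 5 (.reg 4) (.reg 3)))
    (f := .sub (.arr 8 (.reg 2) (.reg 3)) (.reg 0))
    (by simp) (by simp) (by simp) (by simp [RExp.usesReg]) (by simp [RExp.usesArr])
    (by simp [RExp.usesArr]) C₃.size_F C₃.size_F C₃.size_T volume_FFT
    (projCov ST J).toBlocks₁₁ (fun i j => by
      have h := inv_toBlocks₁₁ (posDef_projInfo hST hJ)
      rw [← projCov] at h
      have e1 : (projInfo ST J).toBlocks₁₁ = J.toBlocks₁₁ := by simp [projInfo]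
      have e2 : (projInfo ST J).toBlocks₂₁ = J.toBlocks₂₁ := by simp [projInfo]
      rw [h, e1, e2, Matrix.sub_apply, Matrix.mul_apply]
      simp [RExp.eval, IExp.eval, Mem.loopAt, Mem.setIReg, Mem.setRReg, h8₃.eq, h10₃.eq, h5.eq])
  refine ⟨s₄, (r₁.seq (r₂.seq (r₃.seq r₄))).mono ?_, G₃.trans (F₄.mono le_rfl (by simp)), h4,
    F₄.stores (by simp) h5⟩
  simp only [fillSumCost, RExp.cost, IExp.cost]
  omega

/-- The Chow-Liu algorithm for the conditional covariance matrix of the observed nodes: matrices 11,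
12 and 14 receive the inverse latent covariance, the regression coefficients and the conditional
covariance, and matrix 6 the new covariance of the observed nodes. -/
def condition : Prog :=
  .seq (invert 4 11) (.seq
    (fillSum 12 1 0 0 (.mul (.arr 5 (.reg 2) (.reg 4)) (.arr 11 (.reg 4) (.reg 3))) (.reg 0)) (.seq
    (fillSum 14 1 1 0 (.mul (.arr 12 (.reg 2) (.reg 4)) (.arr 5 (.reg 3) (.reg 4)))
      (.sub (.arr 0 (.reg 2) (.reg 3)) (.reg 0))) (.seq
    (fillSum 15 1 1 10 (.const 0)
      (.div (.mul (.arr 14 (.reg 2) (.reg 3)) (.arr 14 (.reg 2) (.reg 3)))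
        (.mul (.arr 14 (.reg 2) (.reg 2)) (.arr 14 (.reg 3) (.reg 3))))) (.seq
    prim
    (fillSum 6 1 1 10 (.const 0) (.add (.arr 16 (.reg 2) (.reg 3))
      (.sub (.arr 0 (.reg 2) (.reg 3)) (.arr 14 (.reg 2) (.reg 3)))))))))

theorem runs_condition (s : Mem) (hm : 0 < m) (hs : Constants s k m)
    {S : Matrix (Fin k ⊕ Fin m) (Fin k ⊕ Fin m) ℝ} (hS : S.PosDef)
    (h0 : s.Stores 0 S.toBlocks₂₂) (h4 : s.Stores 4 S.toBlocks₁₁) (h5 : s.Stores 5 S.toBlocks₂₁) :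
    ∃ s', Runs condition s (700 * volume k m) s' ∧
      Frame workRegs {6, 9, 11, 12, 14, 15, 16} s s' ∧ s'.Stores 11 S.toBlocks₁₁⁻¹ ∧
      s'.Stores 12 (S.toBlocks₂₁ * S.toBlocks₁₁⁻¹) ∧
      s'.Stores 14 (S.toBlocks₂₂ - correction S) ∧
      ∃ vis par C, PrimState (fun i j => |corr (S.toBlocks₂₂ - correction S) i j|)
        (S.toBlocks₂₂ - correction S) ⟨0, hm⟩ m vis par C ∧ s'.Stores 6 (C + correction S) ∧
        ∀ v : Fin m, s'.narr 1 v = if v = ⟨0, hm⟩ then m else par v := by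
  set A := S.toBlocks₂₂ - correction S with hA
  have hAp : A.PosDef := posDef_schur hS
  obtain ⟨s₁, r₁, F₁, h11⟩ := runs_invert_work s (a := 4) (b := 11) (by norm_num) (by norm_num)
    (by norm_num) hs (posDef_toBlocks₁₁ hS) h4
  have G₁ : Frame workRegs {6, 9, 11, 12, 14, 15, 16} s s₁ := F₁.mono le_rfl (by intro x; simp; tauto)
  have C₁ := hs.frame F₁ (by simp)
  have h5₁ := F₁.stores (by simp) h5
  obtain ⟨s₂, r₂, F₂, -, h12⟩ := runs_fill s₁ (a := 12) (r := 1) (q := 0) (l := 0)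
    (e := .mul (.arr 5 (.reg 2) (.reg 4)) (.arr 11 (.reg 4) (.reg 3))) (f := .reg 0)
    (by simp) (by simp) (by simp) (by simp [RExp.usesReg]) (by simp [RExp.usesArr])
    (by simp [RExp.usesArr]) C₁.size_T C₁.size_F C₁.size_F volume_TFF
    (S.toBlocks₂₁ * S.toBlocks₁₁⁻¹) (fun i j => by
      simp [RExp.eval, IExp.eval, Mem.loopAt, Mem.setIReg, Mem.setRReg, Matrix.mul_apply, h5₁.eq,
        h11.eq])
  have G₂ : Frame workRegs {6, 9, 11, 12, 14, 15, 16} s s₂ := G₁.trans (F₂.mono le_rfl (by simp))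
  have C₂ := C₁.frame F₂ (by simp)
  have h0₂ := G₂.stores (by simp) h0
  have h5₂ := G₂.stores (by simp) h5
  obtain ⟨s₃, r₃, F₃, -, h14⟩ := runs_fill s₂ (a := 14) (r := 1) (q := 1) (l := 0)
    (e := .mul (.arr 12 (.reg 2) (.reg 4)) (.arr 5 (.reg 3) (.reg 4)))
    (f := .sub (.arr 0 (.reg 2) (.reg 3)) (.reg 0))
    (by simp) (by simp) (by simp) (by simp [RExp.usesReg]) (by simp [RExp.usesArr])
    (by simp [RExp.usesArr]) C₂.size_T C₂.size_T C₂.size_F volume_TTF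
    A (fun i j => by
      rw [hA, correction, Matrix.sub_apply, Matrix.mul_apply]
      simp [RExp.eval, IExp.eval, Mem.loopAt, Mem.setIReg, Mem.setRReg, h0₂.eq, h12.eq, h5₂.eq])
  have G₃ : Frame workRegs {6, 9, 11, 12, 14, 15, 16} s s₃ := G₂.trans (F₃.mono le_rfl (by simp))
  have C₃ := C₂.frame F₃ (by simp)
  have hTT : (m + 1) * (m + 1) * (0 + 1) ≤ volume k m := by simpa using volume_TT
  -- The squared correlation orders the edges as |ρ| does and needs no square root.
  obtain ⟨s₄, r₄, F₄, -, h15⟩ := runs_fill s₃ (a := 15) (r := 1) (q := 1) (l := 10)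
    (e := .const 0)
    (f := .div (.mul (.arr 14 (.reg 2) (.reg 3)) (.arr 14 (.reg 2) (.reg 3)))
        (.mul (.arr 14 (.reg 2) (.reg 2)) (.arr 14 (.reg 3) (.reg 3))))
    (by simp) (by simp) (by simp) (by simp [RExp.usesReg]) (by simp [RExp.usesArr])
    (by simp [RExp.usesArr]) C₃.size_T C₃.size_T C₃.zero hTT
    (Matrix.of fun i j => |corr A i j| ^ 2) (fun i j => by
      rw [Matrix.of_apply, sq_corr hAp]
      simp [RExp.eval, IExp.eval, Mem.loopAt, Mem.setIReg, Mem.setRReg, h14.eq, sq])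
  have G₄ : Frame workRegs {6, 9, 11, 12, 14, 15, 16} s s₄ := G₃.trans (F₄.mono le_rfl (by simp))
  have C₄ := C₃.frame F₄ (by simp)
  have h14₄ := F₄.stores (by simp) h14
  obtain ⟨s₅, r₅, F₅, vis, par, C, hP, h16, hpar⟩ := runs_prim s₄ hm C₄.size_T h14₄ h15
    (w := fun i j => |corr A i j|) (fun i j => by rw [corr_symm hAp])
    (fun i j i' j' => sq_le_sq₀ (abs_nonneg _) (abs_nonneg _))
  have F₅' : Frame workRegs {16} s₄ s₅ := F₅.mono (by intro x; simp [workRegs]; tauto) le_rfl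
  have G₅ : Frame workRegs {6, 9, 11, 12, 14, 15, 16} s s₅ := G₄.trans (F₅'.mono le_rfl (by simp))
  have C₅ := C₄.frame F₅' (by simp)
  have h14₅ := F₅'.stores (by simp) h14₄
  have h0₅ := G₅.stores (by simp) h0
  -- The correction is recovered as the difference of the observed covariance and its Schur
  -- complement.
  obtain ⟨s₆, r₆, F₆, n₆, h6⟩ := runs_fill s₅ (a := 6) (r := 1) (q := 1) (l := 10)
    (e := .const 0)
    (f := .add (.arr 16 (.reg 2) (.reg 3))
      (.sub (.arr 0 (.reg 2) (.reg 3)) (.arr 14 (.reg 2) (.reg 3))))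
    (by simp) (by simp) (by simp) (by simp [RExp.usesReg]) (by simp [RExp.usesArr])
    (by simp [RExp.usesArr]) C₅.size_T C₅.size_T C₅.zero hTT
    (C + correction S) (fun i j => by
      simp [RExp.eval, IExp.eval, Mem.loopAt, Mem.setIReg, Mem.setRReg, h14₅.eq, h16.eq, h0₅.eq, hA])
  refine ⟨s₆, (r₁.seq (r₂.seq (r₃.seq (r₄.seq (r₅.seq r₆))))).mono ?_,
    G₅.trans (F₆.mono le_rfl (by simp)), ?_, ?_, F₆.stores (by simp) h14₅, vis, par, C, hP, h6,
    fun v => by rw [n₆, hpar]⟩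
  · have h := Nat.mul_le_mul (le_refl 200) (volume_TT (k := k) (m := m))
    simp only [fillSumCost, RExp.cost, IExp.cost]
    omega
  · exact F₆.stores (by simp) (F₅'.stores (by simp) (F₄.stores (by simp) (F₃.stores (by simp)
      (F₂.stores (by simp) h11))))
  · exact F₆.stores (by simp) (F₅'.stores (by simp) (F₄.stores (by simp) (F₃.stores (by simp)
      h12)))

-- The value m stored as parent of the root equals no node index, so the root needs no separate
-- case, and for every edge exactly one of the two indicators is 1.
open Classical in
theorem PrimState.ite_adj {r : Fin m} {vis : Fin m → ℕ} {par : Fin m → Fin m}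
    {w : Fin m → Fin m → ℝ} {A C : Matrix (Fin m) (Fin m) ℝ} (h : PrimState w A r m vis par C)
    (i j : Fin m) :
    ((if (if i = r then m else (par i : ℕ)) = j then 1 else 0) +
      (if (if j = r then m else (par j : ℕ)) = i then 1 else 0) : ℝ) =
      if (parentGraph r par).Adj i j then 1 else 0 := by
  have h' : PrimState w A r (Fintype.card (Fin m)) vis par C := by simpa using h
  have hlt := fun v (hv : v ≠ r) => h.par_lt v hv (h'.visited v)
  have key : ∀ i j : Fin m, (if i = r then m else (par i : ℕ)) = j ↔ i ≠ r ∧ par i = j := by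
    intro i j
    by_cases hi : i = r
    · have := j.2
      simp only [hi, if_true, ne_eq, not_true_eq_false, false_and, iff_false]
      omega
    · simp [hi, Fin.ext_iff]
  have hne : ∀ i j : Fin m, i ≠ r ∧ par i = j → i ≠ j := by
    rintro i j ⟨hi, rfl⟩ he
    have := hlt i hi
    rw [← he] at this
    exact lt_irrefl _ this
  have hnot : ∀ i j : Fin m, i ≠ r ∧ par i = j → ¬ (j ≠ r ∧ par j = i) := by
    rintro i j ⟨hi, rfl⟩ ⟨hj, he⟩
    have h1 := hlt i hi
    have h2 := hlt _ hj
    rw [he] at h2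
    omega
  have hadj : (parentGraph r par).Adj i j ↔ (i ≠ r ∧ par i = j) ∨ (j ≠ r ∧ par j = i) :=
    ⟨fun h => h.2, fun h => ⟨h.elim (hne i j) fun h => (hne j i h).symm, h⟩⟩
  simp only [key, hadj]
  by_cases h1 : i ≠ r ∧ par i = j
  · simp only [if_pos h1, if_neg (hnot i j h1), if_pos (Or.inl h1 : _ ∨ (j ≠ r ∧ par j = i)),
      add_zero]
  · by_cases h2 : j ≠ r ∧ par j = i
    · simp only [if_neg h1, if_pos h2, if_pos (Or.inr h2 : (i ≠ r ∧ par i = j) ∨ _), zero_add]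
    · simp only [if_neg h1, if_neg h2, if_neg (not_or.2 ⟨h1, h2⟩), add_zero]

/-- The adjacency indicator of the tree given by the parents in index array 1. -/
def adjExp (x y : ℕ) : RExp :=
  .add (delta (.arr 1 (.reg x)) (.reg y)) (delta (.arr 1 (.reg y)) (.reg x))

open Classical in
theorem adjExp_eval {s : Mem} {n : ℕ} (hδ : HasDelta s n) (hn : m ≤ n) {r : Fin m}
    {vis : Fin m → ℕ} {par : Fin m → Fin m} {w : Fin m → Fin m → ℝ}
    {A C : Matrix (Fin m) (Fin m) ℝ} (h : PrimState w A r m vis par C)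
    (hpar : ∀ v : Fin m, s.narr 1 v = if v = r then m else par v) {x y : ℕ} {i j : Fin m}
    (hx : s.nreg x = i) (hy : s.nreg y = j) :
    (adjExp x y).eval s = if (parentGraph r par).Adj i j then 1 else 0 := by
  have hle : ∀ v : Fin m, s.narr 1 v ≤ n := by
    intro v
    rw [hpar]
    split_ifs
    · exact hn
    · exact (par v).2.le.trans hn
  have e1 := hδ.eval (e₁ := .arr 1 (.reg x)) (e₂ := .reg y)
    (by simpa only [IExp.eval, hx] using hle i) (by simp only [IExp.eval, hy]; omega)
  have e2 := hδ.eval (e₁ := .arr 1 (.reg y)) (e₂ := .reg x)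
    (by simpa only [IExp.eval, hy] using hle j) (by simp only [IExp.eval, hx]; omega)
  simp only [IExp.eval, hx, hy, hpar] at e1 e2
  rw [← h.ite_adj i j, adjExp, RExp.eval, e1, e2]

/-- The precision matrix of the tree model: matrix 3 receives the inverse of matrix 16. -/
def precision : Prog :=
  .seq (fillSum 17 1 1 10 (.const 0)
    (.add (.sub (.mul (.arr 14 (.reg 2) (.reg 2)) (.arr 14 (.reg 3) (.reg 3)))
      (.mul (.arr 14 (.reg 2) (.reg 3)) (.arr 14 (.reg 2) (.reg 3))))
      (delta (.reg 2) (.reg 3)))) (.seq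
    (fillSum 18 1 11 1
      (.div (.mul (adjExp 2 4) (.mul (.arr 14 (.reg 2) (.reg 4)) (.arr 14 (.reg 2) (.reg 4))))
        (.mul (.arr 14 (.reg 2) (.reg 2)) (.arr 17 (.reg 2) (.reg 4))))
      (.add (.div (.const 1) (.arr 14 (.reg 2) (.reg 2))) (.reg 0)))
    (fillSum 3 1 1 10 (.const 0)
      (.sub (.mul (delta (.reg 2) (.reg 3)) (.arr 18 (.reg 2) (.const 0)))
        (.div (.mul (adjExp 2 3) (.arr 14 (.reg 2) (.reg 3))) (.arr 17 (.reg 2) (.reg 3))))))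

theorem runs_precision (s : Mem) (hs : Constants s k m) {r : Fin m}
    {vis : Fin m → ℕ} {par : Fin m → Fin m} {w : Fin m → Fin m → ℝ}
    {A C : Matrix (Fin m) (Fin m) ℝ} (hP : PrimState w A r m vis par C)
    (hpar : ∀ v : Fin m, s.narr 1 v = if v = r then m else par v) (h14 : s.Stores 14 A) :
    ∃ s', Runs precision s (400 * volume k m) s' ∧ Frame workRegs {3, 17, 18} s s' ∧
      s'.Stores 3 (treePrec (parentGraph r par) A) := by
  classical
  have hTT : (m + 1) * (m + 1) * (0 + 1) ≤ volume k m := by simpa using volume_TT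
  have hT1T : (m + 1) * (1 + 1) * (m + 1) ≤ 2 * volume k m := by
    have := volume_TT (k := k) (m := m)
    nlinarith
  have hδ : ∀ s' : Mem, HasDelta s' (k + m) → ∀ {x y : ℕ} {i j : Fin m}, s'.nreg x = i →
      s'.nreg y = j → (delta (.reg x) (.reg y)).eval s' = if i = j then 1 else 0 := by
    intro s' hs' x y i j hx hy
    have := hs'.eval (e₁ := .reg x) (e₂ := .reg y) (by simp only [IExp.eval, hx]; omega)
      (by simp only [IExp.eval, hy]; omega)
    simpa only [IExp.eval, hx, hy, ← Fin.ext_iff] using this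
  -- On the diagonal the 2 × 2 minor is zero; adding 1 there spares the program a division by zero
  -- and changes nothing at edges.
  let Δ : Matrix (Fin m) (Fin m) ℝ := Matrix.of fun i j =>
    A i i * A j j - A i j ^ 2 + if i = j then 1 else 0
  have hΔ : ∀ i j (x : ℝ), (if (parentGraph r par).Adj i j then 1 else 0) * x / Δ i j =
      if (parentGraph r par).Adj i j then x / (A i i * A j j - A i j ^ 2) else 0 := by
    intro i j x
    split_ifs with h
    · simp [Δ, h.ne]
    · simp
  obtain ⟨s₁, r₁, F₁, n₁, h17⟩ := runs_fill s (a := 17) (r := 1) (q := 1) (l := 10)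
    (e := .const 0)
    (f := .add (.sub (.mul (.arr 14 (.reg 2) (.reg 2)) (.arr 14 (.reg 3) (.reg 3)))
      (.mul (.arr 14 (.reg 2) (.reg 3)) (.arr 14 (.reg 2) (.reg 3))))
      (delta (.reg 2) (.reg 3)))
    (by simp) (by simp) (by simp) (by simp [RExp.usesReg]) (by simp [RExp.usesArr])
    (by simp [RExp.usesArr, delta]) hs.size_T hs.size_T hs.zero hTT Δ (fun i j => by
      set s' := (s.loopAt i j 0).setRReg 0 (∑ t : Fin 0, (RExp.const 0).eval (s.loopAt i j t))
        with hs'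
      have e2 : s'.nreg 2 = i := by simp [hs', Mem.loopAt, Mem.setIReg, Mem.setRReg]
      have e3 : s'.nreg 3 = j := by simp [hs', Mem.loopAt, Mem.setIReg, Mem.setRReg]
      have er : s'.rarr = s.rarr := rfl
      have d := hδ s' hs.delta e2 e3
      simp only [RExp.eval, IExp.eval, d, e2, e3, er, h14.eq, Δ, sq, Matrix.of_apply])
  have C₁ := hs.frame F₁ (by simp)
  have G₁ : Frame workRegs {3, 17, 18} s s₁ := F₁.mono le_rfl (by simp)
  have h14₁ := F₁.stores (by simp) h14
  have hpar₁ : ∀ v : Fin m, s₁.narr 1 v = if v = r then m else par v := by rwa [n₁]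
  let d₁ : Fin m → ℝ := fun i => 1 / A i i + ∑ l, (if (parentGraph r par).Adj i l then
    A i l ^ 2 / (A i i * (A i i * A l l - A i l ^ 2)) else 0)
  -- The sum over neighbours runs over all nodes with the adjacency indicator as a factor. The
  -- result is a single column, register 11 holding its width 1, so the cost stays quadratic in m.
  obtain ⟨s₂, r₂, F₂, n₂, h18⟩ := runs_fill s₁ (a := 18) (r := 1) (q := 11) (l := 1)
    (e := .div (.mul (adjExp 2 4) (.mul (.arr 14 (.reg 2) (.reg 4)) (.arr 14 (.reg 2) (.reg 4))))
        (.mul (.arr 14 (.reg 2) (.reg 2)) (.arr 17 (.reg 2) (.reg 4))))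
    (f := .add (.div (.const 1) (.arr 14 (.reg 2) (.reg 2))) (.reg 0))
    (by simp) (by simp) (by simp) (by simp [RExp.usesReg, adjExp, delta])
    (by simp [RExp.usesArr, adjExp, delta])
    (by simp [RExp.usesArr]) C₁.size_T C₁.one C₁.size_T hT1T
    (Matrix.of fun i _ => d₁ i) (fun i j => by
      have he : ∀ t : Fin m, (RExp.div (.mul (adjExp 2 4) (.mul (.arr 14 (.reg 2) (.reg 4))
          (.arr 14 (.reg 2) (.reg 4)))) (.mul (.arr 14 (.reg 2) (.reg 2))
          (.arr 17 (.reg 2) (.reg 4)))).eval (s₁.loopAt i j t) =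
          if (parentGraph r par).Adj i t then
            A i t ^ 2 / (A i i * (A i i * A t t - A i t ^ 2)) else 0 := by
        intro t
        set s' := s₁.loopAt i j t with hs'
        have e2 : s'.nreg 2 = i := by simp [hs', Mem.loopAt, Mem.setIReg]
        have e4 : s'.nreg 4 = t := by simp [hs', Mem.loopAt, Mem.setIReg]
        have er : s'.rarr = s₁.rarr := rfl
        have d := adjExp_eval (s := s') C₁.delta (by omega) hP hpar₁ e2 e4
        simp only [RExp.eval, IExp.eval, d, e2, e4, er, h14₁.eq, h17.eq]
        have := hΔ i t (A i t ^ 2 / A i i)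
        rw [← mul_div_assoc, div_div] at this
        rw [← sq, this]
        simp only [div_div]
      rw [Finset.sum_congr rfl fun t _ => he t]
      simp [RExp.eval, IExp.eval, Mem.loopAt, Mem.setIReg, Mem.setRReg, h14₁.eq, d₁])
  have C₂ := C₁.frame F₂ (by simp)
  have G₂ : Frame workRegs {3, 17, 18} s s₂ := G₁.trans (F₂.mono le_rfl (by simp))
  have h14₂ := F₂.stores (by simp) h14₁
  have h17₂ := F₂.stores (by simp) h17
  have hpar₂ : ∀ v : Fin m, s₂.narr 1 v = if v = r then m else par v := by rwa [n₂]
  obtain ⟨s₃, r₃, F₃, n₃, h3⟩ := runs_fill s₂ (a := 3) (r := 1) (q := 1) (l := 10)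
    (e := .const 0)
    (f := .sub (.mul (delta (.reg 2) (.reg 3)) (.arr 18 (.reg 2) (.const 0)))
        (.div (.mul (adjExp 2 3) (.arr 14 (.reg 2) (.reg 3))) (.arr 17 (.reg 2) (.reg 3))))
    (by simp) (by simp) (by simp) (by simp [RExp.usesReg]) (by simp [RExp.usesArr])
    (by simp [RExp.usesArr, delta, adjExp]) C₂.size_T C₂.size_T C₂.zero hTT
    (treePrec (parentGraph r par) A) (fun i j => by
      set s' := (s₂.loopAt i j 0).setRReg 0 (∑ t : Fin 0, (RExp.const 0).eval (s₂.loopAt i j t))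
        with hs'
      have e2 : s'.nreg 2 = i := by simp [hs', Mem.loopAt, Mem.setIReg, Mem.setRReg]
      have e3 : s'.nreg 3 = j := by simp [hs', Mem.loopAt, Mem.setIReg, Mem.setRReg]
      have er : s'.rarr = s₂.rarr := rfl
      have d := hδ s' C₂.delta e2 e3
      have d' := adjExp_eval (s := s') C₂.delta (by omega) hP hpar₂ e2 e3
      have e18 : s₂.rarr 18 i 0 = d₁ i := h18.eq i 0
      simp only [RExp.eval, IExp.eval, d, d', e2, e3, er, h14₂.eq, h17₂.eq, e18]
      rw [hΔ, ite_mul, one_mul, zero_mul]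
      simp only [treePrec, d₁])
  refine ⟨s₃, (r₁.seq (r₂.seq r₃)).mono ?_, G₂.trans (F₃.mono le_rfl (by simp)), h3⟩
  simp only [fillSumCost, RExp.cost, IExp.cost, adjExp, delta]
  omega

/-- Matrices 1 and 2 receive the latent blocks of the information matrix. -/
def recover : Prog :=
  .seq (fillSum 2 1 0 1 (.mul (.arr 3 (.reg 2) (.reg 4)) (.arr 12 (.reg 4) (.reg 3)))
      (.sub (.const 0) (.reg 0)))
    (fillSum 1 0 0 1 (.mul (.arr 12 (.reg 4) (.reg 2)) (.arr 2 (.reg 4) (.reg 3)))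
      (.sub (.arr 11 (.reg 2) (.reg 3)) (.reg 0)))

/-- Used with P = J_T, R the regression matrix and Y = Σ_F⁻¹, where the two results are the blocks
J_M and J_F of the inverse covariance. -/
theorem runs_recover (s : Mem) (hs : Constants s k m) {P : Matrix (Fin m) (Fin m) ℝ}
    {R : Matrix (Fin m) (Fin k) ℝ} {Y : Matrix (Fin k) (Fin k) ℝ} (h3 : s.Stores 3 P)
    (h12 : s.Stores 12 R) (h11 : s.Stores 11 Y) :
    ∃ s', Runs recover s (100 * volume k m) s' ∧ Frame workRegs {1, 2} s s' ∧
      s'.Stores 2 (-(P * R)) ∧ s'.Stores 1 (Y - Rᵀ * -(P * R)) := by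
  obtain ⟨s₁, r₁, F₁, -, h2⟩ := runs_fill s (a := 2) (r := 1) (q := 0) (l := 1)
    (e := .mul (.arr 3 (.reg 2) (.reg 4)) (.arr 12 (.reg 4) (.reg 3)))
    (f := .sub (.const 0) (.reg 0))
    (by simp) (by simp) (by simp) (by simp [RExp.usesReg]) (by simp [RExp.usesArr])
    (by simp [RExp.usesArr]) hs.size_T hs.size_F hs.size_T volume_TFT (-(P * R)) (fun i j => by
      rw [Matrix.neg_apply, Matrix.mul_apply]
      simp [RExp.eval, IExp.eval, Mem.loopAt, Mem.setIReg, Mem.setRReg, h3.eq, h12.eq])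
  have C₁ := hs.frame F₁ (by simp)
  have h12₁ := F₁.stores (by simp) h12
  have h11₁ := F₁.stores (by simp) h11
  obtain ⟨s₂, r₂, F₂, -, h1⟩ := runs_fill s₁ (a := 1) (r := 0) (q := 0) (l := 1)
    (e := .mul (.arr 12 (.reg 4) (.reg 2)) (.arr 2 (.reg 4) (.reg 3)))
    (f := .sub (.arr 11 (.reg 2) (.reg 3)) (.reg 0))
    (by simp) (by simp) (by simp) (by simp [RExp.usesReg]) (by simp [RExp.usesArr])
    (by simp [RExp.usesArr]) C₁.size_F C₁.size_F C₁.size_T volume_FFT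
    (Y - Rᵀ * -(P * R)) (fun i j => by
      rw [Matrix.sub_apply, Matrix.mul_apply]
      simp [RExp.eval, IExp.eval, Mem.loopAt, Mem.setIReg, Mem.setRReg, h2.eq, h12₁.eq, h11₁.eq])
  refine ⟨s₂, (r₁.seq r₂).mono ?_, (F₁.mono le_rfl (by simp)).trans (F₂.mono le_rfl (by simp)),
    F₂.stores (by simp) h2, h1⟩
  simp only [fillSumCost, RExp.cost, IExp.cost]
  omega

/-- One iteration of the latent Chow-Liu algorithm. -/
def iteration : Prog :=
  .seq setup (.seq project (.seq condition (.seq precision recover)))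

theorem runs_iteration (s : Mem) (hm : 0 < m) {ST : Matrix (Fin m) (Fin m) ℝ} (hST : ST.PosDef)
    {J : Matrix (Fin k ⊕ Fin m) (Fin k ⊕ Fin m) ℝ} (hJ : J.PosDef) (hs : s.Encodes ST J) :
    ∃ S' s', IsCCL (projCov ST J) S' ∧ Runs iteration s (2000 * volume k m) s' ∧
      s'.Encodes ST S'⁻¹ ∧ s'.EncodesCov S' := by
  obtain ⟨s₁, r₁, C₁, F₁⟩ := runs_setup s hs.size_F hs.size_T
  have k₁ : ∀ a, a ≠ 7 → ∀ {p q : ℕ} {M : Matrix (Fin p) (Fin q) ℝ}, s.Stores a M →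
      s₁.Stores a M := fun a ha p q M h i j => by rw [F₁ a ha, h i j]
  have h0₁ := k₁ 0 (by norm_num) hs.empirical
  obtain ⟨s₂, r₂, F₂, h4, h5⟩ := runs_project s₁ C₁ hST hJ h0₁ (k₁ 1 (by norm_num) hs.info_F)
    (k₁ 2 (by norm_num) hs.info_M)
  have C₂ := C₁.frame F₂ (by simp)
  have h0₂ := F₂.stores (by simp) h0₁
  set S := projCov ST J with hS
  have hSp : S.PosDef := posDef_projCov hST hJ
  have h22 : S.toBlocks₂₂ = ST := projCov_toBlocks₂₂ hST hJ
  obtain ⟨s₃, r₃, F₃, h11, h12, h14, vis, par, C, hP, h6, hpar⟩ :=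
    runs_condition s₂ hm C₂ hSp (by rwa [h22]) h4 h5
  have C₃ := C₂.frame F₃ (by simp)
  have h0₃ := F₃.stores (by simp) h0₂
  obtain ⟨s₄, r₄, F₄, h3⟩ := runs_precision s₃ C₃ hP hpar h14
  have C₄ := C₃.frame F₄ (by simp)
  obtain ⟨s₅, r₅, F₅, h2, h1⟩ := runs_recover s₄ C₄ h3 (F₄.stores (by simp) h12)
    (F₄.stores (by simp) h11)
  have C₅ := C₄.frame F₅ (by simp)
  set S' := fromBlocks S.toBlocks₁₁ S.toBlocks₂₁ᵀ S.toBlocks₂₁ (C + correction S) with hS'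
  have hA : (S.toBlocks₂₂ - correction S).PosDef := posDef_schur hSp
  have hCL : IsChowLiu (S.toBlocks₂₂ - correction S) (parentGraph ⟨0, hm⟩ par) C :=
    PrimState.isChowLiu (vis := vis) hA (by simpa using hP)
  have hCCL : IsCCL S S' := ⟨_, C, hCL, hS'⟩
  have hS'p := hCCL.posDef hSp
  have i22 : S'⁻¹.toBlocks₂₂ = treePrec (parentGraph ⟨0, hm⟩ par) (S.toBlocks₂₂ - correction S) := by
    rw [inv_toBlocks₂₂ hS'p, hS', correction_fromBlocks, toBlocks_fromBlocks₂₂, ← correction,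
      add_sub_cancel_right, hCL.inv_eq hA]
  have i21 : S'⁻¹.toBlocks₂₁ = -(S'⁻¹.toBlocks₂₂ * (S.toBlocks₂₁ * S.toBlocks₁₁⁻¹)) := by
    rw [inv_toBlocks₂₁ hS'p]
    simp [hS']
  have i11 : S'⁻¹.toBlocks₁₁ =
      S.toBlocks₁₁⁻¹ - (S.toBlocks₂₁ * S.toBlocks₁₁⁻¹)ᵀ * S'⁻¹.toBlocks₂₁ := by
    rw [inv_toBlocks₁₁ hS'p]
    simp [hS']
  refine ⟨S', s₅, hCCL, (r₁.seq (r₂.seq (r₃.seq (r₄.seq r₅)))).mono (by omega),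
    ⟨C₅.size_F, C₅.size_T, F₅.stores (by simp) (F₄.stores (by simp) h0₃), ?_, ?_, ?_⟩, ?_, ?_, ?_⟩
  · rw [i11, i21, i22]
    exact h1
  · rw [i21, i22]
    exact h2
  · rw [i22]
    exact F₅.stores (by simp) h3
  · rw [hS', toBlocks_fromBlocks₁₁]
    exact F₅.stores (by simp) (F₄.stores (by simp) (F₃.stores (by simp) h4))
  · rw [hS', toBlocks_fromBlocks₂₁]
    exact F₅.stores (by simp) (F₄.stores (by simp) (F₃.stores (by simp) h5))
  · rw [hS', toBlocks_fromBlocks₂₂]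
    exact F₅.stores (by simp) (F₄.stores (by simp) h6)

/-- The volume is of the order `k n² + n² log n`. -/
theorem volume_le (hn : 2 ≤ k + m) :
    (volume k m : ℝ) ≤ 8 * ((k : ℝ) * ((k : ℝ) + m) ^ 2 +
      ((k : ℝ) + m) ^ 2 * Real.log ((k : ℝ) + m)) := by
  have h2 : (2 : ℝ) ≤ (k : ℝ) + m := by exact_mod_cast hn
  have hk : (0 : ℝ) ≤ k := Nat.cast_nonneg k
  have hlog : (1 / 2 : ℝ) ≤ Real.log ((k : ℝ) + m) := by
    have h := Real.log_le_log (by norm_num) h2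
    have := Real.log_two_gt_d9
    linarith
  have e : (volume k m : ℝ) = ((k : ℝ) + m + 1) ^ 2 * (k + 1) := by
    simp only [volume]
    push_cast
    ring
  rw [e]
  set n : ℝ := (k : ℝ) + m
  have h3 : (n + 1) ^ 2 ≤ 4 * n ^ 2 := by nlinarith
  -- The summand 1 is absorbed by 2 log n, which is at least 1 for n ≥ 2. This covers k = 0, where
  -- the logarithmic term carries the whole bound.
  have h4 : (k : ℝ) + 1 ≤ 2 * (k + Real.log n) := by linarith
  calc (n + 1) ^ 2 * ((k : ℝ) + 1) ≤ (4 * n ^ 2) * (2 * (k + Real.log n)) :=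
        mul_le_mul h3 h4 (by linarith) (by positivity)
    _ = 8 * (k * n ^ 2 + n ^ 2 * Real.log n) := by ring

/-- One program carries out each iteration of the latent Chow-Liu algorithm. -/
theorem exists_program : ∃ (prog : Prog) (C : ℝ),
      ∀ (k m : ℕ), 0 < m → 2 ≤ k + m → ∀ (ST : Matrix (Fin m) (Fin m) ℝ), ST.PosDef →
        ∀ J₀ : Matrix (Fin k ⊕ Fin m) (Fin k ⊕ Fin m) ℝ, HasFVS J₀ →
          ∀ s₀ : Mem, s₀.Encodes ST J₀ →
            ∃ (J S : ℕ → Matrix (Fin k ⊕ Fin m) (Fin k ⊕ Fin m) ℝ) (s : ℕ → Mem) (c : ℕ → ℕ),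
              IsRun ST J S ∧ J 0 = J₀ ∧ s 0 = s₀ ∧
                ∀ t : ℕ,
                  Exec prog (s t) (c t) (s (t + 1)) ∧
                  (s (t + 1)).Encodes ST (J (t + 1)) ∧ (s (t + 1)).EncodesCov (S (t + 1)) ∧
                  (c t : ℝ) ≤ C * ((k : ℝ) * ((k : ℝ) + (m : ℝ)) ^ 2 +
                    ((k : ℝ) + (m : ℝ)) ^ 2 * Real.log ((k : ℝ) + (m : ℝ))) := by
  -- The constant is 2000 from `runs_iteration` times 8 from `volume_le`.
  refine ⟨iteration, 16000, fun k m hm hn ST hST J₀ hJ₀ s₀ hs₀ => ?_⟩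
  -- A state pairs a covariance matrix with a memory encoding its inverse. One iteration maps states
  -- to states, so iterating a chosen successor produces the run and the sequence of memories
  -- together, starting from the inverse of `J₀`.
  let State := {x : Matrix (Fin k ⊕ Fin m) (Fin k ⊕ Fin m) ℝ × Mem //
    HasFVS x.1⁻¹ ∧ x.2.Encodes ST x.1⁻¹}
  have hstep : ∀ x : State, ∃ (y : State) (c : ℕ), IsCCL (projCov ST x.1.1⁻¹) y.1.1 ∧
      c ≤ 2000 * volume k m ∧ Exec iteration x.1.2 c y.1.2 ∧ y.1.2.EncodesCov y.1.1 := by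
    rintro ⟨⟨S, s⟩, hF, hE⟩
    obtain ⟨S', s', h1, ⟨c, hc, h2⟩, h3, h4⟩ := runs_iteration s hm hST hF.1 hE
    exact ⟨⟨(S', s'), h1.hasFVS (posDef_projCov hST hF.1), h3⟩, c, h1, hc, h2, h4⟩
  choose next c hccl hc hexec hcov using hstep
  have hinv : (J₀⁻¹)⁻¹ = J₀ := Matrix.nonsing_inv_nonsing_inv _ hJ₀.1.det_pos.ne'.isUnit
  let x : ℕ → State := fun t => next^[t] ⟨(J₀⁻¹, s₀), by simpa only [hinv] using ⟨hJ₀, hs₀⟩⟩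
  have hx : ∀ t, x (t + 1) = next (x t) := fun t => Function.iterate_succ_apply' _ _ _
  refine ⟨fun t => (x t).1.1⁻¹, fun t => (x t).1.1, fun t => (x t).1.2, fun t => c (x t),
    ⟨?_, ?_, fun t => ?_, fun t => rfl⟩, hinv, rfl, fun t => ⟨?_, (x (t + 1)).2.2, ?_, ?_⟩⟩
  · exact (x 0).2.1
  · exact hinv.symm ▸ rfl
  · simp only [hx]
    exact hccl (x t)
  · simp only [hx]
    exact hexec (x t)
  · simp only [hx]
    exact hcov (x t)
  · have h1 : (c (x t) : ℝ) ≤ 2000 * volume k m := by exact_mod_cast hc (x t)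
    have h2 := volume_le hn
    linarith

end Iteration

end

end LatentChowLiu

open LatentChowLiu in
theorem proposition2 :
    -- every run: the second projection is exact, and the divergence does not increase
    (∀ (k m : ℕ), 0 < m → ∀ (ST : Matrix (Fin m) (Fin m) ℝ), ST.PosDef →
      ∀ J S : ℕ → Matrix (Fin k ⊕ Fin m) (Fin k ⊕ Fin m) ℝ, IsRun ST J S →
        ∀ t : ℕ,
          ((projCov ST (J t)).PosDef ∧ (S (t + 1)).PosDef ∧ HasFVS (J (t + 1)) ∧
            gauss (S (t + 1)) ∈ familyQ (Fin k) (Fin m) ∧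
            IsMinOn (fun q => InformationTheory.klDiv (gauss (projCov ST (J t))) q)
              (familyQ (Fin k) (Fin m)) (gauss (S (t + 1)))) ∧
          InformationTheory.klDiv (gauss ST) (gauss (S (t + 1)).toBlocks₂₂) ≤
            InformationTheory.klDiv (gauss ST) (gauss (S t).toBlocks₂₂)) ∧
    -- one program carries out each iteration within the stated number of steps
    (∃ (prog : Prog) (C : ℝ),
      ∀ (k m : ℕ), 0 < m → 2 ≤ k + m → ∀ (ST : Matrix (Fin m) (Fin m) ℝ), ST.PosDef →
        ∀ J₀ : Matrix (Fin k ⊕ Fin m) (Fin k ⊕ Fin m) ℝ, HasFVS J₀ →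
          ∀ s₀ : Mem, s₀.Encodes ST J₀ →
            ∃ (J S : ℕ → Matrix (Fin k ⊕ Fin m) (Fin k ⊕ Fin m) ℝ) (s : ℕ → Mem) (c : ℕ → ℕ),
              IsRun ST J S ∧ J 0 = J₀ ∧ s 0 = s₀ ∧
                ∀ t : ℕ,
                  Exec prog (s t) (c t) (s (t + 1)) ∧
                  (s (t + 1)).Encodes ST (J (t + 1)) ∧ (s (t + 1)).EncodesCov (S (t + 1)) ∧
                  (c t : ℝ) ≤ C * ((k : ℝ) * ((k : ℝ) + (m : ℝ)) ^ 2 +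
                    ((k : ℝ) + (m : ℝ)) ^ 2 * Real.log ((k : ℝ) + (m : ℝ)))) :=
  ⟨fun _ _ _ _ hST _ _ h t => ⟨h.projection_exact hST t, h.klDiv_le hST t⟩, exists_program⟩
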